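/- Let $A$ be a C*-algebra (not assumed unital or separable). Let $\mathrm{Tr}\colon A\to A/\overline{[A,A]}$ be the quotient map, where $\overline{[A,A]}$ is the closed linear span of the commutators $xy-yx$ with $x,y\in A$, and write $a\sim_{\mathrm{Tr}}b$ if $\mathrm{Tr}(a-b)=0$. Let $A^\sim=\mathbb{C}\oplus A$ (as a vector space) be the C*-algebra obtained from $A$ by adjoining a unit, and let $\mathrm{U}^0(A)$ be the group of unitaries of the form $1+x$, $x\in A$, that lie in the connected component of the identity of the unitary group of $A^\sim$ (if $A$ is unital, this is canonically the connected component of the identity of the unitary group of $A$). For $u,v\in \mathrm{U}^0(A)$ write $(u,v)=uvu^{-1}v^{-1}$. Exponentials of elements of $A$ are taken in $A^\sim$. Recall that $A$ has nuclear dimension at most $n$ if for every finite set $S\subseteq A$ and every $\varepsilon>0$ there exist finite-dimensional C*-algebras $F_0,\dots,F_n$, a completely positive contractive map $\psi\colon A\to F_0\oplus\cdots\oplus F_n$ and a completely positive map $\phi\colon F_0\oplus\cdots\oplus F_n\to A$ such that $\|\phi(\psi(a))-a\|<\varepsilon$ for all $a\in S$, and such that each restriction $\phi|_{F_i}$ is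 contractive and of order zero (that is, $\phi(x)\phi(y)=0$ whenever $x,y\in F_i$ are positive and $xy=0$). **Theorem.** Suppose that $A$ has nuclear dimension at most $1$. Let $h\in A$ be self-adjoint with $h\sim_{\mathrm{Tr}}0$, and let $\epsilon>0$. (i) There exist unitaries $v_j,w_j\in \mathrm{U}^0(A)$, $j=1,2,3,4$, and a self-adjoint $c\in A$ such that $$e^{ih}=\prod_{j=1}^4 (v_j,w_j)\cdot e^{ic},\qquad c\sim_{\mathrm{Tr}}0,\qquad \|c\|<\epsilon .$$ (ii) If $\|h\|<\frac{\pi}{2}$, then the unitaries in (i) may be chosen so that in addition $$\|v_j-1\|\le \|e^{ih}-1\|^{1/2}\quad\text{and}\quad \|w_j-1\|\le \|e^{ih}-1\|^{1/2}\qquad (j=1,2,3,4).$$ -/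

import Mathlib

open scoped CStarAlgebra commutatorElement

noncomputable section

namespace NucOne

universe u

section UniversalTrace

variable (A : Type u) [NonUnitalCStarAlgebra A]

/-- The closed linear span of the commutators `x * y - y * x` of `A`, that is, the closure of
`[A, A]`. -/
def commutatorClosure : Submodule ℂ A :=
  (Submodule.span ℂ {z : A | ∃ x y : A, z = x * y - y * x}).topologicalClosure

/-- The universal trace: the quotient map from `A` onto `A` modulo the closure of `[A, A]`. -/
def universalTrace : A →ₗ[ℂ] A ⧸ commutatorClosure A :=
  (commutatorClosure A).mkQ

variable {A}

/-- The relation `a ∼_Tr b`: the universal trace vanishes on `a - b`. -/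
def TrEquiv (a b : A) : Prop :=
  universalTrace A (a - b) = 0

end UniversalTrace

section NuclearDimension

variable {A B : Type*} [NonUnitalCStarAlgebra A] [PartialOrder A] [StarOrderedRing A]
  [NonUnitalCStarAlgebra B] [PartialOrder B] [StarOrderedRing B]

/-- A completely positive map is contractive. -/
def IsContractiveCP (φ : A →CP B) : Prop :=
  ∀ a : A, ‖φ a‖ ≤ ‖a‖

/-- A completely positive map has order zero: it preserves orthogonality of positive elements. -/
def IsOrderZero (φ : A →CP B) : Prop :=
  ∀ a b : A, 0 ≤ a → 0 ≤ b → a * b = 0 → φ a * φ b = 0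

/-- `A` has nuclear dimension at most `n` (Winter and Zacharias): the identity of `A` is
approximated, uniformly on finite sets, by compositions `A → F 0 ⊕ ⋯ ⊕ F n → A` where the `F i`
are finite dimensional C*-algebras, the first map is completely positive contractive, and the
second map is completely positive and restricts to a contractive map of order zero on each `F i`.

A completely positive map into (out of) a finite direct sum is given by its components
`ψ i` (`φ i`); since the norm of a direct sum is the maximum norm, the map into the sum is
contractive exactly if all `ψ i` are.  Finite sets and tolerances index the approximating net. -/
def NuclearDimensionLE (A : Type u) [NonUnitalCStarAlgebra A] [PartialOrder A]
    [StarOrderedRing A] (n : ℕ) : Prop :=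
  ∀ (S : Finset A) (ε : ℝ), 0 < ε →
    ∃ (F : Fin (n + 1) → Type) (_ : ∀ i, CStarAlgebra (F i)) (_ : ∀ i, PartialOrder (F i))
      (_ : ∀ i, StarOrderedRing (F i)) (_ : ∀ i, FiniteDimensional ℂ (F i))
      (ψ : ∀ i, A →CP F i) (φ : ∀ i, F i →CP A),
      (∀ i, IsContractiveCP (ψ i)) ∧
      (∀ i, IsContractiveCP (φ i) ∧ IsOrderZero (φ i)) ∧
      ∀ a ∈ S, ‖∑ i, φ i (ψ i a) - a‖ < ε

end NuclearDimension

section UnitaryGroup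

variable (A : Type u) [NonUnitalCStarAlgebra A]

/-- The homomorphism `U(A~) → ℂ` induced by the quotient map `A~ → ℂ`, where `A~ = ℂ ⊕ A` is the
C*-algebra obtained from `A` by adjoining a unit. -/
def scalarPart : unitary (Unitization ℂ A) →* ℂ :=
  (Unitization.fstHom ℂ A : Unitization ℂ A →* ℂ).comp (unitary (Unitization ℂ A)).subtype

/-- The group `U⁰(A)`: those elements of the connected component of the identity of `U(A~)` whose
scalar part is `1`, i.e. which are of the form `1 + x` with `x ∈ A`.  If `A` happens to be unital,
this is the connected component of the identity of `U(A)` through `v ↦ 1 + (v - 1_A)`; see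
`mem_U0_iff_of_unital`. -/
def U0 : Subgroup (unitary (Unitization ℂ A)) :=
  Subgroup.connectedComponentOfOne (unitary (Unitization ℂ A)) ⊓ (scalarPart A).ker

variable {A}

/-- The unitary `e^{ih}` of `A~`, for `h` a self-adjoint element of `A`. -/
def expI (h : selfAdjoint A) : unitary (Unitization ℂ A) :=
  selfAdjoint.expUnitary ⟨((h : A) : Unitization ℂ A), IsSelfAdjoint.inr (R := ℂ) h.2⟩

/-- For unital `B`, the group `U⁰(B)` is the connected component of the identity of `U(B)`. -/
theorem mem_U0_iff_of_unital {B : Type u} [CStarAlgebra B] (u : unitary (Unitization ℂ B)) :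
    u ∈ U0 B ↔ ∃ v ∈ Subgroup.connectedComponentOfOne (unitary B),
      (u : Unitization ℂ B) = 1 + (((v : B) - 1 : B) : Unitization ℂ B) := by
  constructor
  · rintro ⟨hu, hu1⟩
    let f : Unitization ℂ B →⋆ₐ[ℂ] B := Unitization.starLift (NonUnitalStarAlgHom.id ℂ B)
    have hf : Continuous f := map_continuous f
    let g : unitary (Unitization ℂ B) → unitary B := fun w =>
      ⟨f w, by
        have h1 := Unitary.star_mul_self_of_mem w.2
        have h2 := Unitary.mul_star_self_of_mem w.2
        rw [Unitary.mem_iff, ← map_star, ← map_mul, ← map_mul, h1, h2, map_one]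
        exact ⟨rfl, rfl⟩⟩
    have hg : Continuous g := (hf.comp continuous_subtype_val).subtype_mk _
    have hg1 : g 1 = 1 := Subtype.ext (map_one f)
    refine ⟨g u, ?_, ?_⟩
    · have := hg.image_connectedComponent_subset 1 ⟨u, hu, rfl⟩
      rw [hg1] at this
      exact this
    · have h1 : (u : Unitization ℂ B).fst = 1 := hu1
      have h2 : (g u : B) = 1 + (u : Unitization ℂ B).snd := by
        change algebraMap ℂ B (u : Unitization ℂ B).fst + (u : Unitization ℂ B).snd = _
        rw [h1, map_one]
      have h3 : (g u : B) - 1 = (u : Unitization ℂ B).snd := by rw [h2, add_sub_cancel_left]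
      rw [h3]
      ext
      · simp [h1]
      · simp
  · rintro ⟨v, hv, huv⟩
    let k : unitary B → Unitization ℂ B := fun w => 1 + (((w : B) - 1 : B) : Unitization ℂ B)
    have hk : Continuous k := by
      have : Continuous (fun b : B => (b : Unitization ℂ B)) :=
        (Unitization.isometry_inr (𝕜 := ℂ) (A := B)).continuous
      exact continuous_const.add (this.comp (continuous_subtype_val.sub continuous_const))
    have hmem : ∀ w, k w ∈ unitary (Unitization ℂ B) := by
      intro w
      have h1 := Unitary.star_mul_self_of_mem w.2
      have h2 := Unitary.mul_star_self_of_mem w.2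
      obtain ⟨y, hy⟩ : ∃ y : B, (w : B) - 1 = y := ⟨_, rfl⟩
      have hw : (w : B) = 1 + y := by rw [← hy, add_sub_cancel]
      have hky : k w = 1 + (y : Unitization ℂ B) := by simp only [k, hy]
      rw [hw, star_add, star_one] at h1 h2
      have h1' : y + (star y + star y * y) = 0 := by
        rw [← sub_eq_zero] at h1
        rw [← h1]
        noncomm_ring
      have h2' : star y + (y + y * star y) = 0 := by
        rw [← sub_eq_zero] at h2
        rw [← h2]
        noncomm_ring
      rw [Unitary.mem_iff, hky]
      constructor
      · calc star (1 + (y : Unitization ℂ B)) * (1 + (y : Unitization ℂ B))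
            = 1 + ((y + (star y + star y * y) : B) : Unitization ℂ B) := by
              simp only [star_add, star_one, Unitization.inr_add, Unitization.inr_mul,
                Unitization.inr_star]
              noncomm_ring
          _ = 1 := by rw [h1', Unitization.inr_zero, add_zero]
      · calc (1 + (y : Unitization ℂ B)) * star (1 + (y : Unitization ℂ B))
            = 1 + ((star y + (y + y * star y) : B) : Unitization ℂ B) := by
              simp only [star_add, star_one, Unitization.inr_add, Unitization.inr_mul,
                Unitization.inr_star]
              noncomm_ring
          _ = 1 := by rw [h2', Unitization.inr_zero, add_zero]
    let g : unitary B → unitary (Unitization ℂ B) := fun w => ⟨k w, hmem w⟩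
    have hg : Continuous g := hk.subtype_mk _
    have hg1 : g 1 = 1 := Subtype.ext (by simp [g, k])
    have hu : u = g v := Subtype.ext huv
    refine ⟨?_, ?_⟩
    · have := hg.image_connectedComponent_subset 1 ⟨v, hv, rfl⟩
      rw [hg1] at this
      rw [hu]
      exact this
    · change (u : Unitization ℂ B).fst = 1
      rw [huv, Unitization.fst_add, Unitization.fst_inr, Unitization.fst_one, add_zero]

end UnitaryGroup

end NucOne

end

/-!
Let `h` be a selfadjoint element of the closed span of the commutators of `A`.  The theorem holds
because `h` is approximately a sum of four self-commutators `x x⋆ - x⋆ x` of elements `x` with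
`x² = 0`, because the exponential of such a self-commutator is a commutator of two unitaries, and
because the errors can be collected in one exponential factor.

*Approximation.*  Nuclear dimension at most one provides completely positive contractions
`Φ i = φ i ∘ ψ i` for `i = 0, 1`, with sum near the identity, that factor through finite-dimensional
algebras `F i` and have `φ i` of order zero.  The form that bounds the defect of the module property
of `Φ i` is nonnegative and additive in `i`, and it vanishes for the identity map; hence each `Φ i`
is nearly a bimodule map (`norm_map_mul_sub_sq_le_of_sum`).  In particular `Φ 0 h` and `Φ 1 h`
nearly commute and nearly add up to `h`.  Moreover `Φ i` is nearly multiplicative up to a nearly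
central factor `Φ i (e e)`, with `e` from an approximate unit.  Approximate inversion of this factor
inside `F i` shows that `ψ i` sends a commutator to a commutator, up to an error that is small under
`φ i` (`IsOrderZero.norm_map_commutator_sub_le`).  Therefore `ψ i h` is a diagonal element whose
normalized traces at the simple summands are small wherever `φ i` is large.

*Self-commutators.*  A diagonal element with vanishing traces is the sum of two commuting
self-commutators of square-zero elements, with controlled norms: after a reordering of the
diagonal entries that keeps their partial sums bounded, these are summed up by shifts along linked
minimal projections, and the shifts at odd and at even places are pairwise orthogonal
(`IsMinimalPartition.exists_add_selfCommutators`).  An order zero map, multiplied by a function of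
its value at `1`, carries such a decomposition to `A` (`IsOrderZero.exists_selfCommutators`).
Together this gives `exists_selfCommutators_near`.

*One commutator.*  If `x² = 0`, then `d = x x⋆ - x⋆ x` anticommutes with `x - x⋆` and `x + x⋆`,
whose product is `d`.  This leads to explicit unitaries `v` and `w`, at distance at most
`√(3/4) ‖x‖` from `1` if `x` is not too large, with `(v, w) = e^{id}`
(`exists_commutator_eq_expUnitary_sq`, `exists_commutator_eq_expUnitary_selfCommutator`).

*Error term.*  Let `d₀` and `d₁` be the sums of self-commutators near `Φ 0 h` and `Φ 1 h`.  The
unitary `e^{-i d₁} e^{-i d₀} e^{ih}` is close to `1`, hence of the form `e^{ic}` with `c` small.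
That `c` lies in the closed span of the commutators follows by differentiation of the trace of the
logarithm along the path `t ↦ e^{-i t d₁} e^{-i t d₀} e^{i t h}` (`logTrace_sub_one_eq`,
`exists_expI_eq_mul_mul`).  As `d₀` and `d₁` are sums of two commuting self-commutators, the product
`e^{i d₀} e^{i d₁}` is a product of four commutators.

*Norms.*  The elements `x` satisfy `‖x‖² ≤ ‖h‖ + δ`, so that the unitaries satisfy
`‖v - 1‖² ≤ (3/4) (‖h‖ + δ)`.  For `δ = ‖h‖ / 10` this is at most
`2 sin (‖h‖ / 2) = ‖e^{ih} - 1‖`, provided that `‖h‖ < π / 2`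
(`mul_norm_le_norm_expI_sub_one`).
-/

noncomputable section

namespace NucOne

/-! ### Completely positive maps -/

section CompletelyPositive

variable {A B : Type*} [NonUnitalCStarAlgebra A] [PartialOrder A] [StarOrderedRing A]
  [NonUnitalCStarAlgebra B] [PartialOrder B] [StarOrderedRing B]

theorem exists_eq_star_mul_self {b : B} (hb : 0 ≤ b) : ∃ n : B, b = star n * n :=
  CStarAlgebra.nonneg_iff_eq_star_mul_self.1 hb

/-- The Kolmogorov decomposition of the positive kernel `(i, j) ↦ φ ((x i)⋆ x j)`. -/
theorem exists_gram_decomposition (φ : A →CP B) {n : ℕ} (x : Fin (n + 1) → A) :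
    ∃ N : Fin (n + 1) → Fin (n + 1) → B,
      ∀ i j, φ (star (x i) * x j) = ∑ k, star (N k i) * N k j := by
  let X : CStarMatrix (Fin (n + 1)) (Fin (n + 1)) A :=
    CStarMatrix.ofMatrix (fun k j => if k = 0 then x j else 0)
  have hX0 : ∀ k j, X k j = if k = 0 then x j else 0 := fun _ _ => rfl
  have hX : (0 : CStarMatrix (Fin (n + 1)) (Fin (n + 1)) A) ≤ star X * X := star_mul_self_nonneg X
  have h1 := φ.map_cstarMatrix_nonneg _ hX
  obtain ⟨N, hN⟩ := exists_eq_star_mul_self h1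
  refine ⟨fun k j => N k j, fun i j => ?_⟩
  have h2 := congrArg (fun M : CStarMatrix (Fin (n + 1)) (Fin (n + 1)) B => M i j) hN
  simp only [CStarMatrix.map_apply, CStarMatrix.mul_apply, CStarMatrix.star_apply] at h2
  rw [← h2]
  congr 1
  rw [Finset.sum_eq_single (0 : Fin (n + 1))]
  · simp [hX0]
  · intro b _ hb
    simp [hX0, hb]
  · simp

theorem map_star_cp (φ : A →CP B) (a : A) : φ (star a) = star (φ a) :=
  map_star φ a

theorem map_nonneg_cp (φ : A →CP B) {a : A} (ha : 0 ≤ a) : 0 ≤ φ a := by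
  have := OrderHomClass.mono φ ha
  simpa using this

/-- The form `(y i) ↦ ∑ i j, (y i)⋆ φ ((x i)⋆ x j) (y j)` of a completely positive map, evaluated
at `y = (-d, 1, -b)`, is nonnegative.  The `1` is formal: the target need not be unital. -/
theorem cp_form_nonneg (φ : A →CP B) (x : Fin 3 → A) (d b : B) :
    0 ≤ star d * φ (star (x 0) * x 0) * d
      - star d * (φ (star (x 0) * x 1) - φ (star (x 0) * x 2) * b)
      - star (φ (star (x 0) * x 1) - φ (star (x 0) * x 2) * b) * d
      + (φ (star (x 1) * x 1) - φ (star (x 1) * x 2) * b - star b * φ (star (x 2) * x 1)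
        + star b * φ (star (x 2) * x 2) * b) := by
  obtain ⟨N, hN⟩ := exists_gram_decomposition φ x
  have h0 : (0 : B) ≤ ∑ k, star (-(N k 0 * d) + N k 1 - N k 2 * b) *
      (-(N k 0 * d) + N k 1 - N k 2 * b) :=
    Finset.sum_nonneg fun _ _ => star_mul_self_nonneg _
  refine h0.trans_eq ?_
  have e : ∀ k, star (-(N k 0 * d) + N k 1 - N k 2 * b) * (-(N k 0 * d) + N k 1 - N k 2 * b) =
      star d * (star (N k 0) * N k 0) * d
      - star d * (star (N k 0) * N k 1 - star (N k 0) * N k 2 * b)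
      - star (star (N k 0) * N k 1 - star (N k 0) * N k 2 * b) * d
      + (star (N k 1) * N k 1 - star (N k 1) * N k 2 * b - star b * (star (N k 2) * N k 1)
        + star b * (star (N k 2) * N k 2) * b) := by
    intro k
    simp only [star_sub, star_add, star_neg, star_mul, star_star]
    noncomm_ring
  rw [Finset.sum_congr rfl fun k _ => e k]
  simp only [hN, Finset.sum_add_distrib, Finset.sum_sub_distrib, Finset.mul_sum,
    Finset.sum_mul, star_sub, star_sum, mul_sub, sub_mul]

/-- The defect of `φ (c a b) = φ (c a) b` for a completely positive contraction is controlled by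
a form that is additive in `φ` and vanishes for the identity map. -/
theorem star_mul_self_map_mul_sub_le (φ : A →CP A) (hφ : ∀ a, ‖φ a‖ ≤ ‖a‖) {c : A} (hc : ‖c‖ ≤ 1)
    (a b : A) :
    star (φ (c * (a * b)) - φ (c * a) * b) * (φ (c * (a * b)) - φ (c * a) * b) ≤
      φ (star (a * b) * (a * b)) - φ (star (a * b) * a) * b - star b * φ (star a * (a * b))
        + star b * φ (star a * a) * b := by
  set D := φ (c * (a * b)) - φ (c * a) * b with hD
  have h := cp_form_nonneg φ ![star c, a * b, a] D b
  simp only [Matrix.cons_val_zero, Matrix.cons_val_one, Matrix.cons_val, star_star] at h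
  rw [← hD] at h
  have h2 : star D * φ (c * star c) * D ≤ star D * D := by
    have h3 := CStarAlgebra.star_left_conjugate_le_norm_smul (a := D) (b := φ (c * star c))
      (by rw [IsSelfAdjoint, ← map_star_cp]; simp)
    refine h3.trans ?_
    have h4 : ‖φ (c * star c)‖ ≤ 1 := by
      refine (hφ _).trans ?_
      rw [CStarRing.norm_self_mul_star]
      nlinarith [norm_nonneg c]
    have h5 : (0 : A) ≤ star D * D := star_mul_self_nonneg D
    calc ‖φ (c * star c)‖ • (star D * D) ≤ (1 : ℝ) • (star D * D) := by gcongr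
      _ = _ := one_smul _ _
  rw [← sub_nonneg]
  rw [← sub_nonneg] at h2
  have := add_nonneg h h2
  refine this.trans_eq ?_
  abel

/-- If completely positive contractions `Φ i` nearly add up to the identity map, then each of them
is nearly a right module map: the sum of the nonnegative forms bounding the defects of the `Φ i`
nearly vanishes. -/
theorem norm_map_mul_sub_sq_le_of_sum {ι : Type*} [Fintype ι] (Φ : ι → A →CP A)
    (hΦ : ∀ i a, ‖Φ i a‖ ≤ ‖a‖) {c : A} (hc : ‖c‖ ≤ 1) (a b : A) {t : ℝ}
    (h₁ : ‖∑ i, Φ i (star (a * b) * (a * b)) - star (a * b) * (a * b)‖ ≤ t)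
    (h₂ : ‖∑ i, Φ i (star (a * b) * a) - star (a * b) * a‖ ≤ t)
    (h₃ : ‖∑ i, Φ i (star a * (a * b)) - star a * (a * b)‖ ≤ t)
    (h₄ : ‖∑ i, Φ i (star a * a) - star a * a‖ ≤ t) (i : ι) :
    ‖Φ i (c * (a * b)) - Φ i (c * a) * b‖ ^ 2 ≤ t * (1 + ‖b‖) ^ 2 := by
  have h := star_mul_self_map_mul_sub_le (Φ i) (hΦ i) hc a b
  set D := Φ i (c * (a * b)) - Φ i (c * a) * b with hD
  let Q : ι → A := fun j => Φ j (star (a * b) * (a * b)) - Φ j (star (a * b) * a) * b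
    - star b * Φ j (star a * (a * b)) + star b * Φ j (star a * a) * b
  have hQ : ∀ j, 0 ≤ Q j := by
    intro j
    have := cp_form_nonneg (Φ j) ![0, a * b, a] 0 b
    simpa [Q] using this
  have h5 : star D * D ≤ ∑ j, Q j :=
    h.trans (Finset.single_le_sum (f := Q) (fun j _ => hQ j) (Finset.mem_univ i))
  have h6 : ∑ j, Q j = (∑ i, Φ i (star (a * b) * (a * b)) - star (a * b) * (a * b))
      - (∑ i, Φ i (star (a * b) * a) - star (a * b) * a) * b
      - star b * (∑ i, Φ i (star a * (a * b)) - star a * (a * b))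
      + star b * (∑ i, Φ i (star a * a) - star a * a) * b := by
    simp only [Q, Finset.sum_add_distrib, Finset.sum_sub_distrib, ← Finset.mul_sum,
      ← Finset.sum_mul]
    noncomm_ring
  have h7 := CStarAlgebra.norm_le_norm_of_nonneg_of_le (star_mul_self_nonneg D) h5
  rw [CStarRing.norm_star_mul_self, h6] at h7
  have hb := norm_nonneg b
  calc ‖D‖ ^ 2 = ‖D‖ * ‖D‖ := sq _
    _ ≤ t + t * ‖b‖ + ‖b‖ * t + ‖b‖ * t * ‖b‖ := by
      refine h7.trans ((norm_add_le _ _).trans (add_le_add ((norm_sub_le _ _).trans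
        (add_le_add ((norm_sub_le _ _).trans (add_le_add h₁ ?_)) ?_)) ?_))
      · exact (norm_mul_le _ _).trans (by gcongr)
      · refine (norm_mul_le _ _).trans ?_
        rw [norm_star]
        gcongr
      · refine (norm_mul_le _ _).trans ?_
        gcongr
        refine (norm_mul_le _ _).trans ?_
        rw [norm_star]
        gcongr
    _ = t * (1 + ‖b‖) ^ 2 := by ring

/-- The composition of two completely positive maps, as a completely positive map. -/
def compCP {C : Type*} [NonUnitalCStarAlgebra C] [PartialOrder C] [StarOrderedRing C]
    (φ : B →CP C) (ψ : A →CP B) : A →CP C where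
  toLinearMap := (φ : B →ₗ[ℂ] C).comp (ψ : A →ₗ[ℂ] B)
  map_cstarMatrix_nonneg' _ M hM :=
    φ.map_cstarMatrix_nonneg _ (ψ.map_cstarMatrix_nonneg M hM)

/-- If `b` annihilates `φ (x⋆ x)` from the right, then it annihilates the column that represents
`x` in a Kolmogorov decomposition of `φ`, and hence `φ (y⋆ x)` for every `y`. -/
theorem map_star_mul_mul_eq_zero (φ : A →CP B) {x : A} {b : B} (h : φ (star x * x) * b = 0)
    (y : A) : φ (star y * x) * b = 0 := by
  obtain ⟨N, hN⟩ := exists_gram_decomposition φ ![x, y]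
  have h0 : ∑ k, star (N k 0 * b) * (N k 0 * b) = 0 := by
    have h1 := hN 0 0
    simp only [Matrix.cons_val_zero] at h1
    have h2 : star b * (φ (star x * x) * b) = 0 := by rw [h, mul_zero]
    rw [h1] at h2
    rw [← h2, Finset.sum_mul, Finset.mul_sum]
    exact Finset.sum_congr rfl fun k _ => by simp only [star_mul, mul_assoc]
  rw [Finset.sum_eq_zero_iff_of_nonneg fun _ _ => star_mul_self_nonneg _] at h0
  have h3 : ∀ k, N k 0 * b = 0 := fun k => CStarRing.star_mul_self_eq_zero_iff _ |>.1
    (h0 k (Finset.mem_univ k))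
  have h4 := hN 1 0
  simp only [Matrix.cons_val_zero, Matrix.cons_val_one] at h4
  rw [h4, Finset.sum_mul]
  exact Finset.sum_eq_zero fun k _ => by rw [mul_assoc, h3, mul_zero]

/-- The Cauchy-Schwarz inequality for a completely positive map:
`φ (x⋆ y) φ (x⋆ y)⋆ ≤ ‖φ (y⋆ y)‖ φ (x⋆ x)`. -/
theorem map_mul_star_le (φ : A →CP B) (x y : A) :
    φ (star x * y) * star (φ (star x * y)) ≤ ‖φ (star y * y)‖ • φ (star x * x) := by
  obtain ⟨N, hN⟩ := exists_gram_decomposition φ ![x, y]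
  have hxx := hN 0 0
  have hxy := hN 0 1
  have hyy := hN 1 1
  have hyx := hN 1 0
  simp only [Matrix.cons_val_zero, Matrix.cons_val_one] at hxx hxy hyy hyx
  set X := φ (star x * y) with hX
  have hX' : φ (star y * x) = star X := by rw [hX, ← map_star_cp, star_mul, star_star]
  set s := ‖φ (star y * y)‖ with hs
  have hs0 : 0 ≤ s := norm_nonneg _
  have hP : 0 ≤ φ (star x * x) := map_nonneg_cp φ (star_mul_self_nonneg x)
  rcases hs0.eq_or_lt with h0 | hpos
  · -- here `φ (y⋆ y) = 0`, so that the entries `N k 1` vanish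
    have hz : ∑ k, star (N k 1) * N k 1 = 0 := by
      rw [← hyy]; exact norm_eq_zero.1 (hs.symm.trans h0.symm)
    rw [Finset.sum_eq_zero_iff_of_nonneg fun _ _ => star_mul_self_nonneg _] at hz
    have hX0 : X = 0 := by
      rw [hxy]
      refine Finset.sum_eq_zero fun k hk => ?_
      rw [(CStarRing.star_mul_self_eq_zero_iff _).1 (hz k hk), mul_zero]
    rw [hX0, zero_mul]
    exact smul_nonneg hs0 hP
  · -- evaluate the positive form at `(s, -X⋆)`
    have h1 : (0 : B) ≤ ∑ k, star (s • N k 0 - N k 1 * star X) * (s • N k 0 - N k 1 * star X) :=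
      Finset.sum_nonneg fun _ _ => star_mul_self_nonneg _
    have h2 : ∑ k, star (s • N k 0 - N k 1 * star X) * (s • N k 0 - N k 1 * star X) =
        s • s • φ (star x * x) - s • (X * star X) - s • (X * star X)
          + X * φ (star y * y) * star X := by
      have e1 : X * star X = ∑ k, star (N k 0) * N k 1 * star X := by
        conv_lhs => rw [hxy, ← hxy]
        rw [← Finset.sum_mul, ← hxy]
      have e2 : X * star X = ∑ k, X * (star (N k 1) * N k 0) := by
        rw [← Finset.mul_sum, ← hyx, hX']
      have e3 : X * φ (star y * y) * star X = ∑ k, X * (star (N k 1) * N k 1) * star X := by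
        rw [hyy, Finset.mul_sum, Finset.sum_mul]
      rw [e3, hxx]
      nth_rewrite 2 [e2]
      rw [e1]
      simp only [Finset.smul_sum, ← Finset.sum_sub_distrib, ← Finset.sum_add_distrib]
      refine Finset.sum_congr rfl fun k _ => ?_
      simp only [star_sub, star_smul, star_mul, star_star, star_trivial, sub_mul, mul_sub,
        smul_mul_assoc, mul_smul_comm, mul_assoc, smul_sub]
      abel
    have h3 : X * φ (star y * y) * star X ≤ s • (X * star X) :=
      CStarAlgebra.star_right_conjugate_le_norm_smul
        (by rw [IsSelfAdjoint, ← map_star_cp]; simp)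
    have h4 : s • (X * star X) ≤ s • s • φ (star x * x) := by
      rw [h2] at h1
      rw [← sub_nonneg] at h3 ⊢
      refine (add_nonneg h1 h3).trans_eq ?_
      abel
    calc X * star X = s⁻¹ • s • (X * star X) := by rw [inv_smul_smul₀ hpos.ne']
      _ ≤ s⁻¹ • s • s • φ (star x * x) := by gcongr
      _ = s • φ (star x * x) := by rw [inv_smul_smul₀ hpos.ne']

end CompletelyPositive

/-! ### Minimal projections in finite-dimensional C*-algebras -/

section MinimalProjections

variable {F : Type*} [CStarAlgebra F]

/-- Pairwise orthogonal nonzero projections. -/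
structure IsOrthogonalProjections {n : ℕ} (p : Fin n → F) : Prop where
  proj : ∀ i, IsStarProjection (p i)
  orth : ∀ i j, i ≠ j → p i * p j = 0
  ne_zero : ∀ i, p i ≠ 0

/-- A partition of the unit into pairwise orthogonal minimal projections; a projection `p` is
minimal if `p F p = ℂ p`. -/
structure IsMinimalPartition {n : ℕ} (p : Fin n → F) : Prop extends IsOrthogonalProjections p where
  sum_eq_one : ∑ i, p i = 1
  minimal : ∀ i x, ∃ c : ℂ, p i * x * p i = c • p i

theorem IsOrthogonalProjections.mul_sum_smul {n : ℕ} {p : Fin n → F}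
    (hp : IsOrthogonalProjections p) (c : Fin n → ℂ) (i : Fin n) :
    p i * ∑ j, c j • p j = c i • p i := by
  rw [Finset.mul_sum, Finset.sum_eq_single i]
  · rw [mul_smul_comm, (hp.proj i).isIdempotentElem.eq]
  · intro j _ hj
    rw [mul_smul_comm, hp.orth i j hj.symm, smul_zero]
  · simp

theorem IsOrthogonalProjections.linearIndependent {n : ℕ} {p : Fin n → F}
    (hp : IsOrthogonalProjections p) : LinearIndependent ℂ p := by
  rw [Fintype.linearIndependent_iff]
  intro c hc i
  have h := hp.mul_sum_smul c i
  rw [hc, mul_zero] at h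
  exact (smul_eq_zero.1 h.symm).resolve_right (hp.ne_zero i)

theorem finite_spectrum_real [FiniteDimensional ℂ F] (b : F) : (spectrum ℝ b).Finite := by
  nontriviality F
  have : FiniteDimensional ℝ F := FiniteDimensional.complexToReal F
  have hint : IsIntegral ℝ b := Algebra.IsIntegral.isIntegral b
  have hne : minpoly ℝ b ≠ 0 := minpoly.ne_zero hint
  refine ((minpoly ℝ b).roots.toFinset.finite_toSet).subset fun r hr => ?_
  have h1 := spectrum.subset_polynomial_aeval b (minpoly ℝ b) ⟨r, hr, rfl⟩
  rw [minpoly.aeval, spectrum.zero_eq] at h1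
  simp only [Finset.mem_coe, Multiset.mem_toFinset, Polynomial.mem_roots hne]
  exact h1

/-- If no nonzero projection `q < p` commutes with everything that commutes with `b = p b p`,
then `b` is a multiple of `p`: its spectral projections are trivial. -/
theorem exists_eq_smul_of_forall_projection [FiniteDimensional ℂ F] {b p : F}
    (hb : IsSelfAdjoint b) (hpb : p * b = b) (hbp : b * p = b)
    (H : ∀ q : F, IsStarProjection q → q ≠ 0 → p * q = q → q * p = q →
      (∀ y, Commute y b → Commute y q) → q = p) :
    ∃ r : ℝ, b = (r : ℂ) • p := by
  have hc : ∀ g : ℝ → ℝ, ContinuousOn g (spectrum ℝ b) := fun g =>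
    (finite_spectrum_real b).continuousOn g
  have hid : ∀ g : ℝ → ℝ, b * cfc g b = cfc (fun t => t * g t) b := fun g => by
    rw [cfc_mul (fun t => t) g b (hc _) (hc _), cfc_id' ℝ b]
  by_cases h0 : ∃ r ∈ spectrum ℝ b, r ≠ 0
  · obtain ⟨r, hr, hr0⟩ := h0
    let f : ℝ → ℝ := fun t => if t = r then 1 else 0
    let g : ℝ → ℝ := fun t => if t = r then r⁻¹ else 0
    have hff : cfc f b * cfc f b = cfc f b := by
      rw [← cfc_mul f f b (hc _) (hc _)]
      congr 1
      funext t
      simp only [f]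
      split_ifs <;> simp
    have hbg : b * cfc g b = cfc f b := by
      rw [hid]
      congr 1
      funext t
      simp only [f, g]
      split_ifs with h
      · rw [h, mul_inv_cancel₀ hr0]
      · simp
    have hgb : cfc g b * b = cfc f b := by
      rw [← hbg]
      exact ((Commute.refl b).cfc_real g)
    have hbf : b * cfc f b = r • cfc f b := by
      rw [← cfc_smul r f b (hc _), hid]
      congr 1
      funext t
      simp only [f, smul_eq_mul]
      split_ifs with h
      · rw [h]
      · simp
    have hsa : IsSelfAdjoint (cfc f b) := cfc_predicate f b
    have hne : cfc f b ≠ 0 := by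
      intro h
      have h1 : cfc f b = cfc (fun _ => (0 : ℝ)) b := by rw [h, cfc_const_zero]
      have h2 := eqOn_of_cfc_eq_cfc h1 (hc _) (hc _) hb hr
      simp [f] at h2
    have hfp := H (cfc f b) ⟨hff, hsa⟩ hne (by rw [← hbg, ← mul_assoc, hpb])
      (by rw [← hgb, mul_assoc, hbp]) (fun y hy => (hy.symm.cfc_real f).symm)
    refine ⟨r, ?_⟩
    rw [hfp, hbp] at hbf
    rw [hbf]
    exact (Complex.coe_smul r p).symm
  · push Not at h0
    refine ⟨0, ?_⟩
    have : cfc (id : ℝ → ℝ) b = cfc (fun _ => (0 : ℝ)) b := cfc_congr fun t ht => h0 t ht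
    rw [cfc_id ℝ b, cfc_const_zero] at this
    simp [this]

theorem IsOrthogonalProjections.cons {n : ℕ} {p : Fin n → F} (hp : IsOrthogonalProjections p)
    {q : F} (hq : IsStarProjection q) (hq0 : q ≠ 0) (h : ∀ i, q * p i = 0) :
    IsOrthogonalProjections (Fin.cons q p : Fin (n + 1) → F) := by
  have h' : ∀ i, p i * q = 0 := fun i => by
    have := congrArg star (h i)
    rwa [star_mul, star_zero, hq.isSelfAdjoint.star_eq, (hp.proj i).isSelfAdjoint.star_eq] at this
  refine ⟨fun i => ?_, fun i j hij => ?_, fun i => ?_⟩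
  · induction i using Fin.cases with
    | zero => exact hq
    | succ i => exact hp.proj i
  · induction i using Fin.cases with
    | zero =>
      induction j using Fin.cases with
      | zero => exact absurd rfl hij
      | succ j => exact h j
    | succ i =>
      induction j using Fin.cases with
      | zero => exact h' i
      | succ j => exact hp.orth i j fun e => hij (by rw [e])
  · induction i using Fin.cases with
    | zero => exact hq0
    | succ i => exact hp.ne_zero i

theorem isStarProjection_sub {p q : F} (hp : IsStarProjection p)
    (hq : IsStarProjection q) (h : p * q = q) (h' : q * p = q) : IsStarProjection (p - q) where
  isIdempotentElem := by
    have := hp.isIdempotentElem.eq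
    have := hq.isIdempotentElem.eq
    rw [IsIdempotentElem, sub_mul, mul_sub, mul_sub]
    simp [*]
  isSelfAdjoint := hp.isSelfAdjoint.sub hq.isSelfAdjoint

theorem IsOrthogonalProjections.update {n : ℕ} {p : Fin n → F} (hp : IsOrthogonalProjections p)
    (i : Fin n) {q : F} (hq : IsStarProjection q) (hq0 : q ≠ 0) (h : p i * q = q)
    (h' : q * p i = q) : IsOrthogonalProjections (Function.update p i q) := by
  refine ⟨fun j => ?_, fun j k hjk => ?_, fun j => ?_⟩
  · rcases eq_or_ne j i with rfl | hj
    · simpa using hq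
    · simpa [hj] using hp.proj j
  · rcases eq_or_ne j i with rfl | hj
    · rw [Function.update_self, Function.update_of_ne hjk.symm, ← h', mul_assoc,
        hp.orth j k hjk, mul_zero]
    · rcases eq_or_ne k i with rfl | hk
      · rw [Function.update_self, Function.update_of_ne hj, ← h, ← mul_assoc,
          hp.orth j k hjk, zero_mul]
      · simpa [hj, hk] using hp.orth j k hjk
  · rcases eq_or_ne j i with rfl | hj
    · simpa using hq0
    · simpa [hj] using hp.ne_zero j

/-- Every selfadjoint element is diagonal with respect to some partition of the unit into minimal
projections: one takes a family of maximal size among the families of pairwise orthogonal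
projections commuting with it. -/
theorem exists_isMinimalPartition [FiniteDimensional ℂ F] {f : F} (hf : IsSelfAdjoint f) :
    ∃ (n : ℕ) (p : Fin n → F) (r : Fin n → ℝ), IsMinimalPartition p ∧
      f = ∑ i, (r i : ℂ) • p i := by
  classical
  let P : ℕ → Prop := fun n => ∃ p : Fin n → F,
    IsOrthogonalProjections p ∧ ∀ i, Commute (p i) f
  have hbdd : ∀ n, P n → n ≤ Module.finrank ℂ F := by
    rintro n ⟨p, hp, -⟩
    simpa using hp.linearIndependent.fintype_card_le_finrank
  have hP0 : P 0 := ⟨fun i => i.elim0, ⟨fun i => i.elim0, fun i => i.elim0, fun i => i.elim0⟩,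
    fun i => i.elim0⟩
  obtain ⟨n, ⟨p, hp, hpf⟩, hmax⟩ : ∃ n, P n ∧ ¬ P (n + 1) := by
    refine ⟨Nat.findGreatest P (Module.finrank ℂ F),
      Nat.findGreatest_spec (Nat.zero_le _) hP0, fun h => ?_⟩
    have := Nat.le_findGreatest (hbdd _ h) h
    omega
  have hpp : ∀ i, p i * p i = p i := fun i => (hp.proj i).isIdempotentElem.eq
  have hsum : ∑ i, p i = 1 := by
    by_contra hne
    have h1 : ∀ i, (∑ j, p j) * p i = p i := fun i => by
      rw [Finset.sum_mul, Finset.sum_eq_single i, hpp]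
      · exact fun j _ hj => hp.orth j i hj
      · simp
    have hs : IsStarProjection (∑ j, p j) := by
      refine ⟨?_, ?_⟩
      · rw [IsIdempotentElem, Finset.mul_sum]
        exact Finset.sum_congr rfl fun i _ => h1 i
      · rw [IsSelfAdjoint, star_sum]
        exact Finset.sum_congr rfl fun i _ => (hp.proj i).isSelfAdjoint
    refine hmax ⟨_, hp.cons hs.one_sub (sub_ne_zero.2 (Ne.symm hne)) fun i => ?_, fun i => ?_⟩
    · rw [sub_mul, one_mul, h1, sub_self]
    · induction i using Fin.cases with
      | zero => exact (Commute.one_left f).sub_left (Commute.sum_left _ _ _ fun i _ => hpf i)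
      | succ i => exact hpf i
  have hsplit : ∀ i (q : F), IsStarProjection q → q ≠ 0 → p i * q = q → q * p i = q →
      Commute q f → q = p i := by
    intro i q hq hq0 h h' hqf
    by_contra hne
    have hd := isStarProjection_sub (hp.proj i) hq h h'
    have hpd : p i * (p i - q) = p i - q := by rw [mul_sub, hpp, h]
    have hdp : (p i - q) * p i = p i - q := by rw [sub_mul, hpp, h']
    refine hmax ⟨_, (hp.update i hd (sub_ne_zero.2 (Ne.symm hne)) hpd hdp).cons hq hq0
      fun j => ?_, fun j => ?_⟩
    · rcases eq_or_ne j i with rfl | hj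
      · rw [Function.update_self, mul_sub, h', hq.isIdempotentElem.eq, sub_self]
      · rw [Function.update_of_ne hj, ← h', mul_assoc, hp.orth i j hj.symm, mul_zero]
    · induction j using Fin.cases with
      | zero => exact hqf
      | succ j =>
        rcases eq_or_ne j i with rfl | hj
        · simpa using (hpf j).sub_left hqf
        · simpa [hj] using hpf j
  have hr : ∀ i, ∃ r : ℝ, p i * f = (r : ℂ) • p i := by
    intro i
    have hsa : IsSelfAdjoint (p i * f) := by
      rw [IsSelfAdjoint, star_mul, hf.star_eq, (hp.proj i).isSelfAdjoint.star_eq, (hpf i).eq]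
    refine exists_eq_smul_of_forall_projection hsa (by rw [← mul_assoc, hpp])
      (by rw [mul_assoc, ← (hpf i).eq, ← mul_assoc, hpp]) fun q hq hq0 h h' hqc =>
      hsplit i q hq hq0 h h' ?_
    exact (hqc f (by rw [Commute, SemiconjBy, ← mul_assoc, ← (hpf i).eq, mul_assoc])).symm
  choose r hr using hr
  have hfp : ∀ i, f * p i = (r i : ℂ) • p i := fun i => by rw [← (hpf i).eq, hr]
  have hmin : ∀ i x, IsSelfAdjoint x → ∃ c : ℝ, p i * x * p i = (c : ℂ) • p i := by
    intro i x hx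
    have hsa : IsSelfAdjoint (p i * x * p i) := by
      rw [IsSelfAdjoint, star_mul, star_mul, hx.star_eq, (hp.proj i).isSelfAdjoint.star_eq,
        mul_assoc]
    refine exists_eq_smul_of_forall_projection hsa (by simp only [← mul_assoc, hpp])
      (by rw [mul_assoc, hpp]) fun q hq hq0 h h' _ => hsplit i q hq hq0 h h' ?_
    rw [Commute, SemiconjBy]
    calc q * f = q * (p i * f) := by rw [← mul_assoc, h']
      _ = f * p i * q := by rw [hr, hfp, mul_smul_comm, smul_mul_assoc, h, h']
      _ = f * q := by rw [mul_assoc, h]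
  refine ⟨n, p, r, ⟨hp, hsum, fun i x => ?_⟩, ?_⟩
  · obtain ⟨c, hc⟩ := hmin i (realPart x : F) (realPart x).2
    obtain ⟨d, hd⟩ := hmin i (imaginaryPart x : F) (imaginaryPart x).2
    refine ⟨c + Complex.I * d, ?_⟩
    conv_lhs => rw [← realPart_add_I_smul_imaginaryPart x]
    rw [mul_add, add_mul, hc, mul_smul_comm, smul_mul_assoc, hd, add_smul, mul_smul]
  · calc f = (∑ i, p i) * f := by rw [hsum, one_mul]
      _ = _ := by rw [Finset.sum_mul]; exact Finset.sum_congr rfl fun i _ => hr i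

end MinimalProjections

/-! ### Order zero maps on finite-dimensional C*-algebras -/

theorem mem_span_projections {F : Type*} [CStarAlgebra F] [FiniteDimensional ℂ F] (f : F) :
    f ∈ Submodule.span ℂ {p : F | IsStarProjection p} := by
  have key : ∀ g : F, IsSelfAdjoint g → g ∈ Submodule.span ℂ {p : F | IsStarProjection p} := by
    intro g hg
    obtain ⟨n, p, r, hp, h⟩ := exists_isMinimalPartition hg
    rw [h]
    exact Submodule.sum_mem _ fun i _ => Submodule.smul_mem _ _ (Submodule.subset_span (hp.proj i))
  rw [← realPart_add_I_smul_imaginaryPart f]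
  exact Submodule.add_mem _ (key _ (realPart f).2)
    (Submodule.smul_mem _ _ (key _ (imaginaryPart f).2))

theorem norm_map_star_cp {A B : Type*} [NonUnitalCStarAlgebra A] [PartialOrder A]
    [StarOrderedRing A] [NonUnitalCStarAlgebra B] [PartialOrder B] [StarOrderedRing B]
    (φ : A →CP B) (x : A) : ‖φ (star x)‖ = ‖φ x‖ := by
  rw [map_star_cp, norm_star]

section OrderZero

variable {F A : Type*} [CStarAlgebra F] [PartialOrder F] [StarOrderedRing F]
  [FiniteDimensional ℂ F] [NonUnitalCStarAlgebra A] [PartialOrder A] [StarOrderedRing A]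
  {φ : F →CP A}

/-- An order zero map is multiplicative up to the factor `φ 1`.  It suffices to let `f = p` be a
projection, as projections span.  Then `φ (g (1 - p)) φ p = 0 = φ (g p) φ (1 - p)`, because `φ`
maps orthogonal positive elements to orthogonal ones; hence
`φ g φ p = φ (g p) φ p = φ (g p) φ 1`. -/
theorem IsOrderZero.map_mul_map (hφ : IsOrderZero φ) (g f : F) :
    φ g * φ f = φ (g * f) * φ 1 := by
  have key : ∀ p : F, IsStarProjection p → ∀ g, φ (g * (1 - p)) * φ p = 0 := by
    intro p hp g
    have h1 := hφ (1 - p) p hp.one_sub.nonneg hp.nonneg hp.one_sub_mul_self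
    have h2 := map_star_mul_mul_eq_zero φ (x := 1 - p) (b := φ p)
      (by rw [hp.one_sub.isSelfAdjoint.star_eq, hp.one_sub.isIdempotentElem.eq, h1]) (star g)
    rwa [star_star] at h2
  refine Submodule.span_induction (p := fun f _ => φ g * φ f = φ (g * f) * φ 1) ?_ ?_ ?_ ?_
    (mem_span_projections f)
  · intro p hp
    have h1 := key p hp g
    have h2 := key (1 - p) hp.one_sub g
    rw [mul_sub, mul_one, map_sub, sub_mul, sub_eq_zero] at h1
    rw [sub_sub_cancel, map_sub, mul_sub, sub_eq_zero] at h2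
    rw [h1, h2]
  · simp
  · intro x y _ _ hx hy
    rw [map_add, mul_add, hx, hy, mul_add, map_add, add_mul]
  · intro c x _ hx
    rw [map_smul, mul_smul_comm, hx, mul_smul_comm, map_smul, smul_mul_assoc]

theorem IsOrderZero.commute_map_one (hφ : IsOrderZero φ) (f : F) : Commute (φ 1) (φ f) := by
  rw [Commute, SemiconjBy, hφ.map_mul_map, one_mul]

theorem IsOrderZero.map_mul_map' (hφ : IsOrderZero φ) (g f : F) :
    φ g * φ f = φ 1 * φ (g * f) := by
  rw [hφ.map_mul_map, (hφ.commute_map_one _).eq]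

theorem IsOrderZero.norm_map_mul_le (hφ : IsOrderZero φ) (x y : F) :
    ‖φ (x * y)‖ ≤ ‖x‖ * ‖φ y‖ := by
  have h1 : ∀ w, star (φ w) * φ w = φ 1 * φ (star w * w) := fun w => by
    rw [← map_star_cp, hφ.map_mul_map']
  have h2 : star x * x ≤ algebraMap ℝ F (‖x‖ ^ 2) := CStarAlgebra.star_mul_le_algebraMap_norm_sq
  obtain ⟨s, hs⟩ := exists_eq_star_mul_self (sub_nonneg.2 h2)
  have h3 : star (φ (x * y)) * φ (x * y) ≤ (‖x‖ ^ 2) • (star (φ y) * φ y) := by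
    rw [← sub_nonneg]
    refine (star_mul_self_nonneg (φ (s * y))).trans_eq ?_
    have e : star (s * y) * (s * y) = (‖x‖ ^ 2) • (star y * y) - star (x * y) * (x * y) := by
      calc star (s * y) * (s * y) = star y * (star s * s) * y := by
            simp only [star_mul, mul_assoc]
        _ = _ := by
            rw [← hs, mul_sub, sub_mul, Algebra.algebraMap_eq_smul_one, mul_smul_comm, mul_one,
              smul_mul_assoc]
            simp only [star_mul, mul_assoc]
    have e2 : ∀ (r : ℝ) (z : F), φ (r • z) = r • φ z := fun r z => by
      rw [← Complex.coe_smul, map_smul, Complex.coe_smul]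
    rw [h1, h1, h1, e, map_sub, mul_sub, e2, mul_smul_comm]
  have h4 := CStarAlgebra.norm_le_norm_of_nonneg_of_le (star_mul_self_nonneg _) h3
  rw [norm_smul, CStarRing.norm_star_mul_self, CStarRing.norm_star_mul_self, norm_pow,
    norm_norm] at h4
  refine le_of_sq_le_sq ?_ (by positivity)
  calc ‖φ (x * y)‖ ^ 2 = ‖φ (x * y)‖ * ‖φ (x * y)‖ := sq _
    _ ≤ _ := h4
    _ = _ := by ring

theorem IsOrderZero.norm_map_mul_le' (hφ : IsOrderZero φ) (x y : F) :
    ‖φ (x * y)‖ ≤ ‖φ x‖ * ‖y‖ := by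
  rw [← norm_map_star_cp, star_mul, ← norm_map_star_cp φ x, mul_comm, ← norm_star y]
  exact hφ.norm_map_mul_le _ _

/-- Smallness of `φ 1 * φ y` forces smallness of `φ y`. -/
theorem IsOrderZero.norm_map_pow_four_le (hφ : IsOrderZero φ) (hc : IsContractiveCP φ) (y : F) :
    ‖φ y‖ ^ 4 ≤ ‖y‖ ^ 3 * ‖φ 1 * φ y‖ := by
  have h1 : star (φ y) * φ y = φ (star y * y) * φ 1 := by
    rw [← map_star_cp, hφ.map_mul_map]
  have h2 : star (φ y) * φ y * (star (φ y) * φ y) =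
      φ (star y * y) * (star (φ y) * (φ 1 * φ y)) := by
    nth_rewrite 1 [h1]
    rw [mul_assoc, ← mul_assoc (φ 1), ← map_star_cp, (hφ.commute_map_one (star y)).eq, mul_assoc]
  have h3 : ‖star (φ y) * φ y * (star (φ y) * φ y)‖ = ‖φ y‖ ^ 4 := by
    have : star (φ y) * φ y * (star (φ y) * φ y) =
        star (star (φ y) * φ y) * (star (φ y) * φ y) := by
      rw [star_mul, star_star]
    rw [this, CStarRing.norm_star_mul_self, CStarRing.norm_star_mul_self]
    ring
  rw [← h3, h2]
  calc ‖φ (star y * y) * (star (φ y) * (φ 1 * φ y))‖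
      ≤ ‖φ (star y * y)‖ * (‖star (φ y)‖ * ‖φ 1 * φ y‖) :=
        (norm_mul_le _ _).trans (by gcongr; exact norm_mul_le _ _)
    _ ≤ (‖y‖ * ‖y‖) * (‖y‖ * ‖φ 1 * φ y‖) := by
        gcongr
        · exact (hc _).trans_eq CStarRing.norm_star_mul_self
        · rw [norm_star]; exact hc _
    _ = _ := by ring

end OrderZero

section Coefficients

variable {F : Type*} [CStarAlgebra F] {n : ℕ} {p : Fin n → F}

/-- Equivalence of the minimal projections `p i` and `p j`: they lie in the same simple summand. -/
def Linked (p : Fin n → F) (i j : Fin n) : Prop :=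
  ∃ x, p i * x * p j ≠ 0

/-- The scalar `c` with `p i * x * p i = c • p i`. -/
def IsMinimalPartition.coeff (hp : IsMinimalPartition p) (i : Fin n) (x : F) : ℂ :=
  (hp.minimal i x).choose

namespace IsMinimalPartition

variable (hp : IsMinimalPartition p)

theorem mul_self (hp : IsMinimalPartition p) (i : Fin n) : p i * p i = p i :=
  (hp.proj i).isIdempotentElem.eq

theorem star_eq (hp : IsMinimalPartition p) (i : Fin n) : star (p i) = p i :=
  (hp.proj i).isSelfAdjoint.star_eq

theorem coeff_spec (i : Fin n) (x : F) : p i * x * p i = hp.coeff i x • p i :=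
  (hp.minimal i x).choose_spec

theorem coeff_eq_of {i : Fin n} {x : F} {c : ℂ} (h : p i * x * p i = c • p i) :
    hp.coeff i x = c := by
  rw [hp.coeff_spec, ← sub_eq_zero, ← sub_smul] at h
  exact sub_eq_zero.1 ((smul_eq_zero.1 h).resolve_right (hp.ne_zero i))

/-- The scalar `coeff i x` as a linear functional of `x`. -/
def coeffₗ (i : Fin n) : F →ₗ[ℂ] ℂ where
  toFun := hp.coeff i
  map_add' x y := hp.coeff_eq_of (by
    rw [mul_add, add_mul, hp.coeff_spec, hp.coeff_spec, add_smul])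
  map_smul' c x := hp.coeff_eq_of (by
    rw [mul_smul_comm, smul_mul_assoc, hp.coeff_spec, smul_smul]; rfl)

theorem linked_refl (hp : IsMinimalPartition p) (i : Fin n) : Linked p i i :=
  ⟨1, by rw [mul_one, hp.mul_self]; exact hp.ne_zero i⟩

theorem linked_symm (hp : IsMinimalPartition p) {i j : Fin n} (h : Linked p i j) :
    Linked p j i := by
  obtain ⟨x, hx⟩ := h
  refine ⟨star x, fun h0 => hx ?_⟩
  have := congrArg star h0
  rwa [star_mul, star_mul, star_star, hp.star_eq, hp.star_eq, star_zero, ← mul_assoc] at this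

/-- Linked minimal projections are equivalent via a partial isometry. -/
theorem exists_partialIsometry (hp : IsMinimalPartition p) {i j : Fin n} (h : Linked p i j) :
    ∃ v : F, v * star v = p i ∧ star v * v = p j ∧ p i * v = v ∧ v * p j = v := by
  obtain ⟨x, hx⟩ := h
  set y := p i * x * p j with hy
  have hiy : p i * y = y := by rw [hy, ← mul_assoc, ← mul_assoc, hp.mul_self]
  have hyj : y * p j = y := by rw [hy, mul_assoc, hp.mul_self]
  have hn : 0 < ‖y‖ := norm_pos_iff.2 hx
  -- both `y⋆ y` and `y y⋆` are multiples of minimal projections, with the same norm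
  have key : ∀ (k : Fin n) (z : F), z * p k = z → 0 < ‖z‖ →
      star z * z = ((‖z‖ ^ 2 : ℝ) : ℂ) • p k := by
    intro k z hz hz0
    have h1 : p k * star z = star z := by
      have := congrArg star hz
      rwa [star_mul, hp.star_eq] at this
    have h2 : star z * z = hp.coeff k (star z * z) • p k := by
      rw [← hp.coeff_spec, ← mul_assoc, h1, mul_assoc, hz]
    set c := hp.coeff k (star z * z)
    let _ : PartialOrder F := CStarAlgebra.spectralOrder F
    let _ : StarOrderedRing F := CStarAlgebra.spectralOrderedRing F
    have hpk : ‖p k‖ = 1 := by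
      have h3 : ‖p k‖ * ‖p k‖ = ‖p k‖ := by
        rw [← CStarRing.norm_star_mul_self, hp.star_eq, hp.mul_self]
      have h4 : ‖p k‖ ≠ 0 := norm_ne_zero_iff.2 (hp.ne_zero k)
      exact mul_right_cancel₀ h4 (by rw [h3, one_mul])
    have h5 : star c = c := by
      have h6 := congrArg star h2
      rw [star_mul, star_star, star_smul, hp.star_eq] at h6
      exact smul_left_injective ℂ (hp.ne_zero k) (h6.symm.trans h2)
    obtain ⟨r, hr⟩ : ∃ r : ℝ, (r : ℂ) = c := Complex.conj_eq_iff_real.1 h5 |>.imp fun _ h => h.symm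
    have h7 : ‖z‖ ^ 2 = |r| := by
      have := congrArg norm h2
      rw [CStarRing.norm_star_mul_self, norm_smul, hpk, ← hr, Complex.norm_real, mul_one] at this
      rw [sq, this, Real.norm_eq_abs]
    have h8 : 0 ≤ r := by
      by_contra hneg
      push Not at hneg
      have h9 : (0 : F) ≤ (r : ℂ) • p k := by
        rw [hr, ← h2]; exact star_mul_self_nonneg z
      have h10 : (r : ℂ) • p k ≤ 0 := by
        rw [Complex.coe_smul]
        exact smul_nonpos_of_nonpos_of_nonneg hneg.le (hp.proj k).nonneg
      have h11 := le_antisymm h10 h9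
      rcases smul_eq_zero.1 h11 with h | h
      · exact hneg.ne (by exact_mod_cast h)
      · exact hp.ne_zero k h
    rw [h2, ← hr, h7, abs_of_nonneg h8]
  have h1 := key j y hyj hn
  have h2 := key i (star y) (by
    have := congrArg star hiy
    rwa [star_mul, hp.star_eq] at this) (by rwa [norm_star])
  rw [star_star, norm_star] at h2
  have e : ((‖y‖⁻¹ : ℝ) : ℂ) * ((‖y‖⁻¹ : ℝ) : ℂ) * ((‖y‖ ^ 2 : ℝ) : ℂ) = 1 := by
    norm_cast
    field_simp
  refine ⟨((‖y‖⁻¹ : ℝ) : ℂ) • y, ?_, ?_, ?_, ?_⟩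
  · rw [star_smul, smul_mul_assoc, mul_smul_comm, h2, smul_smul, smul_smul, Complex.star_def,
      Complex.conj_ofReal, e, one_smul]
  · rw [star_smul, smul_mul_assoc, mul_smul_comm, h1, smul_smul, smul_smul, Complex.star_def,
      Complex.conj_ofReal, e, one_smul]
  · rw [mul_smul_comm, hiy]
  · rw [smul_mul_assoc, hyj]

theorem linked_trans (hp : IsMinimalPartition p) {i j k : Fin n} (h : Linked p i j)
    (h' : Linked p j k) : Linked p i k := by
  obtain ⟨v, hv1, hv2, hv3, hv4⟩ := hp.exists_partialIsometry h
  obtain ⟨w, hw1, hw2, hw3, hw4⟩ := hp.exists_partialIsometry h'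
  refine ⟨v * w, fun h0 => hp.ne_zero j ?_⟩
  rw [← mul_assoc, hv3, mul_assoc, hw4] at h0
  calc p j = star v * (v * w) * star w := by
        rw [← mul_assoc, hv2, mul_assoc, hw1, hp.mul_self]
    _ = 0 := by rw [h0]; simp

/-- The trace property of the diagonal coefficients, one pair of minimal projections at a time. -/
theorem coeff_mul_comm {i j : Fin n} (x y : F) :
    hp.coeff i (x * p j * y) = hp.coeff j (y * p i * x) := by
  by_cases h : Linked p i j
  · obtain ⟨v, hv1, hv2, hv3, hv4⟩ := hp.exists_partialIsometry h
    have hv3' : star v * p i = star v := by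
      have := congrArg star hv3
      rwa [star_mul, hp.star_eq] at this
    have h1 : p i * x * p j = hp.coeff i (x * star v) • v := by
      calc p i * x * p j = p i * (x * star v) * p i * v := by
            rw [← hv2]; simp only [mul_assoc, hv3]
        _ = _ := by rw [hp.coeff_spec, smul_mul_assoc, hv3]
    have h2 : p j * y * p i = hp.coeff j (y * v) • star v := by
      have hv4' : p j * star v = star v := by
        have := congrArg star hv4
        rwa [star_mul, hp.star_eq] at this
      calc p j * y * p i = p j * (y * v) * p j * star v := by
            rw [← hv1]; simp only [mul_assoc, hv4']
        _ = _ := by rw [hp.coeff_spec, smul_mul_assoc, hv4']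
    have h3 : hp.coeff i (x * p j * y) = hp.coeff i (x * star v) * hp.coeff j (y * v) :=
      hp.coeff_eq_of <| by
        calc p i * (x * p j * y) * p i = p i * x * (p j * p j) * y * p i := by
              rw [hp.mul_self]; simp only [mul_assoc]
          _ = p i * x * p j * (p j * y * p i) := by simp only [mul_assoc]
          _ = _ := by rw [h1, h2, smul_mul_assoc, mul_smul_comm, hv1, smul_smul]
    have h4 : hp.coeff j (y * p i * x) = hp.coeff i (x * star v) * hp.coeff j (y * v) :=
      hp.coeff_eq_of <| by
        calc p j * (y * p i * x) * p j = p j * y * (p i * p i) * x * p j := by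
              rw [hp.mul_self]; simp only [mul_assoc]
          _ = p j * y * p i * (p i * x * p j) := by simp only [mul_assoc]
          _ = _ := by rw [h1, h2, smul_mul_assoc, mul_smul_comm, hv2, smul_smul, mul_comm]
    rw [h3, h4]
  · have h1 : ∀ x, p i * x * p j = 0 := fun x => by
      by_contra hx; exact h ⟨x, hx⟩
    have h2 : ∀ x, p j * x * p i = 0 := fun x => by
      by_contra hx; exact h (hp.linked_symm ⟨x, hx⟩)
    rw [hp.coeff_eq_of (c := 0) (i := i), hp.coeff_eq_of (c := 0) (i := j)]
    · calc p j * (y * p i * x) * p j = p j * y * p i * (x * p j) := by simp only [mul_assoc]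
        _ = _ := by rw [h2, zero_mul, zero_smul]
    · calc p i * (x * p j * y) * p i = p i * x * p j * (y * p i) := by simp only [mul_assoc]
        _ = _ := by rw [h1, zero_mul, zero_smul]

/-- A weighted sum of the diagonal coefficients, with weights that are constant on the classes of
linked projections, is a trace: it vanishes on commutators. -/
theorem sum_coeff_eq_zero {w : Fin n → ℂ} (hw : ∀ i j, Linked p i j → w i = w j) {t : F}
    (ht : t ∈ Submodule.span ℂ {z : F | ∃ x y : F, z = x * y - y * x}) :
    ∑ i, w i * hp.coeff i t = 0 := by
  have hlin : ∀ i x, hp.coeff i x = hp.coeffₗ i x := fun _ _ => rfl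
  refine Submodule.span_induction (p := fun t _ => ∑ i, w i * hp.coeff i t = 0) ?_ ?_ ?_ ?_ ht
  · rintro z ⟨x, y, rfl⟩
    have h1 : ∀ (x y : F) i, hp.coeff i (x * y) = ∑ j, hp.coeff i (x * p j * y) := by
      intro x y i
      simp only [hlin]
      rw [← map_sum, ← Finset.sum_mul, ← Finset.mul_sum, hp.sum_eq_one, mul_one]
    have h2 : ∀ i j, w i * hp.coeff i (x * p j * y) = w j * hp.coeff j (y * p i * x) := by
      intro i j
      by_cases h : Linked p i j
      · rw [hp.coeff_mul_comm, hw i j h]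
      · have h3 : ∀ x, p i * x * p j = 0 := fun x => by
          by_contra hx; exact h ⟨x, hx⟩
        have h4 : hp.coeff i (x * p j * y) = 0 := hp.coeff_eq_of (by
          calc p i * (x * p j * y) * p i = p i * x * p j * (y * p i) := by simp only [mul_assoc]
            _ = _ := by rw [h3, zero_mul, zero_smul])
        rw [← hp.coeff_mul_comm x y, h4, mul_zero, mul_zero]
    have h5 : ∑ i, w i * hp.coeff i (x * y) = ∑ i, w i * hp.coeff i (y * x) := by
      rw [Finset.sum_congr rfl fun i _ => by rw [h1, Finset.mul_sum],
        Finset.sum_congr rfl fun i _ => Finset.sum_congr rfl fun j _ => h2 i j, Finset.sum_comm]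
      exact Finset.sum_congr rfl fun i _ => by rw [h1, Finset.mul_sum]
    have h6 : ∀ i, hp.coeff i (x * y - y * x) = hp.coeff i (x * y) - hp.coeff i (y * x) :=
      fun i => by simp only [hlin, map_sub]
    simp only [h6, mul_sub, Finset.sum_sub_distrib, h5, sub_self]
  · simp [hlin]
  · intro x y _ _ hx hy
    simp only [hlin, map_add, mul_add, Finset.sum_add_distrib] at hx hy ⊢
    rw [hx, hy, add_zero]
  · intro c x _ hx
    simp only [hlin, map_smul, smul_eq_mul, mul_left_comm _ c, ← Finset.mul_sum] at hx ⊢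
    rw [hx, mul_zero]

end IsMinimalPartition

end Coefficients

/-! ### Diagonal elements as sums of two self-commutators of square-zero elements -/

section Diagonal

variable {F : Type*} [CStarAlgebra F] {n : ℕ} {p : Fin n → F}

/-- The element `y` has square zero, is supported on the projections `p i` with `i ∈ T`, and both
`y y⋆` and `y⋆ y` are diagonal; the diagonal entries of `y y⋆` are bounded by `B`. -/
structure IsDiagonalSquareZero (p : Fin n → F) (B : Fin n → ℝ) (T : Finset (Fin n)) (y : F) :
    Prop where
  sq : y * y = 0
  mul_eq_zero : ∀ i ∉ T, y * p i = 0
  mul_eq_zero' : ∀ i ∉ T, p i * y = 0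
  mul_star : ∃ a : Fin n → ℝ, (∀ i, 0 ≤ a i) ∧ (∀ i, a i ≤ B i) ∧ y * star y = ∑ i, (a i : ℂ) • p i
  star_mul : ∃ b : Fin n → ℝ, star y * y = ∑ i, (b i : ℂ) • p i

theorem IsDiagonalSquareZero.zero {B : Fin n → ℝ} (hB : ∀ i, 0 ≤ B i) (T : Finset (Fin n)) :
    IsDiagonalSquareZero p B T 0 where
  sq := by simp
  mul_eq_zero := by simp
  mul_eq_zero' := by simp
  mul_star := ⟨0, by simp, by simpa using hB, by simp⟩
  star_mul := ⟨0, by simp⟩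

theorem IsDiagonalSquareZero.mono {B : Fin n → ℝ} {T T' : Finset (Fin n)} (hT : T ⊆ T') {y : F}
    (h : IsDiagonalSquareZero p B T y) : IsDiagonalSquareZero p B T' y :=
  { h with
    mul_eq_zero := fun i hi => h.mul_eq_zero i fun h' => hi (hT h')
    mul_eq_zero' := fun i hi => h.mul_eq_zero' i fun h' => hi (hT h') }

namespace IsMinimalPartition

variable (hp : IsMinimalPartition p)
include hp

theorem sum_smul_mul (a : Fin n → ℂ) (i : Fin n) : (∑ j, a j • p j) * p i = a i • p i := by
  rw [Finset.sum_mul, Finset.sum_eq_single i]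
  · rw [smul_mul_assoc, hp.mul_self]
  · intro j _ hj
    rw [smul_mul_assoc, hp.orth j i hj, smul_zero]
  · simp

theorem eq_of_mul_eq {x y : F} (h : ∀ i, x * p i = y * p i) : x = y := by
  rw [← mul_one x, ← mul_one y, ← hp.sum_eq_one, Finset.mul_sum, Finset.mul_sum]
  exact Finset.sum_congr rfl fun i _ => h i

theorem mul_eq_zero_of_disjoint {T T' : Finset (Fin n)} (hT : Disjoint T T') {x y : F}
    (hx : ∀ i ∉ T, x * p i = 0) (hy : ∀ i ∉ T', p i * y = 0) : x * y = 0 := by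
  rw [← mul_one x, ← hp.sum_eq_one, Finset.mul_sum, Finset.sum_mul]
  refine Finset.sum_eq_zero fun i _ => ?_
  by_cases hi : i ∈ T
  · rw [mul_assoc, hy i (Finset.disjoint_left.1 hT hi), mul_zero]
  · rw [hx i hi, zero_mul]

theorem mul_star_of {T : Finset (Fin n)} {y : F} (h : ∀ i ∉ T, y * p i = 0) :
    ∀ i ∉ T, p i * star y = 0 := fun i hi => by
  have := congrArg star (h i hi)
  rwa [star_mul, hp.star_eq, star_zero] at this

theorem star_mul_of {T : Finset (Fin n)} {y : F} (h : ∀ i ∉ T, p i * y = 0) :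
    ∀ i ∉ T, star y * p i = 0 := fun i hi => by
  have := congrArg star (h i hi)
  rwa [star_mul, hp.star_eq, star_zero] at this

/-- Two elements with disjoint supports add up, and so do their absolute values. -/
theorem isDiagonalSquareZero_add {B : Fin n → ℝ} {T T' : Finset (Fin n)} (hT : Disjoint T T')
    {x y : F} (hx : IsDiagonalSquareZero p B T x) (hy : IsDiagonalSquareZero p B T' y) :
    IsDiagonalSquareZero p B (T ∪ T') (x + y) ∧
      (x + y) * star (x + y) = x * star x + y * star y ∧
      star (x + y) * (x + y) = star x * x + star y * y := by
  have h1 : x * y = 0 := hp.mul_eq_zero_of_disjoint hT hx.mul_eq_zero hy.mul_eq_zero'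
  have h2 : y * x = 0 := hp.mul_eq_zero_of_disjoint hT.symm hy.mul_eq_zero hx.mul_eq_zero'
  have h3 : x * star y = 0 :=
    hp.mul_eq_zero_of_disjoint hT hx.mul_eq_zero (hp.mul_star_of hy.mul_eq_zero)
  have h4 : y * star x = 0 :=
    hp.mul_eq_zero_of_disjoint hT.symm hy.mul_eq_zero (hp.mul_star_of hx.mul_eq_zero)
  have h5 : star x * y = 0 :=
    hp.mul_eq_zero_of_disjoint hT (hp.star_mul_of hx.mul_eq_zero') hy.mul_eq_zero'
  have h6 : star y * x = 0 :=
    hp.mul_eq_zero_of_disjoint hT.symm (hp.star_mul_of hy.mul_eq_zero') hx.mul_eq_zero'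
  have e1 : (x + y) * star (x + y) = x * star x + y * star y := by
    rw [star_add, add_mul, mul_add, mul_add, h3, h4, add_zero, zero_add]
  have e2 : star (x + y) * (x + y) = star x * x + star y * y := by
    rw [star_add, add_mul, mul_add, mul_add, h5, h6, add_zero, zero_add]
  refine ⟨⟨?_, ?_, ?_, ?_, ?_⟩, e1, e2⟩
  · rw [add_mul, mul_add, mul_add, hx.sq, hy.sq, h1, h2]
    simp
  · intro i hi
    rw [Finset.mem_union, not_or] at hi
    rw [add_mul, hx.mul_eq_zero i hi.1, hy.mul_eq_zero i hi.2, add_zero]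
  · intro i hi
    rw [Finset.mem_union, not_or] at hi
    rw [mul_add, hx.mul_eq_zero' i hi.1, hy.mul_eq_zero' i hi.2, add_zero]
  · obtain ⟨a, ha0, haB, ha⟩ := hx.mul_star
    obtain ⟨b, hb0, hbB, hb⟩ := hy.mul_star
    have haT : ∀ i ∉ T, a i = 0 := fun i hi => by
      have h := hp.sum_smul_mul (fun j => (a j : ℂ)) i
      rw [← ha, mul_assoc, hp.star_mul_of hx.mul_eq_zero' i hi, mul_zero] at h
      exact_mod_cast (smul_eq_zero.1 h.symm).resolve_right (hp.ne_zero i)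
    have hbT : ∀ i ∉ T', b i = 0 := fun i hi => by
      have h := hp.sum_smul_mul (fun j => (b j : ℂ)) i
      rw [← hb, mul_assoc, hp.star_mul_of hy.mul_eq_zero' i hi, mul_zero] at h
      exact_mod_cast (smul_eq_zero.1 h.symm).resolve_right (hp.ne_zero i)
    refine ⟨fun i => a i + b i, fun i => add_nonneg (ha0 i) (hb0 i), fun i => ?_, ?_⟩
    · by_cases hi : i ∈ T
      · simpa [hbT i (Finset.disjoint_left.1 hT hi)] using haB i
      · simpa [haT i hi] using hbB i
    · rw [e1, ha, hb, ← Finset.sum_add_distrib]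
      exact Finset.sum_congr rfl fun i _ => by rw [← add_smul, Complex.ofReal_add]
  · obtain ⟨a, ha⟩ := hx.star_mul
    obtain ⟨b, hb⟩ := hy.star_mul
    refine ⟨fun i => a i + b i, ?_⟩
    rw [e2, ha, hb, ← Finset.sum_add_distrib]
    exact Finset.sum_congr rfl fun i _ => by rw [← add_smul, Complex.ofReal_add]

/-- A multiple of the difference of two linked minimal projections is a self-commutator. -/
theorem exists_selfCommutator_of_linked {B : Fin n → ℝ} (hB : ∀ i, 0 ≤ B i) {i j : Fin n}
    (hij : i ≠ j) (h : Linked p i j) {s : ℝ} (hsi : |s| ≤ B i) (hsj : |s| ≤ B j) :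
    ∃ u : F, IsDiagonalSquareZero p B {i, j} u ∧
      u * star u - star u * u = (s : ℂ) • (p i - p j) := by
  wlog hs : 0 ≤ s generalizing i j s
  · obtain ⟨u, hu, hu'⟩ := this hij.symm (hp.linked_symm h) (s := -s) (by rwa [abs_neg])
      (by rwa [abs_neg]) (by linarith)
    refine ⟨u, by rwa [Finset.pair_comm], ?_⟩
    rw [hu', Complex.ofReal_neg, neg_smul, ← smul_neg, neg_sub]
  rw [abs_of_nonneg hs] at hsi
  obtain ⟨v, hv1, hv2, hv3, hv4⟩ := hp.exists_partialIsometry h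
  have e : ((√s : ℝ) : ℂ) * ((√s : ℝ) : ℂ) = (s : ℂ) := by
    rw [← Complex.ofReal_mul, Real.mul_self_sqrt hs]
  have h1 : ((√s : ℝ) : ℂ) • v * star (((√s : ℝ) : ℂ) • v) = (s : ℂ) • p i := by
    rw [star_smul, smul_mul_assoc, mul_smul_comm, hv1, smul_smul, Complex.star_def,
      Complex.conj_ofReal, e]
  have h2 : star (((√s : ℝ) : ℂ) • v) * (((√s : ℝ) : ℂ) • v) = (s : ℂ) • p j := by
    rw [star_smul, smul_mul_assoc, mul_smul_comm, hv2, smul_smul, Complex.star_def,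
      Complex.conj_ofReal, e]
  have hs1 : ∀ k, (s : ℂ) • p k = ∑ i, (((if i = k then s else 0 : ℝ)) : ℂ) • p i := fun k => by
    rw [Finset.sum_eq_single k]
    · simp
    · intro l _ hl
      simp [hl]
    · simp
  refine ⟨((√s : ℝ) : ℂ) • v, ⟨?_, ?_, ?_, ⟨_, ?_, ?_, h1.trans (hs1 i)⟩,
    ⟨_, h2.trans (hs1 j)⟩⟩, ?_⟩
  · have : v * v = 0 := by
      rw [← hv4, mul_assoc, ← hv3, ← mul_assoc (p j), ← mul_assoc (p j), hp.orth j i hij.symm]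
      simp
    rw [smul_mul_assoc, mul_smul_comm, this, smul_zero, smul_zero]
  · intro k hk
    rw [smul_mul_assoc, ← hv4, mul_assoc, hp.orth j k (by rintro rfl; simp at hk), mul_zero,
      smul_zero]
  · intro k hk
    rw [mul_smul_comm, ← hv3, ← mul_assoc, hp.orth k i (by rintro rfl; simp at hk), zero_mul,
      smul_zero]
  · intro k
    split_ifs <;> simp [hs]
  · intro k
    split_ifs with hk
    · rw [hk]; exact hsi
    · exact hB k
  · rw [h1, h2, smul_sub]

open Classical in
/-- A diagonal element with vanishing traces is the sum of two commuting self-commutators of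
square-zero elements.  The indices are processed one after the other; `s` is the partial sum that
has been accumulated at the last index `i`, and it is passed on to a linked index `j` at which the
diagonal entry has the opposite sign, so that partial sums stay bounded by `B`.  The two
self-commutators collect the odd and the even steps. -/
theorem exists_add_selfCommutators_aux {ν B : Fin n → ℝ} (hνB : ∀ i, |ν i| ≤ B i)
    (hB : ∀ i j, Linked p i j → B i = B j) (m : ℕ) :
    ∀ (R : Finset (Fin n)) (i : Fin n) (s : ℝ), R.card = m → i ∉ R → |s| ≤ B i →
      (∀ k, (if Linked p k i then s else 0) + ∑ j ∈ R with Linked p k j, ν j = 0) →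
      ∃ y z : F, IsDiagonalSquareZero p B (insert i R) y ∧ IsDiagonalSquareZero p B R z ∧
        (s : ℂ) • p i + ∑ j ∈ R, (ν j : ℂ) • p j =
          (y * star y - star y * y) + (z * star z - star z * z) := by
  have hB0 : ∀ i, 0 ≤ B i := fun i => (abs_nonneg _).trans (hνB i)
  induction m with
  | zero =>
    intro R i s hR hi hs hsum
    rw [Finset.card_eq_zero] at hR
    subst hR
    have h0 := hsum i
    rw [if_pos (hp.linked_refl i)] at h0
    simp only [Finset.filter_empty, Finset.sum_empty, add_zero] at h0
    exact ⟨0, 0, .zero hB0 _, .zero hB0 _, by simp [h0]⟩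
  | succ m ih =>
    intro R i s hR hi hs hsum
    obtain ⟨j, hjR, hjs, hjB⟩ : ∃ j ∈ R, (s = 0 ∨ Linked p i j) ∧ |s + ν j| ≤ B j := by
      rcases eq_or_ne s 0 with rfl | hs0
      · obtain ⟨j, hj⟩ := Finset.card_pos.1 (hR ▸ Nat.succ_pos m : 0 < R.card)
        exact ⟨j, hj, Or.inl rfl, by rw [zero_add]; exact hνB j⟩
      · have h0 := hsum i
        rw [if_pos (hp.linked_refl i)] at h0
        obtain ⟨j, hj, hjs⟩ : ∃ j ∈ R.filter (Linked p i), s * ν j < 0 := by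
          by_contra! hcon
          have h1 := Finset.sum_nonneg hcon
          rw [← Finset.mul_sum] at h1
          have h2 : s * s + s * ∑ j ∈ R with Linked p i j, ν j = 0 := by
            rw [← mul_add, h0, mul_zero]
          have h3 : 0 < s * s := mul_self_pos.2 hs0
          linarith
        rw [Finset.mem_filter] at hj
        refine ⟨j, hj.1, Or.inr hj.2, ?_⟩
        have h1 := hνB j
        rw [hB i j hj.2] at hs
        rw [abs_le] at hs h1 ⊢
        rcases lt_or_gt_of_ne hs0 with h | h
        · have : 0 < ν j := by nlinarith
          constructor <;> linarith
        · have : ν j < 0 := by nlinarith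
          constructor <;> linarith
    have hij : i ≠ j := by rintro rfl; exact hi hjR
    obtain ⟨y, z, hy, hz, hyz⟩ := ih (R.erase j) j (s + ν j)
      (by rw [Finset.card_erase_of_mem hjR, hR, Nat.add_sub_cancel]) (Finset.notMem_erase j R) hjB
      (by
        intro k
        have h1 := hsum k
        have h2 : ∑ l ∈ R with Linked p k l, ν l =
            (if Linked p k j then ν j else 0) + ∑ l ∈ R.erase j with Linked p k l, ν l := by
          rw [Finset.sum_filter, Finset.sum_filter,
            Finset.add_sum_erase R (fun l => if Linked p k l then ν l else 0) hjR]
        rw [h2] at h1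
        rcases hjs with rfl | hjs
        · simpa using h1
        · have h3 : Linked p k i ↔ Linked p k j :=
            ⟨fun h => hp.linked_trans h hjs, fun h => hp.linked_trans h (hp.linked_symm hjs)⟩
          rw [h3] at h1
          by_cases h4 : Linked p k j
          · rw [if_pos h4] at h1 ⊢
            rw [if_pos h4] at h1
            rw [← h1, add_assoc]
          · rw [if_neg h4] at h1 ⊢
            rwa [if_neg h4, zero_add] at h1)
    have hu : ∃ u : F, IsDiagonalSquareZero p B {i, j} u ∧
        u * star u - star u * u = (s : ℂ) • (p i - p j) := by
      rcases eq_or_ne s 0 with hs0 | hs0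
      · exact ⟨0, .zero hB0 _, by simp [hs0]⟩
      · have hl := hjs.resolve_left hs0
        exact hp.exists_selfCommutator_of_linked hB0 hij hl hs (hB i j hl ▸ hs)
    obtain ⟨u, hu, hus⟩ := hu
    have hdisj : Disjoint ({i, j} : Finset (Fin n)) (R.erase j) := by
      rw [Finset.disjoint_left]
      intro k hk
      simp only [Finset.mem_insert, Finset.mem_singleton] at hk
      rcases hk with rfl | rfl
      · exact fun h => hi (Finset.mem_of_mem_erase h)
      · exact Finset.notMem_erase k R
    obtain ⟨huz, h1, h2⟩ := hp.isDiagonalSquareZero_add hdisj hu hz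
    refine ⟨u + z, y, huz.mono ?_, hy.mono ?_, ?_⟩
    · intro k hk
      simp only [Finset.mem_union, Finset.mem_insert, Finset.mem_singleton,
        Finset.mem_erase] at hk ⊢
      rcases hk with (rfl | rfl) | hk
      · exact Or.inl rfl
      · exact Or.inr hjR
      · exact Or.inr hk.2
    · rw [Finset.insert_erase hjR]
    · rw [h1, h2, ← Finset.add_sum_erase _ _ hjR]
      calc (s : ℂ) • p i + ((ν j : ℂ) • p j + ∑ k ∈ R.erase j, (ν k : ℂ) • p k)
          = (s : ℂ) • (p i - p j) + (((s + ν j : ℝ) : ℂ) • p j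
            + ∑ k ∈ R.erase j, (ν k : ℂ) • p k) := by
            rw [Complex.ofReal_add, add_smul, smul_sub]; abel
        _ = _ := by rw [hyz, ← hus]; abel

open Classical in
/-- A diagonal element whose trace vanishes at every simple summand is the sum of the
self-commutators of two square-zero elements, each with diagonal absolute values and with the same
bound as the given element. -/
theorem exists_add_selfCommutators {ν B : Fin n → ℝ} (hνB : ∀ i, |ν i| ≤ B i)
    (hB : ∀ i j, Linked p i j → B i = B j)
    (hν : ∀ k, ∑ j with Linked p k j, ν j = 0) :
    ∃ y z : F, IsDiagonalSquareZero p B Finset.univ y ∧ IsDiagonalSquareZero p B Finset.univ z ∧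
      ∑ j, (ν j : ℂ) • p j = (y * star y - star y * y) + (z * star z - star z * z) := by
  rcases isEmpty_or_nonempty (Fin n) with h | ⟨⟨i⟩⟩
  · have hB0 : ∀ i, 0 ≤ B i := fun i => (abs_nonneg _).trans (hνB i)
    exact ⟨0, 0, .zero hB0 _, .zero hB0 _, by simp⟩
  · obtain ⟨y, z, hy, hz, h⟩ := hp.exists_add_selfCommutators_aux hνB hB _
      (Finset.univ.erase i) i (ν i) rfl (Finset.notMem_erase _ _) (hνB i) (fun k => by
        refine Eq.trans ?_ (hν k)
        rw [Finset.sum_filter, Finset.sum_filter,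
          Finset.add_sum_erase _ (fun l => if Linked p k l then ν l else 0) (Finset.mem_univ i)])
    refine ⟨y, z, hy.mono (Finset.subset_univ _), hz.mono (Finset.subset_univ _), ?_⟩
    rw [← h, Finset.add_sum_erase _ (fun l => (ν l : ℂ) • p l) (Finset.mem_univ i)]

end IsMinimalPartition

open Classical in
/-- The average of `r` over the class of `i`, that is, the normalized trace of `∑ r j • p j` at
the simple summand containing `p i`. -/
def classMean (p : Fin n → F) (r : Fin n → ℝ) (i : Fin n) : ℝ :=
  (∑ j with Linked p i j, r j) / (Finset.univ.filter (Linked p i)).card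

open Classical in
theorem classMean_congr (hp : IsMinimalPartition p) (r : Fin n → ℝ) {i j : Fin n}
    (h : Linked p i j) : classMean p r i = classMean p r j := by
  have e : Finset.univ.filter (Linked p i) = Finset.univ.filter (Linked p j) :=
    Finset.filter_congr fun k _ =>
      ⟨fun h' => hp.linked_trans (hp.linked_symm h) h', fun h' => hp.linked_trans h h'⟩
  rw [classMean, classMean, e]

open Classical in
theorem sum_sub_classMean (hp : IsMinimalPartition p) (r : Fin n → ℝ) (i : Fin n) :
    ∑ j with Linked p i j, (r j - classMean p r j) = 0 := by
  have h1 : ∀ j ∈ Finset.univ.filter (Linked p i), classMean p r j = classMean p r i := by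
    intro j hj
    exact (classMean_congr hp r (Finset.mem_filter.1 hj).2).symm
  have hcard : ((Finset.univ.filter (Linked p i)).card : ℝ) ≠ 0 := by
    rw [Nat.cast_ne_zero, Finset.card_ne_zero]
    exact ⟨i, by simp [hp.linked_refl i]⟩
  rw [Finset.sum_sub_distrib, Finset.sum_congr rfl h1, Finset.sum_const, nsmul_eq_mul, classMean,
    mul_div_cancel₀ _ hcard, sub_self]

end Diagonal

/-! ### Transport along order zero maps -/

section OrthogonalSum

variable {F A : Type*} [CStarAlgebra F] [PartialOrder F] [StarOrderedRing F]
  [NonUnitalCStarAlgebra A] [PartialOrder A] [StarOrderedRing A]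
  {φ : F →CP A} {n : ℕ} {p : Fin n → F}

theorem real_smul_map (φ : F →CP A) (c : ℝ) (x : F) : φ ((c : ℂ) • x) = c • φ x := by
  rw [map_smul, Complex.coe_smul]

/-- The images of orthogonal projections under an order zero map are orthogonal, so that the norm
of a combination of them is the maximum of the norms of the summands. -/
theorem IsOrderZero.norm_map_sum_le (hφ : IsOrderZero φ) (hp : IsMinimalPartition p)
    (c : Fin n → ℝ) {δ : ℝ} (hδ : 0 ≤ δ) (hc : ∀ i, |c i| * ‖φ (p i)‖ ≤ δ) :
    ‖φ (∑ i, (c i : ℂ) • p i)‖ ≤ δ := by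
  classical
  have hsa : ∀ s : Finset (Fin n), IsSelfAdjoint (∑ i ∈ s, c i • φ (p i)) := fun s => by
    rw [IsSelfAdjoint, star_sum]
    refine Finset.sum_congr rfl fun i _ => ?_
    rw [star_smul, star_trivial, ← map_star_cp, hp.star_eq]
  have hort : ∀ i j, i ≠ j → φ (p i) * φ (p j) = 0 := fun i j hij =>
    hφ _ _ (hp.proj i).nonneg (hp.proj j).nonneg (hp.orth i j hij)
  have key : ∀ s : Finset (Fin n), ‖∑ i ∈ s, c i • φ (p i)‖ ≤ δ := by
    intro s
    induction s using Finset.induction with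
    | empty => simpa using hδ
    | insert i s hi ih =>
      rw [Finset.sum_insert hi]
      have h1 : (c i • φ (p i)) * ∑ j ∈ s, c j • φ (p j) = 0 := by
        rw [Finset.mul_sum]
        refine Finset.sum_eq_zero fun j hj => ?_
        rw [smul_mul_assoc, mul_smul_comm, hort i j (by rintro rfl; exact hi hj), smul_zero,
          smul_zero]
      have h2 : (∑ j ∈ s, c j • φ (p j)) * (c i • φ (p i)) = 0 := by
        rw [Finset.sum_mul]
        refine Finset.sum_eq_zero fun j hj => ?_
        rw [smul_mul_assoc, mul_smul_comm, hort j i (by rintro rfl; exact hi hj), smul_zero,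
          smul_zero]
      have h3 : IsSelfAdjoint (c i • φ (p i)) := by simpa using hsa {i}
      rw [h3.isStarNormal.norm_add_eq_max (hsa s).isStarNormal (h1.trans h2.symm) h1]
      refine max_le ?_ ih
      rw [norm_smul, Real.norm_eq_abs]
      exact hc i
  have := key Finset.univ
  have e : ∀ i, φ ((c i : ℂ) • p i) = c i • φ (p i) := fun i => real_smul_map φ _ _
  rw [map_sum]
  simpa only [e] using this

end OrthogonalSum

section Transport

variable {F A : Type*} [CStarAlgebra F] [PartialOrder F] [StarOrderedRing F]
  [FiniteDimensional ℂ F] [NonUnitalCStarAlgebra A] [PartialOrder A] [StarOrderedRing A]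
  {φ : F →CP A} {n : ℕ} {p : Fin n → F}

theorem IsOrderZero.norm_coeff_mul_le (hφ : IsOrderZero φ) (hp : IsMinimalPartition p) (i : Fin n)
    (y : F) : ‖hp.coeff i y‖ * ‖φ (p i)‖ ≤ ‖φ y‖ := by
  have hp1 : ‖p i‖ ≤ 1 := (hp.proj i).norm_le
  rw [← norm_smul, ← map_smul, ← hp.coeff_spec]
  calc ‖φ (p i * y * p i)‖ ≤ ‖φ (p i * y)‖ * ‖p i‖ := hφ.norm_map_mul_le' _ _
    _ ≤ ‖p i‖ * ‖φ y‖ * ‖p i‖ := by gcongr; exact hφ.norm_map_mul_le _ _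
    _ ≤ 1 * ‖φ y‖ * 1 := by gcongr
    _ = ‖φ y‖ := by ring

theorem IsOrderZero.norm_map_le_of_linked (hφ : IsOrderZero φ) (hp : IsMinimalPartition p)
    {i j : Fin n} (h : Linked p i j) : ‖φ (p i)‖ ≤ ‖φ (p j)‖ := by
  obtain ⟨v, hv1, hv2, hv3, hv4⟩ := hp.exists_partialIsometry h
  have hv : ‖v‖ ≤ 1 := by
    have h1 : ‖v‖ * ‖v‖ ≤ 1 := by
      rw [← CStarRing.norm_star_mul_self, hv2]
      exact (hp.proj j).norm_le
    nlinarith [norm_nonneg v]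
  have e : p i = v * p j * star v := by rw [hv4, hv1]
  calc ‖φ (p i)‖ = ‖φ (v * p j * star v)‖ := by rw [← e]
    _ ≤ ‖φ (v * p j)‖ * ‖star v‖ := hφ.norm_map_mul_le' _ _
    _ ≤ ‖v‖ * ‖φ (p j)‖ * ‖star v‖ := by gcongr; exact hφ.norm_map_mul_le _ _
    _ ≤ 1 * ‖φ (p j)‖ * 1 := by rw [norm_star]; gcongr
    _ = ‖φ (p j)‖ := by ring

/-- The normalized traces of an element that `φ` does not distinguish from a sum of commutators
are small on the summands on which `φ` is large. -/
theorem IsOrderZero.abs_classMean_mul_le (hφ : IsOrderZero φ) (hp : IsMinimalPartition p)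
    {r : Fin n → ℝ} {t : F}
    (ht : t ∈ Submodule.span ℂ {z : F | ∃ x y : F, z = x * y - y * x}) (i : Fin n) :
    |classMean p r i| * ‖φ (p i)‖ ≤ ‖φ (∑ j, (r j : ℂ) • p j - t)‖ := by
  classical
  set y := ∑ j, (r j : ℂ) • p j - t with hy
  have hcard : (0 : ℝ) < (Finset.univ.filter (Linked p i)).card := by
    rw [Nat.cast_pos, Finset.card_pos]
    exact ⟨i, by simp [hp.linked_refl i]⟩
  have h1 : ∀ j, hp.coeff j y = r j - hp.coeff j t := fun j => by
    have e : hp.coeff j (∑ j, (r j : ℂ) • p j) = r j := hp.coeff_eq_of (by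
      rw [hp.mul_sum_smul, smul_mul_assoc, hp.mul_self])
    rw [← e]
    exact map_sub (hp.coeffₗ j) _ _
  have h2 : ∑ j with Linked p i j, hp.coeff j t = 0 := by
    have := hp.sum_coeff_eq_zero (w := fun j => if Linked p i j then 1 else 0) (fun j k hjk => by
      have : Linked p i j ↔ Linked p i k :=
        ⟨fun h => hp.linked_trans h hjk, fun h => hp.linked_trans h (hp.linked_symm hjk)⟩
      simp only [this]) ht
    simpa [Finset.sum_filter] using this
  have h3 : ((∑ j with Linked p i j, r j : ℝ) : ℂ) = ∑ j with Linked p i j, hp.coeff j y := by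
    simp only [h1, Finset.sum_sub_distrib, h2, sub_zero, Complex.ofReal_sum]
  have h4 : |∑ j with Linked p i j, r j| ≤ ∑ j with Linked p i j, ‖hp.coeff j y‖ := by
    rw [← Real.norm_eq_abs, ← Complex.norm_real, h3]
    exact norm_sum_le _ _
  rw [classMean, abs_div, abs_of_pos hcard, div_mul_eq_mul_div, div_le_iff₀ hcard]
  calc |∑ j with Linked p i j, r j| * ‖φ (p i)‖
      ≤ (∑ j with Linked p i j, ‖hp.coeff j y‖) * ‖φ (p i)‖ := by gcongr
    _ = ∑ j with Linked p i j, ‖hp.coeff j y‖ * ‖φ (p i)‖ := Finset.sum_mul _ _ _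
    _ ≤ ∑ j with Linked p i j, ‖φ y‖ := by
        refine Finset.sum_le_sum fun j hj => ?_
        refine le_trans ?_ (hφ.norm_coeff_mul_le hp j y)
        gcongr
        exact hφ.norm_map_le_of_linked hp (Finset.mem_filter.1 hj).2
    _ = ‖φ y‖ * (Finset.univ.filter (Linked p i)).card := by
        rw [Finset.sum_const, nsmul_eq_mul, mul_comm]

/-- The maps `q φ`, where `q` is a function of `φ 1`, send square-zero elements to square-zero
elements, and `q` can be chosen such that self-commutators are preserved up to `η`. -/
theorem IsOrderZero.exists_multiplier (hφ : IsOrderZero φ) (hc : IsContractiveCP φ) {C η : ℝ}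
    (hC : 0 ≤ C) (hη : 0 < η) :
    ∃ q : A, IsSelfAdjoint q ∧ (∀ f, Commute q (φ f)) ∧ ‖q * q * φ 1‖ ≤ 1 ∧
      ∀ w, ‖w‖ ≤ C → ‖φ w - q * q * φ 1 * φ w‖ ≤ η := by
  set k := φ 1 with hk
  have hk0 : 0 ≤ k := map_nonneg_cp φ zero_le_one
  have hksa : IsSelfAdjoint k := hk0.isSelfAdjoint
  obtain ⟨θ, hθ, hθC⟩ : ∃ θ : ℝ, 0 < θ ∧ 2 * θ * C ^ 2 ≤ η ^ 2 := by
    refine ⟨η ^ 2 / (2 * (C ^ 2 + 1)), by positivity, ?_⟩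
    rw [mul_div_assoc', div_mul_eq_mul_div, div_le_iff₀ (by positivity)]
    nlinarith [sq_nonneg η]
  -- a regularization of `t ↦ t ^ (-1/2)`, so that `g (φ 1) ^ 2 * φ 1` is nearly a unit
  let g : ℝ → ℝ := fun t => √|t| / (|t| + θ)
  have hg : Continuous g := by
    refine Continuous.div (by fun_prop) (by fun_prop) fun t => ?_
    positivity
  have hg0 : g 0 = 0 := by simp [g]
  have hspec : ∀ t ∈ quasispectrum ℝ k, 0 ≤ t := fun t ht =>
    quasispectrum_nonneg_of_nonneg k hk0 t ht
  have hgt : ∀ t, 0 ≤ t → g t * g t * t = (t / (t + θ)) ^ 2 := fun t ht => by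
    simp only [g, abs_of_nonneg ht]
    rw [div_mul_div_comm, Real.mul_self_sqrt ht, div_pow, ← sq (t + θ), div_mul_eq_mul_div, ← sq]
  set q := cfcₙ g k with hq
  have hqsa : IsSelfAdjoint q := cfcₙ_predicate g k
  have hqc : ∀ f, Commute q (φ f) := fun f => (hφ.commute_map_one f).cfcₙ_real g
  have hG : q * q * k = cfcₙ (fun t => g t * g t * t) k := by
    have h1 : cfcₙ (fun t => g t * g t) k = q * q :=
      cfcₙ_mul g g k hg.continuousOn hg0 hg.continuousOn hg0
    have h2 := cfcₙ_mul (fun t => g t * g t) (fun t => t) k (hg.mul hg).continuousOn (by simp [hg0])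
      continuous_id.continuousOn rfl
    rw [h2, h1, cfcₙ_id' ℝ k]
  have hGc : Continuous fun t => g t * g t * t := (hg.mul hg).mul continuous_id
  have hG1 : ‖q * q * k‖ ≤ 1 := by
    rw [hG]
    refine norm_cfcₙ_le fun t ht => ?_
    have ht0 := hspec t ht
    rw [hgt t ht0, Real.norm_eq_abs, abs_of_nonneg (by positivity)]
    have : t / (t + θ) ≤ 1 := by rw [div_le_one (by positivity)]; linarith
    exact pow_le_one₀ (by positivity) this
  refine ⟨q, hqsa, hqc, hG1, fun w hw => ?_⟩
  set G := q * q * k with hGdef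
  have hGsa : IsSelfAdjoint G := by rw [hG]; exact cfcₙ_predicate _ k
  have hGcomm : ∀ f, Commute G (φ f) := fun f =>
    ((hqc f).mul_left (hqc f)).mul_left (hφ.commute_map_one f)
  have hK : k - G * k - G * k + G * (G * k) =
      cfcₙ (fun t => t * (1 - g t * g t * t) ^ 2) k := by
    let γ : ℝ → ℝ := fun t => g t * g t * t
    have hγ0 : γ 0 = 0 := by simp [γ]
    have h1 : cfcₙ (fun t => γ t * t) k = G * k := by
      rw [cfcₙ_mul γ (fun t => t) k hGc.continuousOn hγ0 continuous_id.continuousOn rfl,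
        cfcₙ_id' ℝ k, hG]
    have h2 : cfcₙ (fun t => γ t * (γ t * t)) k = G * (G * k) := by
      rw [cfcₙ_mul γ (fun t => γ t * t) k hGc.continuousOn hγ0
        (hGc.mul continuous_id).continuousOn (by simp), h1, hG]
    have hc1 : Continuous fun t => γ t * t := hGc.mul continuous_id
    have hc2 : Continuous fun t => γ t * (γ t * t) := hGc.mul hc1
    have h3 : cfcₙ (fun t => t - γ t * t) k = k - G * k := by
      rw [cfcₙ_sub (fun t => t) (fun t => γ t * t) k continuous_id.continuousOn rfl
        hc1.continuousOn (by simp), h1, cfcₙ_id' ℝ k]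
    have h4 : cfcₙ (fun t => t - γ t * t - γ t * t) k = k - G * k - G * k := by
      rw [cfcₙ_sub (fun t => t - γ t * t) (fun t => γ t * t) k
        (continuous_id.sub hc1).continuousOn (by simp) hc1.continuousOn (by simp), h1, h3]
    rw [← h4, ← h2, ← cfcₙ_add (fun t => t - γ t * t - γ t * t) (fun t => γ t * (γ t * t)) k
      ((continuous_id.sub hc1).sub hc1).continuousOn (by simp) hc2.continuousOn (by simp)]
    congr 1
    funext t
    simp only [γ]
    ring
  have hKn : ‖k - G * k - G * k + G * (G * k)‖ ≤ 2 * θ := by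
    rw [hK]
    refine norm_cfcₙ_le fun t ht => ?_
    have ht0 := hspec t ht
    rw [hgt t ht0, Real.norm_eq_abs, abs_of_nonneg (by positivity)]
    -- `1 - (t / (t + θ))²` is at most `1` and at most `2 θ / (t + θ)`
    set u := t / (t + θ) with hu
    have hu0 : 0 ≤ u := by positivity
    have hu1 : u ≤ 1 := by rw [hu, div_le_one (by positivity)]; linarith
    have h1 : t * (1 - u) = θ * u := by
      rw [hu]; field_simp; ring
    have h2 : t * (1 - u ^ 2) ≤ 2 * θ := by
      have : t * (1 - u ^ 2) = θ * u * (1 + u) := by rw [← h1]; ring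
      rw [this]
      nlinarith [mul_nonneg hu0 (sub_nonneg.2 hu1)]
    have h3 : 0 ≤ 1 - u ^ 2 := by nlinarith
    have h4 : 1 - u ^ 2 ≤ 1 := by nlinarith
    calc t * (1 - u ^ 2) ^ 2 = t * (1 - u ^ 2) * (1 - u ^ 2) := by ring
      _ ≤ 2 * θ * 1 := mul_le_mul h2 h4 h3 (by positivity)
      _ = 2 * θ := mul_one _
  have hZ : (φ w - G * φ w) * star (φ w - G * φ w) =
      (k - G * k - G * k + G * (G * k)) * φ (w * star w) := by
    have h1 : φ w * φ (star w) = k * φ (w * star w) := hφ.map_mul_map' _ _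
    rw [star_sub, star_mul, hGsa.star_eq, ← map_star_cp, ← (hGcomm (star w)).eq]
    calc (φ w - G * φ w) * (φ (star w) - G * φ (star w))
        = φ w * φ (star w) - G * (φ w * φ (star w)) - φ w * G * φ (star w)
          + G * (φ w * G * φ (star w)) := by noncomm_ring
      _ = φ w * φ (star w) - G * (φ w * φ (star w)) - G * (φ w * φ (star w))
          + G * (G * (φ w * φ (star w))) := by rw [← (hGcomm w).eq]; simp only [mul_assoc]
      _ = _ := by rw [h1]; noncomm_ring
  have hfin : ‖φ w - G * φ w‖ ^ 2 ≤ η ^ 2 := by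
    calc ‖φ w - G * φ w‖ ^ 2 = ‖(φ w - G * φ w) * star (φ w - G * φ w)‖ := by
          rw [CStarRing.norm_self_mul_star, sq]
      _ ≤ 2 * θ * (C * C) := by
          rw [hZ]
          refine (norm_mul_le _ _).trans ?_
          gcongr
          refine (hc _).trans ?_
          rw [CStarRing.norm_self_mul_star]
          gcongr
      _ ≤ η ^ 2 := by rw [← sq]; exact hθC
  exact le_of_sq_le_sq hfin hη.le

/-- If `f` is selfadjoint and `φ` nearly maps it to the image of a sum of commutators, then `φ f`
is nearly the sum of two commuting self-commutators of square-zero elements. -/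
theorem IsOrderZero.exists_selfCommutators (hφ : IsOrderZero φ) (hc : IsContractiveCP φ) {f t : F}
    (hf : IsSelfAdjoint f) (ht : t ∈ Submodule.span ℂ {z : F | ∃ x y : F, z = x * y - y * x})
    {δ η : ℝ} (hδ : ‖φ (f - t)‖ ≤ δ) (hη : 0 < η) :
    ∃ x z : A, x * x = 0 ∧ z * z = 0 ∧ ‖x‖ ^ 2 ≤ ‖f‖ + δ ∧ ‖z‖ ^ 2 ≤ ‖f‖ + δ ∧
      Commute (x * star x - star x * x) (z * star z - star z * z) ∧
      ‖φ f - ((x * star x - star x * x) + (z * star z - star z * z))‖ ≤ δ + η := by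
  classical
  have hδ0 : 0 ≤ δ := (norm_nonneg _).trans hδ
  obtain ⟨n, p, r, hp, hfr⟩ := exists_isMinimalPartition hf
  set μ := classMean p r with hμ
  have hμφ : ∀ i, |μ i| * ‖φ (p i)‖ ≤ δ := fun i =>
    (hφ.abs_classMean_mul_le hp ht i).trans (by rwa [← hfr])
  have hr : ∀ i, |r i| ≤ ‖f‖ := fun i => by
    have h1 : f * p i = (r i : ℂ) • p i := by rw [hfr]; exact hp.sum_smul_mul _ i
    have h2 := norm_mul_le f (p i)
    rw [h1, norm_smul, Complex.norm_real, Real.norm_eq_abs] at h2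
    exact le_of_mul_le_mul_right h2 (norm_pos_iff.2 (hp.ne_zero i))
  set B : Fin n → ℝ := fun i => ‖f‖ + |μ i| with hB
  obtain ⟨y₁, y₂, hy₁, hy₂, hy⟩ := hp.exists_add_selfCommutators (ν := fun i => r i - μ i) (B := B)
    (fun i => (abs_sub _ _).trans (add_le_add (hr i) le_rfl))
    (fun i j hij => by simp only [hB, hμ, classMean_congr hp r hij]) (sum_sub_classMean hp r)
  -- `m` is the central part of `f`; it is small under `φ`, and `f - m` has vanishing traces
  set m := ∑ i, (μ i : ℂ) • p i with hm
  have hfm : ∑ i, ((r i - μ i : ℝ) : ℂ) • p i = f - m := by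
    rw [hfr, hm, ← Finset.sum_sub_distrib]
    exact Finset.sum_congr rfl fun i _ => by rw [← sub_smul, Complex.ofReal_sub]
  rw [hfm] at hy
  obtain ⟨q, hq, hqφ, hq1, hqw⟩ := hφ.exists_multiplier hc (norm_nonneg (f - m)) hη
  set G := q * q * φ 1 with hG
  have hGφ : ∀ w, Commute G (φ w) := fun w =>
    ((hqφ w).mul_left (hqφ w)).mul_left (hφ.commute_map_one w)
  -- products of two elements of the form `q φ y`
  have hmul : ∀ a b, (q * φ a) * (q * φ b) = G * φ (a * b) := fun a b => by
    calc (q * φ a) * (q * φ b) = q * (φ a * q) * φ b := by simp only [mul_assoc]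
      _ = q * q * (φ a * φ b) := by rw [← (hqφ a).eq]; simp only [mul_assoc]
      _ = _ := by rw [hφ.map_mul_map', hG]; simp only [mul_assoc]
  have hstar : ∀ a, star (q * φ a) = q * φ (star a) := fun a => by
    rw [star_mul, hq.star_eq, ← map_star_cp, (hqφ _).eq]
  have hcomm : ∀ a, (q * φ a) * star (q * φ a) - star (q * φ a) * (q * φ a) =
      G * φ (a * star a - star a * a) := fun a => by
    rw [hstar, hmul, hmul, map_sub, mul_sub]
  have hsq : ∀ a, a * a = 0 → (q * φ a) * (q * φ a) = 0 := fun a ha => by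
    rw [hmul, ha, map_zero, mul_zero]
  have hnorm : ∀ a, IsDiagonalSquareZero p B Finset.univ a → ‖q * φ a‖ ^ 2 ≤ ‖f‖ + δ := by
    intro a ha
    obtain ⟨α, hα0, hαB, hα⟩ := ha.mul_star
    have h1 : φ (a * star a) ≤ ‖f‖ • φ 1 + φ (∑ i, ((|μ i| : ℝ) : ℂ) • p i) := by
      rw [hα, ← hp.sum_eq_one, map_sum, map_sum, map_sum, Finset.smul_sum,
        ← Finset.sum_add_distrib]
      refine Finset.sum_le_sum fun i _ => ?_
      rw [real_smul_map, real_smul_map, ← add_smul]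
      exact smul_le_smul_of_nonneg_right (hαB i) (map_nonneg_cp φ (hp.proj i).nonneg)
    have h2 : ‖φ (a * star a)‖ ≤ ‖f‖ + δ := by
      refine (CStarAlgebra.norm_le_norm_of_nonneg_of_le
        (map_nonneg_cp φ (mul_star_self_nonneg a)) h1).trans ((norm_add_le _ _).trans ?_)
      refine add_le_add ?_ (hφ.norm_map_sum_le hp _ hδ0 fun i => by rw [abs_abs]; exact hμφ i)
      rw [norm_smul, norm_norm]
      have h3 : ‖φ 1‖ ≤ 1 := (hc 1).trans (IsStarProjection.one F).norm_le
      nlinarith [norm_nonneg f]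
    calc ‖q * φ a‖ ^ 2 = ‖G * φ (a * star a)‖ := by
          rw [← hmul, ← hstar, CStarRing.norm_self_mul_star, sq]
      _ ≤ ‖G‖ * ‖φ (a * star a)‖ := norm_mul_le _ _
      _ ≤ 1 * (‖f‖ + δ) := by gcongr
      _ = _ := one_mul _
  refine ⟨q * φ y₁, q * φ y₂, hsq _ hy₁.sq, hsq _ hy₂.sq, hnorm _ hy₁, hnorm _ hy₂, ?_, ?_⟩
  · rw [hcomm, hcomm]
    have hdiag : ∀ a, IsDiagonalSquareZero p B Finset.univ a →
        ∃ c : Fin n → ℂ, a * star a - star a * a = ∑ i, c i • p i := by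
      intro a ha
      obtain ⟨α, -, -, hα⟩ := ha.mul_star
      obtain ⟨β, hβ⟩ := ha.star_mul
      refine ⟨fun i => (α i : ℂ) - (β i : ℂ), ?_⟩
      rw [hα, hβ, ← Finset.sum_sub_distrib]
      exact Finset.sum_congr rfl fun i _ => (sub_smul _ _ _).symm
    obtain ⟨c, hc'⟩ := hdiag y₁ hy₁
    obtain ⟨d, hd'⟩ := hdiag y₂ hy₂
    have h1 : (∑ i, c i • p i) * ∑ i, d i • p i = (∑ i, d i • p i) * ∑ i, c i • p i := by
      refine hp.eq_of_mul_eq fun i => ?_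
      rw [mul_assoc, mul_assoc, hp.sum_smul_mul, hp.sum_smul_mul, mul_smul_comm, mul_smul_comm,
        hp.sum_smul_mul, hp.sum_smul_mul, smul_smul, smul_smul, mul_comm]
    have h2 : Commute (φ (∑ i, c i • p i)) (φ (∑ i, d i • p i)) := by
      rw [Commute, SemiconjBy, hφ.map_mul_map, h1, ← hφ.map_mul_map]
    rw [hc', hd']
    exact ((Commute.refl G).mul_right (hGφ _)).mul_left ((hGφ _).symm.mul_right h2)
  · rw [hcomm, hcomm, ← mul_add, ← map_add, ← hy]
    have h1 : φ f - G * φ (f - m) = φ m + (φ (f - m) - G * φ (f - m)) := by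
      rw [map_sub]; abel
    rw [h1]
    exact (norm_add_le _ _).trans
      (add_le_add (hφ.norm_map_sum_le hp μ hδ0 hμφ) (hqw _ le_rfl))

end Transport

/-! ### Downward maps send commutators close to commutators -/

section Factorization

variable {A : Type*} [NonUnitalCStarAlgebra A] [PartialOrder A] [StarOrderedRing A]

/-- An approximate right module map is an approximate left module map; the approximate unit `e`
removes the extra factor. -/
theorem norm_mul_map_sub_le (Φ : A →CP A) (hΦ : IsContractiveCP Φ) {e a b : A} {R s t : ℝ}
    (ha : ‖a‖ ≤ R) (h : ‖Φ (e * (star b * star a)) - Φ (e * star b) * star a‖ ≤ s)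
    (hb : ‖star b - e * star b‖ ≤ t) : ‖a * Φ b - Φ (a * b)‖ ≤ 2 * (t * R) + s := by
  have h0 : 0 ≤ R := (norm_nonneg _).trans ha
  have ht : 0 ≤ t := (norm_nonneg _).trans hb
  have e1 : ‖a * Φ b - Φ (a * b)‖ = ‖Φ (star b) * star a - Φ (star b * star a)‖ := by
    rw [← norm_star, star_sub, star_mul, ← map_star_cp, ← map_star_cp, star_mul]
  have e2 : Φ (star b) * star a - Φ (star b * star a) =
      Φ (star b - e * star b) * star a - Φ ((star b - e * star b) * star a)
        - (Φ (e * (star b * star a)) - Φ (e * star b) * star a) := by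
    rw [map_sub, sub_mul, sub_mul, map_sub, mul_assoc]; abel
  rw [← norm_star a] at ha
  have h1 : ‖Φ (star b - e * star b) * star a‖ ≤ t * R :=
    (norm_mul_le _ _).trans (mul_le_mul ((hΦ _).trans hb) ha (norm_nonneg _) ht)
  have h2 : ‖Φ ((star b - e * star b) * star a)‖ ≤ t * R :=
    (hΦ _).trans ((norm_mul_le _ _).trans (mul_le_mul hb ha (norm_nonneg _) ht))
  rw [e1, e2]
  calc _ ≤ t * R + t * R + s := (norm_sub_le _ _).trans
        (add_le_add ((norm_sub_le _ _).trans (add_le_add h1 h2)) h)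
    _ = _ := by ring

theorem norm_sub_mul_mul_le {A : Type*} [NonUnitalCStarAlgebra A] {e a : A} {t : ℝ} (he : ‖e‖ ≤ 1)
    (ha : ‖a - e * a‖ ≤ t) : ‖a - e * (e * a)‖ ≤ 2 * t := by
  have e1 : a - e * (e * a) = (a - e * a) + e * (a - e * a) := by rw [mul_sub]; abel
  rw [e1]
  refine (norm_add_le _ _).trans ?_
  have := norm_mul_le e (a - e * a)
  nlinarith [norm_nonneg e, norm_nonneg (a - e * a)]

/-- An approximate bimodule map `Φ` is multiplicative up to the factor `Φ (e e)`, where `e` is an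
approximate unit: both products are close to `Φ (e e) a Φ b`. -/
theorem norm_map_mul_map_sub_le (Φ : A →CP A) (hΦ : IsContractiveCP Φ) {e a b : A} {R s t : ℝ}
    (he : ‖e‖ ≤ 1) (ha : ‖a‖ ≤ R) (hb : ‖b‖ ≤ R) (hR : 1 ≤ R)
    (h₁ : ‖Φ (e * (e * a)) - Φ (e * e) * a‖ ≤ s)
    (h₂ : ‖Φ (e * (star b * star a)) - Φ (e * star b) * star a‖ ≤ s)
    (h₃ : ‖a - e * a‖ ≤ t) (h₄ : ‖star b - e * star b‖ ≤ t) :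
    ‖Φ (e * e) * Φ (a * b) - Φ a * Φ b‖ ≤ (4 * t + 2 * s) * R := by
  have hs : 0 ≤ s := (norm_nonneg _).trans h₁
  have ht : 0 ≤ t := (norm_nonneg _).trans h₃
  have hee : ‖Φ (e * e)‖ ≤ 1 :=
    (hΦ _).trans ((norm_mul_le _ _).trans (by nlinarith [norm_nonneg e]))
  have hΦb : ‖Φ b‖ ≤ R := (hΦ b).trans hb
  have e1 : Φ (e * e) * Φ (a * b) - Φ a * Φ b = -(Φ (e * e) * (a * Φ b - Φ (a * b)))
      - (Φ (e * (e * a)) - Φ (e * e) * a) * Φ b - Φ (a - e * (e * a)) * Φ b := by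
    rw [map_sub]; noncomm_ring
  have h5 := norm_mul_map_sub_le Φ hΦ ha h₂ h₄
  have h6 := norm_sub_mul_mul_le he h₃
  have h7 : ‖-(Φ (e * e) * (a * Φ b - Φ (a * b)))‖ ≤ 1 * (2 * (t * R) + s) := by
    rw [norm_neg]
    exact (norm_mul_le _ _).trans (mul_le_mul hee h5 (norm_nonneg _) zero_le_one)
  have h8 : ‖(Φ (e * (e * a)) - Φ (e * e) * a) * Φ b‖ ≤ s * R :=
    (norm_mul_le _ _).trans (mul_le_mul h₁ hΦb (norm_nonneg _) hs)
  have h9 : ‖Φ (a - e * (e * a)) * Φ b‖ ≤ 2 * t * R :=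
    (norm_mul_le _ _).trans (mul_le_mul ((hΦ _).trans h6) hΦb (norm_nonneg _) (by positivity))
  rw [e1]
  have h10 := (norm_sub_le (-(Φ (e * e) * (a * Φ b - Φ (a * b)))
      - (Φ (e * (e * a)) - Φ (e * e) * a) * Φ b) (Φ (a - e * (e * a)) * Φ b)).trans
    (add_le_add (norm_sub_le _ _) le_rfl)
  nlinarith

/-- For an approximate bimodule map `Φ`, the factor `Φ (e e)` is nearly central in its image. -/
theorem norm_map_commutator_le (Φ : A →CP A) (hΦ : IsContractiveCP Φ) {e b : A} {R s t : ℝ}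
    (he : ‖e‖ ≤ 1) (hesa : IsSelfAdjoint e) (hR : 1 ≤ R)
    (h₁ : ‖Φ (e * (e * b)) - Φ (e * e) * b‖ ≤ s)
    (h₂ : ‖Φ (e * (e * star b)) - Φ (e * e) * star b‖ ≤ s)
    (h₃ : ‖b - e * b‖ ≤ t) (h₄ : ‖star b - e * star b‖ ≤ t) :
    ‖Φ (e * e) * Φ b - Φ b * Φ (e * e)‖ ≤ (4 * t + 2 * s) * R := by
  have hs : 0 ≤ s := (norm_nonneg _).trans h₁
  have ht : 0 ≤ t := (norm_nonneg _).trans h₃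
  have hee : ‖Φ (e * e)‖ ≤ 1 :=
    (hΦ _).trans ((norm_mul_le _ _).trans (by nlinarith [norm_nonneg e]))
  have e1 : Φ (e * e) * Φ b - Φ b * Φ (e * e) =
      Φ (e * e) * Φ (b - b * (e * e)) + Φ (e * e) * (Φ (b * (e * e)) - b * Φ (e * e))
      - (Φ (e * (e * b)) - Φ (e * e) * b) * Φ (e * e) - Φ (b - e * (e * b)) * Φ (e * e) := by
    rw [map_sub, map_sub]; noncomm_ring
  have h5 : ‖Φ (b * (e * e)) - b * Φ (e * e)‖ ≤ s := by
    rw [← norm_star, star_sub, star_mul, ← map_star_cp, ← map_star_cp, star_mul, star_mul,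
      hesa.star_eq, mul_assoc]
    exact h₂
  have h6 : ‖b - b * (e * e)‖ ≤ 2 * t := by
    rw [← norm_star, star_sub, star_mul, star_mul, hesa.star_eq, mul_assoc]
    exact norm_sub_mul_mul_le he h₄
  have h7 := norm_sub_mul_mul_le he h₃
  have h8 : ‖Φ (e * e) * Φ (b - b * (e * e))‖ ≤ 1 * (2 * t) :=
    (norm_mul_le _ _).trans (mul_le_mul hee ((hΦ _).trans h6) (norm_nonneg _) zero_le_one)
  have h9 : ‖Φ (e * e) * (Φ (b * (e * e)) - b * Φ (e * e))‖ ≤ 1 * s :=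
    (norm_mul_le _ _).trans (mul_le_mul hee h5 (norm_nonneg _) zero_le_one)
  have h10 : ‖(Φ (e * (e * b)) - Φ (e * e) * b) * Φ (e * e)‖ ≤ s * 1 :=
    (norm_mul_le _ _).trans (mul_le_mul h₁ hee (norm_nonneg _) hs)
  have h11 : ‖Φ (b - e * (e * b)) * Φ (e * e)‖ ≤ 2 * t * 1 :=
    (norm_mul_le _ _).trans (mul_le_mul ((hΦ _).trans h7) hee (norm_nonneg _) (by positivity))
  have h12 : ‖Φ (e * e) * Φ b - Φ b * Φ (e * e)‖ ≤ 4 * t + 2 * s := by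
    rw [e1]
    refine ((norm_sub_le _ _).trans (add_le_add ((norm_sub_le _ _).trans
      (add_le_add ((norm_add_le _ _).trans (add_le_add h8 h9)) h10)) h11)).trans ?_
    linarith
  nlinarith

variable {F : Type*} [CStarAlgebra F] [PartialOrder F] [StarOrderedRing F]

/-- Elements of the form `ψ (e y)` are nearly supported where `ψ (e e)` is not small. -/
theorem norm_one_sub_pow_mul_map_sq_le (ψ : A →CP F) (hψ : IsContractiveCP ψ) {e : A}
    (hesa : IsSelfAdjoint e) (he : ‖e‖ ≤ 1) (y : A) (N : ℕ) :
    ‖(1 - ψ (e * e)) ^ N * ψ (e * y)‖ ^ 2 * (N + 1) ≤ ‖y‖ ^ 2 := by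
  have hpos : 0 ≤ ψ (e * e) := by
    have := map_nonneg_cp ψ (star_mul_self_nonneg e)
    rwa [hesa.star_eq] at this
  set K := ψ (e * e) with hK
  have hKsa : IsSelfAdjoint K := hpos.isSelfAdjoint
  have hK1 : ‖K‖ ≤ 1 := (hψ _).trans ((norm_mul_le _ _).trans (by nlinarith [norm_nonneg e]))
  have hspec : ∀ t ∈ spectrum ℝ K, 0 ≤ t ∧ t ≤ 1 := fun t ht =>
    ⟨spectrum_nonneg_of_nonneg hpos ht, by
      have h1 := spectrum.norm_le_norm_mul_of_mem ht
      rcases subsingleton_or_nontrivial F with h | h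
      · rw [spectrum.of_subsingleton] at ht; exact absurd ht (Set.notMem_empty _)
      · rw [norm_one, mul_one] at h1
        exact (le_abs_self t).trans (h1.trans hK1)⟩
  set c := (1 - K) ^ N with hc
  have hcsa : IsSelfAdjoint c := ((IsSelfAdjoint.one F).sub hKsa).pow N
  have h1 := map_mul_star_le ψ e y
  rw [hesa.star_eq] at h1
  set X := ψ (e * y) with hX
  have h2 : c * X * star (c * X) ≤ ‖ψ (star y * y)‖ • (c * K * c) := by
    have h3 := hcsa.conjugate_le_conjugate h1
    calc c * X * star (c * X) = c * (X * star X) * c := by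
          rw [star_mul, hcsa.star_eq]; simp only [mul_assoc]
      _ ≤ c * (‖ψ (star y * y)‖ • K) * c := h3
      _ = _ := by rw [mul_smul_comm, smul_mul_assoc]
  have hcKc : ‖c * K * c‖ * (N + 1) ≤ 1 := by
    have e1 : c * K * c = cfc (fun t : ℝ => t * (1 - t) ^ (2 * N)) K := by
      rw [cfc_mul (fun t => t) (fun t : ℝ => (1 - t) ^ (2 * N)) K, cfc_id' ℝ K,
        cfc_pow (fun t : ℝ => 1 - t) (2 * N) K, cfc_sub (fun _ => (1 : ℝ)) (fun t => t) K,
        cfc_id' ℝ K, cfc_const_one ℝ K, two_mul, pow_add, ← hc]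
      have : Commute c K := ((Commute.one_left K).sub_left (Commute.refl K)).pow_left N
      rw [this.eq, mul_assoc]
    have hN : (0 : ℝ) < N + 1 := by positivity
    rw [← le_div_iff₀ hN, e1]
    refine norm_cfc_le (by positivity) fun t ht => ?_
    obtain ⟨ht0, ht1⟩ := hspec t ht
    have ht2 : (0 : ℝ) ≤ 1 - t := by linarith
    rw [Real.norm_eq_abs, abs_of_nonneg (by positivity), le_div_iff₀ hN]
    -- Bernoulli: `(1 + N t) (1 - t) ^ N ≤ ((1 + t) (1 - t)) ^ N ≤ 1`
    have h4 : 1 + (N : ℝ) * t ≤ (1 + t) ^ N := one_add_mul_le_pow (by linarith) N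
    have h5 : (1 + t) ^ N * (1 - t) ^ N ≤ 1 := by
      rw [← mul_pow]; exact pow_le_one₀ (by nlinarith) (by nlinarith)
    have h6 : (1 - t) ^ N ≤ 1 := pow_le_one₀ ht2 (by linarith)
    have h7 : 0 ≤ (1 - t) ^ N := by positivity
    calc t * (1 - t) ^ (2 * N) * (N + 1) = ((N : ℝ) * t + t) * (1 - t) ^ N * (1 - t) ^ N := by
          rw [two_mul, pow_add]; ring
      _ ≤ (1 + (N : ℝ) * t) * (1 - t) ^ N * (1 - t) ^ N := by
          have h8 : (N : ℝ) * t + t ≤ 1 + (N : ℝ) * t := by linarith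
          gcongr
      _ ≤ (1 + t) ^ N * (1 - t) ^ N * (1 - t) ^ N := by gcongr
      _ ≤ 1 * 1 := by gcongr
      _ = 1 := one_mul 1
  have h8 := CStarAlgebra.norm_le_norm_of_nonneg_of_le (mul_star_self_nonneg _) h2
  rw [CStarRing.norm_self_mul_star, norm_smul, norm_norm] at h8
  have h9 : ‖ψ (star y * y)‖ ≤ ‖y‖ ^ 2 := by
    refine (hψ _).trans_eq ?_
    rw [CStarRing.norm_star_mul_self, sq]
  calc ‖c * X‖ ^ 2 * (N + 1) ≤ ‖ψ (star y * y)‖ * ‖c * K * c‖ * (N + 1) := by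
        rw [sq]; gcongr
    _ = ‖ψ (star y * y)‖ * (‖c * K * c‖ * (N + 1)) := by ring
    _ ≤ ‖y‖ ^ 2 * 1 := by gcongr
    _ = _ := mul_one _

theorem norm_pow_le_one {F : Type*} [CStarAlgebra F] {c : F} (hc : ‖c‖ ≤ 1) (j : ℕ) :
    ‖c ^ j‖ ≤ 1 := by
  induction j with
  | zero => rw [pow_zero]; exact (IsStarProjection.one F).norm_le
  | succ j ih =>
    rw [pow_succ]
    exact (norm_mul_le _ _).trans (mul_le_one₀ ih (norm_nonneg _) hc)

variable [FiniteDimensional ℂ F]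

theorem IsOrderZero.norm_map_sum_pow_commutator_le {φ : F →CP A} (hφ : IsOrderZero φ) {c b : F}
    (hc : ‖c‖ ≤ 1) {σ : ℝ} (hσ : ‖φ (c * b - b * c)‖ ≤ σ) (N : ℕ) :
    ‖φ ((∑ j ∈ Finset.range N, c ^ j) * b - b * ∑ j ∈ Finset.range N, c ^ j)‖ ≤ N ^ 2 * σ := by
  have hσ0 : 0 ≤ σ := (norm_nonneg _).trans hσ
  have h1 : ∀ j : ℕ, ‖φ (c ^ j * b - b * c ^ j)‖ ≤ j * σ := by
    intro j
    induction j with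
    | zero => simp
    | succ j ih =>
      have e1 : c ^ (j + 1) * b - b * c ^ (j + 1) =
          c * (c ^ j * b - b * c ^ j) + (c * b - b * c) * c ^ j := by
        rw [pow_succ']; noncomm_ring
      rw [e1, map_add]
      have h2 := hφ.norm_map_mul_le c (c ^ j * b - b * c ^ j)
      have h3 := hφ.norm_map_mul_le' (c * b - b * c) (c ^ j)
      have h4 := norm_pow_le_one hc j
      push_cast
      refine (norm_add_le _ _).trans ?_
      have h5 : ‖c‖ * ‖φ (c ^ j * b - b * c ^ j)‖ ≤ 1 * (j * σ) := by gcongr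
      have h6 : ‖φ (c * b - b * c)‖ * ‖c ^ j‖ ≤ σ * 1 := by gcongr
      linarith
  rw [Finset.sum_mul, Finset.mul_sum, ← Finset.sum_sub_distrib, map_sum]
  calc _ ≤ ∑ j ∈ Finset.range N, ‖φ (c ^ j * b - b * c ^ j)‖ := norm_sum_le _ _
    _ ≤ ∑ j ∈ Finset.range N, N * σ := by
        refine Finset.sum_le_sum fun j hj => (h1 j).trans ?_
        have : (j : ℝ) ≤ N := by exact_mod_cast (Finset.mem_range.1 hj).le
        gcongr
    _ = N ^ 2 * σ := by
        rw [Finset.sum_const, Finset.card_range, nsmul_eq_mul]; ring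

/-- If `φ` has order zero and `φ ψ` is nearly multiplicative up to the central factor `φ (ψ (e e))`,
then `φ` does not distinguish `ψ (a b - b a)` from a commutator.  With `K = ψ (e e)` and
`q = ∑ j < N, (1 - K) ^ j`, so that `q K = 1 - (1 - K) ^ N`, the commutator is that of `q ψ a`
and `ψ b`. -/
theorem IsOrderZero.norm_map_commutator_sub_le {φ : F →CP A} (hφ : IsOrderZero φ)
    (hφc : IsContractiveCP φ) (ψ : A →CP F) (hψ : IsContractiveCP ψ) {e a b : A}
    (hesa : IsSelfAdjoint e) (he : ‖e‖ ≤ 1) {R t τ σ ω : ℝ} (hR : 1 ≤ R)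
    (ha : ‖a‖ ≤ R) (hb : ‖b‖ ≤ R) (N : ℕ)
    (hae : ‖a - e * a‖ ≤ t) (hbe : ‖b - e * b‖ ≤ t)
    (hab : ‖φ (ψ (e * e)) * φ (ψ (a * b)) - φ (ψ a) * φ (ψ b)‖ ≤ τ)
    (hba : ‖φ (ψ (e * e)) * φ (ψ (b * a)) - φ (ψ b) * φ (ψ a)‖ ≤ τ)
    (heb : ‖φ (ψ (e * e)) * φ (ψ b) - φ (ψ b) * φ (ψ (e * e))‖ ≤ τ)
    (hσ0 : 0 ≤ σ) (hσ : (2 * R ^ 2) ^ 3 * τ ≤ σ ^ 4) (hω0 : 0 ≤ ω) (hω : R ^ 4 ≤ ω ^ 2 * (N + 1)) :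
    ∃ u v : F, ‖φ (ψ (a * b - b * a) - (u * v - v * u))‖ ≤
      2 * (ω + t * R + N * σ) + N ^ 2 * σ * R := by
  have hpos : 0 ≤ ψ (e * e) := by
    have := map_nonneg_cp ψ (star_mul_self_nonneg e)
    rwa [hesa.star_eq] at this
  set K := ψ (e * e) with hK
  have hK1 : ‖K‖ ≤ 1 := (hψ _).trans ((norm_mul_le _ _).trans (by nlinarith [norm_nonneg e]))
  have h1K : ‖1 - K‖ ≤ 1 := by
    rw [CStarAlgebra.norm_le_one_iff_of_nonneg _ (sub_nonneg.2
      ((CStarAlgebra.norm_le_one_iff_of_nonneg K hpos).1 hK1))]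
    exact sub_le_self _ hpos
  have hτ0 : 0 ≤ τ := (norm_nonneg _).trans hab
  -- elements annihilated by `φ 1 * φ` up to `τ` are annihilated by `φ` up to `σ`
  have small : ∀ y : F, ‖y‖ ≤ 2 * R ^ 2 → ‖φ 1 * φ y‖ ≤ τ → ‖φ y‖ ≤ σ := by
    intro y hy hy'
    have h1 := hφ.norm_map_pow_four_le hφc y
    have h2 : ‖φ y‖ ^ 4 ≤ σ ^ 4 := h1.trans (le_trans (by gcongr) hσ)
    exact le_of_pow_le_pow_left₀ (by norm_num) hσ0 h2
  have hψa : ‖ψ a‖ ≤ R := (hψ a).trans ha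
  have hψb : ‖ψ b‖ ≤ R := (hψ b).trans hb
  have hprod : ∀ x y : A, ‖x‖ ≤ R → ‖y‖ ≤ R → ‖x * y‖ ≤ R ^ 2 := fun x y hx hy => by
    rw [sq]; exact (norm_mul_le _ _).trans (by gcongr)
  have hsmall2 : ∀ x y : A, ‖x‖ ≤ R → ‖y‖ ≤ R →
      ‖φ K * φ (ψ (x * y)) - φ (ψ x) * φ (ψ y)‖ ≤ τ →
      ‖φ (K * ψ (x * y) - ψ x * ψ y)‖ ≤ σ := by
    intro x y hx hy hxy
    refine small _ ?_ ?_
    · have h1 : ‖K * ψ (x * y)‖ ≤ 1 * R ^ 2 := (norm_mul_le _ _).trans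
        (mul_le_mul hK1 ((hψ _).trans (hprod x y hx hy)) (norm_nonneg _) zero_le_one)
      have h2 : ‖ψ x * ψ y‖ ≤ R * R := (norm_mul_le _ _).trans
        (mul_le_mul ((hψ x).trans hx) ((hψ y).trans hy) (norm_nonneg _) (by linarith))
      refine (norm_sub_le _ _).trans ?_
      linarith
    · rw [map_sub, mul_sub, ← hφ.map_mul_map', ← hφ.map_mul_map']
      exact hxy
  have hcomm : ‖φ ((1 - K) * ψ b - ψ b * (1 - K))‖ ≤ σ := by
    have e1 : (1 - K) * ψ b - ψ b * (1 - K) = -(K * ψ b - ψ b * K) := by noncomm_ring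
    rw [e1, map_neg, norm_neg]
    refine small _ ?_ ?_
    · have h1 : ‖K * ψ b‖ ≤ 1 * R := (norm_mul_le _ _).trans
        (mul_le_mul hK1 hψb (norm_nonneg _) zero_le_one)
      have h2 : ‖ψ b * K‖ ≤ R * 1 := (norm_mul_le _ _).trans
        (mul_le_mul hψb hK1 (norm_nonneg _) (by linarith))
      refine (norm_sub_le _ _).trans ?_
      nlinarith
    · rw [map_sub, mul_sub, ← hφ.map_mul_map', ← hφ.map_mul_map']
      exact heb
  set q := ∑ j ∈ Finset.range N, (1 - K) ^ j with hq
  have hqK : q * K = 1 - (1 - K) ^ N := by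
    have := geom_sum_mul_neg (1 - K) N
    rwa [sub_sub_cancel] at this
  have hqn : ‖q‖ ≤ N := by
    refine (norm_sum_le _ _).trans ?_
    have : ∀ j ∈ Finset.range N, ‖(1 - K) ^ j‖ ≤ 1 := fun j _ => norm_pow_le_one h1K j
    refine (Finset.sum_le_sum this).trans ?_
    simp
  have hcp : ‖(1 - K) ^ N‖ ≤ 1 := norm_pow_le_one h1K N
  have main : ∀ x y : A, ‖x‖ ≤ R → ‖y‖ ≤ R → ‖x - e * x‖ ≤ t →
      ‖φ (K * ψ (x * y) - ψ x * ψ y)‖ ≤ σ →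
      ‖φ (ψ (x * y) - q * (ψ x * ψ y))‖ ≤ ω + t * R + N * σ := by
    intro x y hx hy hxe hxy
    have e1 : ψ (x * y) - q * (ψ x * ψ y) = (1 - K) ^ N * ψ (e * (x * y))
        + (1 - K) ^ N * ψ ((x - e * x) * y) + q * (K * ψ (x * y) - ψ x * ψ y) := by
      have : (1 - K) ^ N = 1 - q * K := by rw [hqK]; abel
      have h2 : ψ ((x - e * x) * y) = ψ (x * y) - ψ (e * (x * y)) := by
        rw [sub_mul, map_sub, mul_assoc]
      rw [this, h2]
      noncomm_ring
    have h1 : ‖(1 - K) ^ N * ψ (e * (x * y))‖ ≤ ω := by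
      have h2 := norm_one_sub_pow_mul_map_sq_le ψ hψ hesa he (x * y) N
      have h3 : ‖x * y‖ ^ 2 ≤ R ^ 4 := by
        calc ‖x * y‖ ^ 2 ≤ (R ^ 2) ^ 2 := by gcongr; exact hprod x y hx hy
          _ = R ^ 4 := by ring
      have h4 := le_of_mul_le_mul_right (h2.trans (h3.trans hω)) (by positivity)
      exact le_of_sq_le_sq h4 hω0
    have h2 : ‖(1 - K) ^ N * ψ ((x - e * x) * y)‖ ≤ 1 * (t * R) := by
      refine (norm_mul_le _ _).trans (mul_le_mul hcp ((hψ _).trans ?_) (norm_nonneg _) zero_le_one)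
      exact (norm_mul_le _ _).trans
        (mul_le_mul hxe hy (norm_nonneg _) ((norm_nonneg _).trans hxe))
    have h3 : ‖φ (q * (K * ψ (x * y) - ψ x * ψ y))‖ ≤ N * σ :=
      (hφ.norm_map_mul_le _ _).trans (mul_le_mul hqn hxy (norm_nonneg _) (by positivity))
    rw [e1, map_add, map_add]
    have h4 := (hφc _).trans h1
    have h5 := (hφc _).trans h2
    refine (norm_add₃_le).trans ?_
    linarith
  refine ⟨q * ψ a, ψ b, ?_⟩
  have e1 : ψ (a * b - b * a) - (q * ψ a * ψ b - ψ b * (q * ψ a)) =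
      (ψ (a * b) - q * (ψ a * ψ b)) - (ψ (b * a) - q * (ψ b * ψ a))
        - (q * ψ b - ψ b * q) * ψ a := by
    rw [map_sub]; noncomm_ring
  have h1 := main a b ha hb hae (hsmall2 a b ha hb hab)
  have h2 := main b a hb ha hbe (hsmall2 b a hb ha hba)
  have h3 := hφ.norm_map_mul_le' (q * ψ b - ψ b * q) (ψ a)
  have h4 := hφ.norm_map_sum_pow_commutator_le h1K hcomm N
  have h5 : ‖φ ((q * ψ b - ψ b * q) * ψ a)‖ ≤ N ^ 2 * σ * R :=
    h3.trans (mul_le_mul h4 hψa (norm_nonneg _) (by positivity))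
  rw [e1, map_sub, map_sub]
  refine (norm_sub_le _ _).trans ((add_le_add (norm_sub_le _ _) le_rfl).trans ?_)
  linarith

end Factorization

/-! ### Approximation by self-commutators of square-zero elements -/

section Approximation

variable {A : Type*} [NonUnitalCStarAlgebra A]

/-- The self-commutator `x x⋆ - x⋆ x`. -/
def selfCommutator (x : A) : A := x * star x - star x * x

theorem isSelfAdjoint_selfCommutator (x : A) : IsSelfAdjoint (selfCommutator x) :=
  (IsSelfAdjoint.mul_star_self x).sub (IsSelfAdjoint.star_mul_self x)

theorem selfCommutator_mem_commutatorClosure (x : A) :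
    selfCommutator x ∈ commutatorClosure A :=
  Submodule.le_topologicalClosure _ (Submodule.subset_span ⟨x, star x, rfl⟩)

theorem trEquiv_zero_iff {a : A} : TrEquiv a 0 ↔ a ∈ commutatorClosure A := by
  rw [TrEquiv, universalTrace, sub_zero, Submodule.mkQ_apply, Submodule.Quotient.mk_eq_zero]

theorem exists_sum_commutators_near {h : A} (hh : h ∈ commutatorClosure A) {ε : ℝ} (hε : 0 < ε) :
    ∃ (m : ℕ) (a b : Fin m → A), ‖h - ∑ l, (a l * b l - b l * a l)‖ ≤ ε := by
  have h1 : h ∈ closure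
      (Submodule.span ℂ {z : A | ∃ x y : A, z = x * y - y * x} : Set A) := hh
  obtain ⟨z, hz, hzh⟩ := Metric.mem_closure_iff.1 h1 ε hε
  obtain ⟨m, c, g, rfl⟩ := Submodule.mem_span_set'.1 hz
  choose x y hxy using fun i => (g i).2
  refine ⟨m, fun i => c i • x i, y, ?_⟩
  rw [dist_eq_norm] at hzh
  have e : ∑ l, (c l • x l * y l - y l * (c l • x l)) = ∑ i, c i • (g i : A) :=
    Finset.sum_congr rfl fun i _ => by rw [hxy, smul_sub, smul_mul_assoc, mul_smul_comm]
  rw [e]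
  exact hzh.le

/-- The tolerances for `IsOrderZero.norm_map_commutator_sub_le`, applied to `m` commutators.  First
`ω` is chosen, then the number `N` of terms of the geometric sum, then `σ` depending on `N`, and
last the tolerance `t` of the approximations. -/
theorem exists_parameters (m : ℕ) {R ζ : ℝ} (hR : 1 ≤ R) (hζ : 0 < ζ) :
    ∃ (N : ℕ) (ω σ t : ℝ), 0 < t ∧ 0 ≤ σ ∧ 0 ≤ ω ∧ (2 * R ^ 2) ^ 3 * (8 * R ^ 2 * t) ≤ σ ^ 4 ∧
      R ^ 4 ≤ ω ^ 2 * (N + 1) ∧ m * (2 * (ω + t * R + N * σ) + N ^ 2 * σ * R) ≤ ζ ∧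
      8 * R * t ≤ ζ := by
  have hR0 : 0 < R := by linarith
  set M : ℝ := m + 1 with hM
  have hM1 : 1 ≤ M := by rw [hM]; linarith [Nat.cast_nonneg (α := ℝ) m]
  have hM0 : 0 < M := by linarith
  set ω := ζ / (8 * M) with hω
  have hω0 : 0 < ω := by positivity
  obtain ⟨N, hN⟩ := exists_nat_ge (R ^ 4 / ω ^ 2)
  rw [div_le_iff₀ (by positivity)] at hN
  have hN0 : (0 : ℝ) ≤ N := Nat.cast_nonneg N
  set σ := ζ / (8 * M * (N + 1) ^ 2 * R) with hσ
  have hσ0 : 0 < σ := by positivity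
  set t := min (σ ^ 4 / (64 * R ^ 8)) (ζ / (8 * M * R)) with ht
  have ht0 : 0 < t := lt_min (by positivity) (by positivity)
  have ht1 : 64 * R ^ 8 * t ≤ σ ^ 4 := by
    have := min_le_left (σ ^ 4 / (64 * R ^ 8)) (ζ / (8 * M * R))
    rw [← ht, le_div_iff₀ (by positivity)] at this
    linarith
  have ht2 : 8 * M * R * t ≤ ζ := by
    have := min_le_right (σ ^ 4 / (64 * R ^ 8)) (ζ / (8 * M * R))
    rw [← ht, le_div_iff₀ (by positivity)] at this
    linarith
  have hωM : 8 * M * ω = ζ := by rw [hω]; field_simp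
  have hσM : 8 * M * ((N + 1) ^ 2 * σ * R) = ζ := by rw [hσ]; field_simp
  refine ⟨N, ω, σ, t, ht0, hσ0.le, hω0.le, ?_, ?_, ?_, ?_⟩
  · calc (2 * R ^ 2) ^ 3 * (8 * R ^ 2 * t) = 64 * R ^ 8 * t := by ring
      _ ≤ σ ^ 4 := ht1
  · nlinarith [sq_nonneg ω]
  · have h1 : N * σ ≤ (N + 1) ^ 2 * σ * R := by
      calc N * σ = N * σ * 1 := (mul_one _).symm
        _ ≤ (N + 1) ^ 2 * σ * R := by gcongr; nlinarith
    have h2 : N ^ 2 * σ * R ≤ (N + 1) ^ 2 * σ * R := by gcongr; linarith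
    have h3 : 2 * (ω + t * R + N * σ) + N ^ 2 * σ * R ≤
        2 * ω + 2 * (t * R) + 3 * ((N + 1) ^ 2 * σ * R) := by linarith
    have h4 : 0 ≤ 2 * (ω + t * R + N * σ) + N ^ 2 * σ * R := by positivity
    calc m * (2 * (ω + t * R + N * σ) + N ^ 2 * σ * R)
        ≤ M * (2 * (ω + t * R + N * σ) + N ^ 2 * σ * R) := by gcongr; rw [hM]; linarith
      _ ≤ M * (2 * ω + 2 * (t * R) + 3 * ((N + 1) ^ 2 * σ * R)) := by gcongr
      _ ≤ ζ := by linarith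
  · have h0 : 0 ≤ R * t := by positivity
    nlinarith

variable [PartialOrder A] [StarOrderedRing A]

theorem exists_approximate_unit (T : Finset A) {t : ℝ} (ht : 0 < t) :
    ∃ e : A, IsSelfAdjoint e ∧ ‖e‖ ≤ 1 ∧ ∀ x ∈ T, ‖x - e * x‖ ≤ t := by
  have hl := CStarAlgebra.increasingApproximateUnit A
  have h1 : ∀ x ∈ T, ∀ᶠ e in CStarAlgebra.approximateUnit A, ‖x - e * x‖ ≤ t := fun x _ => by
    have h2 := hl.tendsto_mul_right x
    filter_upwards [h2.eventually (Metric.ball_mem_nhds x ht)] with e he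
    rw [dist_comm, dist_eq_norm] at he
    exact he.le
  have := hl.neBot
  obtain ⟨e, h2, h3, h4⟩ := ((hl.eventually_isSelfAdjoint.and
    (hl.eventually_norm.and ((Finset.eventually_all T).2 h1)))).exists
  exact ⟨e, h2, h3, h4⟩

/-- In a C*-algebra of nuclear dimension at most one, a selfadjoint element in the closed span of
the commutators is approximately the sum of four self-commutators of square-zero elements, in two
almost commuting groups of two commuting summands. -/
theorem exists_selfCommutators_near (hA : NuclearDimensionLE A 1) {h : A} (hsa : IsSelfAdjoint h)
    (hh : h ∈ commutatorClosure A) {δ : ℝ} (hδ : 0 < δ) :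
    ∃ x z : Fin 2 → A, (∀ i, x i * x i = 0 ∧ z i * z i = 0 ∧ ‖x i‖ ^ 2 ≤ ‖h‖ + δ ∧
        ‖z i‖ ^ 2 ≤ ‖h‖ + δ ∧ Commute (selfCommutator (x i)) (selfCommutator (z i))) ∧
      ‖(selfCommutator (x 0) + selfCommutator (z 0)) * (selfCommutator (x 1) + selfCommutator (z 1))
        - (selfCommutator (x 1) + selfCommutator (z 1)) *
          (selfCommutator (x 0) + selfCommutator (z 0))‖ ≤ δ ∧
      ‖h - (selfCommutator (x 0) + selfCommutator (z 0))
        - (selfCommutator (x 1) + selfCommutator (z 1))‖ ≤ δ := by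
  classical
  -- the choice of the parameters; `R` bounds all norms
  obtain ⟨R₁, hR₁, hhR₁⟩ : ∃ R : ℝ, 1 ≤ R ∧ ‖h‖ ≤ R :=
    ⟨max 1 ‖h‖, le_max_left _ _, le_max_right _ _⟩
  obtain ⟨ζ, hζ0, hζ1, hζδ⟩ : ∃ ζ : ℝ, 0 < ζ ∧ ζ ≤ 1 ∧ 33 * R₁ * ζ ≤ δ := by
    refine ⟨min 1 (δ / (33 * R₁)), lt_min one_pos (by positivity), min_le_left _ _, ?_⟩
    have := min_le_right 1 (δ / (33 * R₁))
    rw [le_div_iff₀ (by positivity)] at this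
    linarith
  obtain ⟨m, a, b, hab⟩ := exists_sum_commutators_near hh hζ0
  obtain ⟨R, hR, hRR, haR, hbR⟩ : ∃ R : ℝ, 1 ≤ R ∧ R₁ ≤ R ∧ (∀ l, ‖a l‖ ≤ R) ∧ ∀ l, ‖b l‖ ≤ R := by
    have h1 : ∀ l, ‖a l‖ ≤ ∑ l, ‖a l‖ := fun l =>
      Finset.single_le_sum (f := fun l => ‖a l‖) (fun _ _ => norm_nonneg _) (Finset.mem_univ l)
    have h2 : ∀ l, ‖b l‖ ≤ ∑ l, ‖b l‖ := fun l =>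
      Finset.single_le_sum (f := fun l => ‖b l‖) (fun _ _ => norm_nonneg _) (Finset.mem_univ l)
    have h3 : 0 ≤ ∑ l, ‖a l‖ := Finset.sum_nonneg fun _ _ => norm_nonneg _
    have h4 : 0 ≤ ∑ l, ‖b l‖ := Finset.sum_nonneg fun _ _ => norm_nonneg _
    exact ⟨R₁ + ∑ l, ‖a l‖ + ∑ l, ‖b l‖, by linarith, by linarith, fun l => by linarith [h1 l],
      fun l => by linarith [h2 l]⟩
  have hhR : ‖h‖ ≤ R := hhR₁.trans hRR
  obtain ⟨N, ω, σ, t, ht, hσ0, hω0, hσ, hω, hbnd, htζ⟩ := exists_parameters m hR hζ0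
  set T₀ : Finset A := {h} ∪ Finset.univ.image a ∪ Finset.univ.image b
    ∪ Finset.univ.image (fun l => star (a l)) ∪ Finset.univ.image (fun l => star (b l)) with hT₀
  have hhT : h ∈ T₀ := by simp [hT₀]
  have haT : ∀ l, a l ∈ T₀ := fun l => by simp [hT₀]
  have hbT : ∀ l, b l ∈ T₀ := fun l => by simp [hT₀]
  have haT' : ∀ l, star (a l) ∈ T₀ := fun l => by simp [hT₀]
  have hbT' : ∀ l, star (b l) ∈ T₀ := fun l => by simp [hT₀]
  have hTR : ∀ y ∈ T₀, ‖y‖ ≤ R := by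
    intro y hy
    simp only [hT₀, Finset.mem_union, Finset.mem_singleton, Finset.mem_image, Finset.mem_univ,
      true_and] at hy
    rcases hy with (((rfl | ⟨l, rfl⟩) | ⟨l, rfl⟩) | ⟨l, rfl⟩) | ⟨l, rfl⟩
    · exact hhR
    · exact haR l
    · exact hbR l
    · rw [norm_star]; exact haR l
    · rw [norm_star]; exact hbR l
  obtain ⟨e, hesa, he1, heT⟩ := exists_approximate_unit T₀ ht
  set T : Finset A := insert e T₀ with hT
  have heT' : e ∈ T := Finset.mem_insert_self _ _
  have hsub : ∀ {y}, y ∈ T₀ → y ∈ T := fun hy => Finset.mem_insert_of_mem hy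
  set S : Finset A := insert h ((T ×ˢ T).biUnion fun q =>
    {star (q.1 * q.2) * (q.1 * q.2), star (q.1 * q.2) * q.1, star q.1 * (q.1 * q.2),
      star q.1 * q.1}) with hS
  obtain ⟨F, iF1, iF2, iF3, iF4, ψ, φ, hψ, hφ, hS'⟩ := hA S (min (t ^ 2) ζ)
    (lt_min (by positivity) hζ0)
  let Φ : Fin 2 → A →CP A := fun i => compCP (φ i) (ψ i)
  have hΦ : ∀ i, IsContractiveCP (Φ i) := fun i x => ((hφ i).1 _).trans (hψ i x)
  have happ : ∀ x ∈ S, ‖∑ i, Φ i x - x‖ ≤ t ^ 2 := fun x hx =>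
    (hS' x hx).le.trans (min_le_left _ _)
  -- the maps `Φ i` are almost right module maps on `T`
  have hM : ∀ i, ∀ x ∈ T, ∀ y ∈ T₀, ‖Φ i (e * (x * y)) - Φ i (e * x) * y‖ ≤ 2 * R * t := by
    intro i x hx y hy
    have hq : ∀ w ∈ ({star (x * y) * (x * y), star (x * y) * x, star x * (x * y),
        star x * x} : Finset A), w ∈ S := fun w hw =>
      Finset.mem_insert_of_mem (Finset.mem_biUnion.2
        ⟨(x, y), Finset.mem_product.2 ⟨hx, hsub hy⟩, hw⟩)
    have h1 := norm_map_mul_sub_sq_le_of_sum Φ hΦ he1 x y (happ _ (hq _ (by simp)))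
      (happ _ (hq _ (by simp))) (happ _ (hq _ (by simp))) (happ _ (hq _ (by simp))) i
    have hyR := hTR y hy
    have h2 : t ^ 2 * (1 + ‖y‖) ^ 2 ≤ (2 * R * t) ^ 2 := by
      rw [← mul_pow]
      have := norm_nonneg y
      exact pow_le_pow_left₀ (by positivity) (by nlinarith) 2
    exact le_of_sq_le_sq (h1.trans h2) (by positivity)
  have hτ : (4 * t + 2 * (2 * R * t)) * R ≤ 8 * R ^ 2 * t := by
    nlinarith [mul_pos ht (by linarith : 0 < R)]
  -- each color yields two self-commutators
  have hcolor : ∀ i, ∃ x z : A, x * x = 0 ∧ z * z = 0 ∧ ‖x‖ ^ 2 ≤ ‖ψ i h‖ + 2 * ζ ∧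
      ‖z‖ ^ 2 ≤ ‖ψ i h‖ + 2 * ζ ∧
      Commute (x * star x - star x * x) (z * star z - star z * z) ∧
      ‖φ i (ψ i h) - ((x * star x - star x * x) + (z * star z - star z * z))‖ ≤ 2 * ζ + ζ := by
    intro i
    have h1 : ∀ l, ∃ u v : F i, ‖φ i (ψ i (a l * b l - b l * a l) - (u * v - v * u))‖ ≤
        2 * (ω + t * R + N * σ) + N ^ 2 * σ * R := by
      intro l
      refine (hφ i).2.norm_map_commutator_sub_le (hφ i).1 (ψ i) (hψ i) hesa he1 hR (haR l) (hbR l) N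
        (heT _ (haT l)) (heT _ (hbT l)) (τ := 8 * R ^ 2 * t) ?_ ?_ ?_ hσ0 hσ hω0 hω
      · exact (norm_map_mul_map_sub_le (Φ i) (hΦ i) he1 (haR l) (hbR l) hR
          (hM i e heT' _ (haT l)) (hM i _ (hsub (hbT' l)) _ (haT' l)) (heT _ (haT l))
          (heT _ (hbT' l))).trans hτ
      · exact (norm_map_mul_map_sub_le (Φ i) (hΦ i) he1 (hbR l) (haR l) hR
          (hM i e heT' _ (hbT l)) (hM i _ (hsub (haT' l)) _ (hbT' l)) (heT _ (hbT l))
          (heT _ (haT' l))).trans hτ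
      · exact (norm_map_commutator_le (Φ i) (hΦ i) he1 hesa hR (hM i e heT' _ (hbT l))
          (hM i e heT' _ (hbT' l)) (heT _ (hbT l)) (heT _ (hbT' l))).trans hτ
    choose u v huv using h1
    refine (hφ i).2.exists_selfCommutators (hφ i).1 (f := ψ i h)
      (t := ∑ l, (u l * v l - v l * u l)) ?_ ?_ ?_ hζ0
    · rw [IsSelfAdjoint, ← map_star_cp, hsa.star_eq]
    · exact Submodule.sum_mem _ fun l _ => Submodule.subset_span ⟨_, _, rfl⟩
    · have e1 : ψ i h - ∑ l, (u l * v l - v l * u l) =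
          ψ i (h - ∑ l, (a l * b l - b l * a l))
            + ∑ l, (ψ i (a l * b l - b l * a l) - (u l * v l - v l * u l)) := by
        have e2 : ∑ l, (ψ i (a l * b l - b l * a l) - (u l * v l - v l * u l)) =
            ∑ l, ψ i (a l * b l - b l * a l) - ∑ l, (u l * v l - v l * u l) :=
          Finset.sum_sub_distrib _ _
        have e3 : ψ i (∑ l, (a l * b l - b l * a l)) = ∑ l, ψ i (a l * b l - b l * a l) :=
          map_sum (ψ i) _ _
        rw [e2, map_sub, e3]
        abel
      rw [e1, map_add, map_sum]
      have h2 : ‖φ i (ψ i (h - ∑ l, (a l * b l - b l * a l)))‖ ≤ ζ := (hΦ i _).trans hab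
      have h3 : ‖∑ l, φ i (ψ i (a l * b l - b l * a l) - (u l * v l - v l * u l))‖ ≤ ζ := by
        refine (norm_sum_le _ _).trans ((Finset.sum_le_sum fun l _ => huv l).trans ?_)
        rw [Finset.sum_const, Finset.card_univ, Fintype.card_fin, nsmul_eq_mul]
        exact hbnd
      refine (norm_add_le _ _).trans ?_
      linarith
  choose x z hx hz hxn hzn hxz hd using hcolor
  have hζR : 0 ≤ ζ * R₁ := by positivity
  have hζR' : ζ ≤ ζ * R₁ := le_mul_of_one_le_right hζ0.le hR₁
  refine ⟨x, z, fun i => ⟨hx i, hz i, ?_, ?_, hxz i⟩, ?_, ?_⟩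
  · have := hψ i h
    linarith [hxn i]
  · have := hψ i h
    linarith [hzn i]
  · -- `P + Q` is near `h` and `P` nearly commutes with `h`, so that `P` and `Q` nearly commute
    set P := Φ 0 h with hP
    set Q := Φ 1 h with hQ
    set D₀ := selfCommutator (x 0) + selfCommutator (z 0) with hD₀
    set D₁ := selfCommutator (x 1) + selfCommutator (z 1) with hD₁
    have hPD : ‖P - D₀‖ ≤ 3 * ζ := (hd 0).trans_eq (by ring)
    have hQD : ‖Q - D₁‖ ≤ 3 * ζ := (hd 1).trans_eq (by ring)
    have hPn : ‖P‖ ≤ R₁ := (hΦ 0 h).trans hhR₁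
    have hQn : ‖Q‖ ≤ R₁ := (hΦ 1 h).trans hhR₁
    have hPQ : ‖P + Q - h‖ ≤ ζ := by
      have := (hS' h (Finset.mem_insert_self _ _)).le.trans (min_le_right _ _)
      rwa [Fin.sum_univ_two] at this
    have hPsa : star P = P := by rw [hP, ← map_star_cp, hsa.star_eq]
    have h1 : ‖h * P - Φ 0 (h * h)‖ ≤ 2 * (t * R) + 2 * R * t := by
      refine norm_mul_map_sub_le (e := e) (Φ 0) (hΦ 0) hhR ?_ ?_
      · rw [hsa.star_eq]; exact hM 0 h (hsub hhT) h hhT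
      · rw [hsa.star_eq]; exact heT h hhT
    have h2 : ‖P * h - Φ 0 (h * h)‖ ≤ 2 * (t * R) + 2 * R * t := by
      rw [← norm_star, star_sub, star_mul, hPsa, hsa.star_eq, ← map_star_cp, star_mul,
        hsa.star_eq]
      exact h1
    have h3 : ‖P * h - h * P‖ ≤ ζ := by
      have e1 : P * h - h * P = (P * h - Φ 0 (h * h)) - (h * P - Φ 0 (h * h)) := by abel
      rw [e1]
      refine (norm_sub_le _ _).trans ?_
      linarith
    have e2 : D₀ * D₁ - D₁ * D₀ = (P * h - h * P) + (P * (P + Q - h) - (P + Q - h) * P)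
        - (P * (Q - D₁) - (Q - D₁) * P) - ((P - D₀) * Q - Q * (P - D₀))
        + ((P - D₀) * (Q - D₁) - (Q - D₁) * (P - D₀)) := by noncomm_ring
    have hc : ∀ (x y : A) (r s : ℝ), ‖x‖ ≤ r → ‖y‖ ≤ s → ‖x * y - y * x‖ ≤ 2 * (r * s) := by
      intro x y r s hx hy
      have hr : 0 ≤ r := (norm_nonneg _).trans hx
      have hs : 0 ≤ s := (norm_nonneg _).trans hy
      have h4 : ‖x * y‖ ≤ r * s := (norm_mul_le _ _).trans (by gcongr)
      have h5 : ‖y * x‖ ≤ s * r := (norm_mul_le _ _).trans (by gcongr)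
      refine (norm_sub_le _ _).trans ?_
      linarith
    have h4 := hc P (P + Q - h) _ _ hPn hPQ
    have h5 := hc P (Q - D₁) _ _ hPn hQD
    have h6 := hc (P - D₀) Q _ _ hPD hQn
    have h7 := hc (P - D₀) (Q - D₁) _ _ hPD hQD
    rw [e2]
    refine ((norm_add_le _ _).trans (add_le_add ((norm_sub_le _ _).trans (add_le_add
      ((norm_sub_le _ _).trans (add_le_add ((norm_add_le _ _).trans (add_le_add h3 h4)) h5)) h6))
      h7)).trans ?_
    have h8 : ζ * ζ ≤ ζ := by nlinarith
    linarith
  · have hPQ : ‖Φ 0 h + Φ 1 h - h‖ ≤ ζ := by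
      have := (hS' h (Finset.mem_insert_self _ _)).le.trans (min_le_right _ _)
      rwa [Fin.sum_univ_two] at this
    have e1 : h - (selfCommutator (x 0) + selfCommutator (z 0))
        - (selfCommutator (x 1) + selfCommutator (z 1)) =
        (Φ 0 h - (selfCommutator (x 0) + selfCommutator (z 0)))
        + (Φ 1 h - (selfCommutator (x 1) + selfCommutator (z 1))) - (Φ 0 h + Φ 1 h - h) := by abel
    rw [e1]
    refine ((norm_sub_le _ _).trans (add_le_add ((norm_add_le _ _).trans
      (add_le_add (hd 0) (hd 1))) hPQ)).trans ?_
    linarith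

end Approximation

/-! ### The exponential of a self-commutator is a commutator -/

section SingleCommutator

variable {B : Type*} [CStarAlgebra B]

/-- The function `t ↦ (1 + t)^(-1/2)` for `0 ≤ t`, extended to an even function in order to be
continuous on the whole line. -/
def invSqrt (t : ℝ) : ℝ := (√(1 + |t|))⁻¹

theorem continuous_invSqrt : Continuous invSqrt := by
  unfold invSqrt
  refine Continuous.inv₀ (by fun_prop) fun t => ?_
  have := abs_nonneg t
  positivity

theorem invSqrt_pos (t : ℝ) : 0 < invSqrt t := by
  have := abs_nonneg t
  unfold invSqrt
  positivity

theorem invSqrt_le_one (t : ℝ) : invSqrt t ≤ 1 :=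
  inv_le_one_of_one_le₀ (Real.one_le_sqrt.2 (by linarith [abs_nonneg t]))

theorem invSqrt_sq_mul {t : ℝ} (ht : 0 ≤ t) : invSqrt t * invSqrt t * (1 + t) = 1 := by
  unfold invSqrt
  rw [abs_of_nonneg ht, ← mul_inv, Real.mul_self_sqrt (by linarith), inv_mul_cancel₀ (by linarith)]

/-- The unitary `(1 + k) (1 + k⋆ k)^(-1/2)` in the polar decomposition of `1 + k`, for a
skew-adjoint element `k`. -/
def skewPolar (k : B) : B := (1 + k) * cfc invSqrt (star k * k)

theorem commute_cfc_star_mul_self {k : B} (hk : star k = -k) (f : ℝ → ℝ) :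
    Commute k (cfc f (star k * k)) := by
  refine (IsSelfAdjoint.star_mul_self k).commute_cfc ?_ f |>.symm
  rw [hk]
  exact (Commute.neg_left (Commute.refl k)).mul_left (Commute.refl k)

theorem cfc_invSqrt_sq_mul (k : B) :
    cfc invSqrt (star k * k) * cfc invSqrt (star k * k) * (1 + star k * k) = 1 := by
  have hc := continuous_invSqrt
  have e1 : 1 + star k * k = cfc (fun t : ℝ => 1 + t) (star k * k) := by
    rw [cfc_const_add (1 : ℝ) (fun t => t) (star k * k), cfc_id' ℝ (star k * k), map_one]
  rw [e1, ← cfc_mul invSqrt invSqrt _ hc.continuousOn hc.continuousOn,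
    ← cfc_mul (fun t => invSqrt t * invSqrt t) _ _ (hc.mul hc).continuousOn (by fun_prop),
    ← cfc_one ℝ (star k * k)]
  exact cfc_congr fun t ht => invSqrt_sq_mul (spectrum_star_mul_self_nonneg t ht)

theorem star_skewPolar {k : B} (hk : star k = -k) :
    star (skewPolar k) = (1 - k) * cfc invSqrt (star k * k) := by
  have h1 := commute_cfc_star_mul_self hk invSqrt
  have h2 : IsSelfAdjoint (cfc invSqrt (star k * k)) := cfc_predicate _ _
  rw [skewPolar, star_mul, h2.star_eq, star_add, star_one]
  nth_rewrite 2 [hk]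
  rw [← sub_eq_add_neg]
  exact (((Commute.one_left _).sub_left h1).eq).symm

theorem skewPolar_mem_unitary {k : B} (hk : star k = -k) : skewPolar k ∈ unitary B := by
  have h1 := commute_cfc_star_mul_self hk invSqrt
  have h2 := cfc_invSqrt_sq_mul k
  set r := cfc invSqrt (star k * k)
  have e1 : (1 - k) * (1 + k) = 1 + star k * k := by rw [hk]; noncomm_ring
  have e2 : (1 + k) * (1 - k) = 1 + star k * k := by rw [hk]; noncomm_ring
  have c1 : Commute (1 + k) r := (Commute.one_left _).add_left h1
  have c2 : Commute (1 - k) r := (Commute.one_left _).sub_left h1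
  have c3 : Commute (1 + star k * k) r := by rw [← e1]; exact c2.mul_left c1
  rw [Unitary.mem_iff, star_skewPolar hk, skewPolar]
  constructor
  · calc (1 - k) * r * ((1 + k) * r) = (1 - k) * (r * (1 + k)) * r := by noncomm_ring
      _ = ((1 - k) * (1 + k)) * r * r := by rw [← c1.eq]; noncomm_ring
      _ = r * r * (1 + star k * k) := by rw [e1, c3.eq, mul_assoc, c3.eq, ← mul_assoc]
      _ = 1 := h2
  · calc (1 + k) * r * ((1 - k) * r) = (1 + k) * (r * (1 - k)) * r := by noncomm_ring
      _ = ((1 + k) * (1 - k)) * r * r := by rw [← c2.eq]; noncomm_ring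
      _ = r * r * (1 + star k * k) := by rw [e2, c3.eq, mul_assoc, c3.eq, ← mul_assoc]
      _ = 1 := h2

/-- For a unitary `u`, the distance to `1` is governed by the real part of `u`. -/
theorem norm_unitary_sub_one_sq {u : B} (hu : u ∈ unitary B) :
    ‖u - 1‖ ^ 2 = ‖2 - (u + star u)‖ := by
  rw [sq, ← CStarRing.norm_star_mul_self, star_sub, star_one, sub_mul, mul_sub, mul_sub,
    Unitary.star_mul_self_of_mem hu, mul_one, one_mul, one_mul]
  congr 1
  rw [← one_add_one_eq_two]
  abel

theorem norm_skewPolar_sub_one_lt_two {k : B} (hk : star k = -k) : ‖skewPolar k - 1‖ < 2 := by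
  rcases subsingleton_or_nontrivial B with hB | hB
  · rw [Subsingleton.elim (skewPolar k - 1) 0, norm_zero]; exact two_pos
  have hc := continuous_invSqrt
  have h1 : ‖skewPolar k - 1‖ ^ 2 < 2 ^ 2 := by
    rw [norm_unitary_sub_one_sq (skewPolar_mem_unitary hk), star_skewPolar hk, skewPolar]
    have e1 : 2 - ((1 + k) * cfc invSqrt (star k * k) + (1 - k) * cfc invSqrt (star k * k)) =
        (2 : ℝ) • (cfc (fun t => 1 - invSqrt t) (star k * k)) := by
      rw [cfc_sub (fun _ => (1 : ℝ)) invSqrt (star k * k) (by fun_prop)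
        hc.continuousOn, cfc_const_one ℝ (star k * k) (IsSelfAdjoint.star_mul_self k), two_smul,
        ← one_add_one_eq_two]
      noncomm_ring
    rw [e1, norm_smul]
    have h2 : ‖cfc (fun t => 1 - invSqrt t) (star k * k)‖ < 1 := by
      refine norm_cfc_lt one_pos (fun t _ => ?_)
      have h3 := invSqrt_pos t
      have h4 := invSqrt_le_one t
      rw [Real.norm_eq_abs, abs_of_nonneg (by linarith)]
      linarith
    norm_num
    linarith
  exact lt_of_pow_lt_pow_left₀ 2 two_pos.le h1

theorem mem_connectedComponentOfOne_of_norm_sub_one_lt_two {u : unitary B}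
    (hu : ‖(u : B) - 1‖ < 2) : u ∈ Subgroup.connectedComponentOfOne (unitary B) :=
  pathComponent_subset_component (1 : unitary B) (Unitary.joined 1 u hu)

theorem expUnitary_mem_connectedComponentOfOne (a : selfAdjoint B) :
    selfAdjoint.expUnitary a ∈ Subgroup.connectedComponentOfOne (unitary B) :=
  (pathComponent_subset_component (1 : unitary B)) (selfAdjoint.joined_one_expUnitary a)

theorem map_skewPolar (χ : B →⋆ₐ[ℂ] ℂ) {k : B} (hk : χ k = 0) : χ (skewPolar k) = 1 := by
  have h1 : χ (cfc invSqrt (star k * k)) = cfc invSqrt (χ (star k * k)) :=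
    StarAlgHomClass.map_cfc χ invSqrt (star k * k) continuous_invSqrt.continuousOn
      (map_continuous χ) (IsSelfAdjoint.star_mul_self k) ((IsSelfAdjoint.star_mul_self k).map χ)
  have h2 : χ (star k * k) = 0 := by rw [map_mul, hk, mul_zero]
  rw [skewPolar, map_mul, map_add, map_one, hk, h1, h2, cfc_apply_zero]
  simp [invSqrt]

theorem map_expUnitary (χ : B →⋆ₐ[ℂ] ℂ) {a : selfAdjoint B} (ha : χ a = 0) :
    χ (selfAdjoint.expUnitary a : B) = 1 := by
  rw [selfAdjoint.expUnitary_coe]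
  let +nondep : NormedAlgebra ℚ B := .restrictScalars ℚ ℂ B
  rw [NormedSpace.map_exp χ (map_continuous χ), map_smul, ha, smul_zero, NormedSpace.exp_zero]

/-- If `d² = φ²`, then `e^{id} = cos φ + i d sinc φ`: both `cos` and `sinc` are even, so that they
only depend on the square. -/
theorem expUnitary_eq_cos_add_sinc {d φ : B} (hd : IsSelfAdjoint d) (hφ : IsSelfAdjoint φ)
    (h : d ^ 2 = φ ^ 2) :
    (selfAdjoint.expUnitary ⟨d, hd⟩ : B) =
      cfc Real.cos φ + Complex.I • (cfc Real.sinc φ * d) := by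
  have even : ∀ f : ℝ → ℝ, Continuous f → (∀ t, f (-t) = f t) → cfc f φ = cfc f d := by
    intro f hf he
    have h1 : ∀ a : B, IsSelfAdjoint a → cfc f a = cfc (fun t => f √t) (a ^ 2) := by
      intro a ha
      rw [← cfc_comp_pow (fun t => f √t) 2 a (by fun_prop) ha]
      refine cfc_congr fun t _ => ?_
      rw [Real.sqrt_sq_eq_abs]
      rcases abs_choice t with h | h <;> rw [h]
      rw [he]
    rw [h1 φ hφ, h1 d hd, h]
  have hsin : cfc Real.sinc d * d = cfc Real.sin d := by
    have h1 : cfc Real.sin d = cfc (fun t => Real.sinc t * t) d := by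
      refine cfc_congr fun t _ => ?_
      rcases eq_or_ne t 0 with rfl | h0
      · simp
      · rw [Real.sinc_of_ne_zero h0, div_mul_cancel₀ _ h0]
    rw [h1, cfc_mul Real.sinc (fun t => t) d Real.continuous_sinc.continuousOn (by fun_prop),
      cfc_id' ℝ d]
  have hn : IsStarNormal (Complex.I • d) := ⟨by simp [Commute, SemiconjBy, hd.star_eq]⟩
  rw [even _ Real.continuous_cos Real.cos_neg, even _ Real.continuous_sinc Real.sinc_neg, hsin,
    selfAdjoint.expUnitary_coe, ← CFC.exp_eq_normedSpace_exp (𝕜 := ℂ)]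
  change cfc NormedSpace.exp (Complex.I • d) = _
  rw [← cfc_comp_smul Complex.I _ d, cfc_real_eq_complex Real.cos, cfc_real_eq_complex Real.sin,
    ← cfc_smul Complex.I (fun z : ℂ => ((Real.sin z.re : ℝ) : ℂ)) d (by fun_prop),
    ← cfc_add _ _ _ (by fun_prop) (by fun_prop)]
  refine cfc_congr fun z hz => ?_
  rw [← hd.spectrumRestricts.algebraMap_image] at hz
  obtain ⟨t, -, rfl⟩ := hz
  simp only [Complex.coe_algebraMap, smul_eq_mul, Complex.ofReal_re]
  rw [← Complex.exp_eq_exp_ℂ, mul_comm, Complex.exp_mul_I, mul_comm, Complex.ofReal_cos,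
    Complex.ofReal_sin]

/-- A unitary whose real part is a function of the positive element `k⋆ k` that is close to the
constant `1` near `0` is close to `1`. -/
theorem norm_unitary_sub_one_sq_le {u k : B} (hu : u ∈ unitary B) {f : ℝ → ℝ} (hf : Continuous f)
    (h : u + star u = (2 : ℝ) • cfc f (star k * k)) (hk : ‖star k * k‖ ≤ 4 / 3)
    (h1 : ∀ t, f t ≤ 1) (h2 : ∀ t, 0 ≤ t → t ≤ 4 / 3 → 1 - 3 / 4 * t ≤ f t) :
    ‖u - 1‖ ^ 2 ≤ 3 / 2 * ‖star k * k‖ := by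
  rcases subsingleton_or_nontrivial B with hB | hB
  · rw [Subsingleton.elim (u - 1) 0, norm_zero, zero_pow two_ne_zero]; positivity
  have e1 : 2 - (u + star u) = (2 : ℝ) • (cfc (fun t => 1 - f t) (star k * k)) := by
    rw [h, cfc_sub (fun _ => (1 : ℝ)) f _ (by fun_prop) hf.continuousOn,
      cfc_const_one ℝ (star k * k), smul_sub, two_smul ℝ (1 : B), one_add_one_eq_two]
  rw [norm_unitary_sub_one_sq hu, e1, norm_smul]
  have h3 : ‖cfc (fun t => 1 - f t) (star k * k)‖ ≤ 3 / 4 * ‖star k * k‖ := by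
    refine norm_cfc_le (by positivity) fun t ht => ?_
    have h0 := spectrum_star_mul_self_nonneg t ht
    have h4 : t ≤ ‖star k * k‖ := (le_abs_self t).trans (spectrum.norm_le_norm_of_mem ht)
    have h5 := h2 t h0 (h4.trans hk)
    rw [Real.norm_eq_abs, abs_of_nonneg (by linarith [h1 t])]
    linarith
  norm_num
  linarith

theorem one_sub_le_cos_mul_invSqrt {s t : ℝ} (h0 : 0 ≤ s) (hst : s ≤ t) (ht : t ≤ 4 / 3) :
    1 - 3 / 4 * t ≤ Real.cos t * invSqrt s := by
  have h1 := Real.one_sub_sq_div_two_le_cos (x := t)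
  have h2 : √(1 + s) ≤ 1 + t / 2 := by
    rw [Real.sqrt_le_left (by linarith)]
    nlinarith
  have h3 : 0 < √(1 + s) := Real.sqrt_pos.2 (by linarith)
  rw [invSqrt, abs_of_nonneg h0, ← div_eq_mul_inv, le_div_iff₀ h3]
  calc (1 - 3 / 4 * t) * √(1 + s) ≤ (1 - 3 / 4 * t) * (1 + t / 2) := by
        gcongr; linarith
    _ ≤ 1 - t ^ 2 / 2 := by nlinarith [mul_nonneg (h0.trans hst) (by linarith : 0 ≤ 2 - t)]
    _ ≤ _ := h1

theorem cos_mul_invSqrt_le_one (s t : ℝ) : Real.cos t * invSqrt s ≤ 1 := by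
  have h1 := Real.cos_le_one t
  have h2 := invSqrt_pos s
  have h3 := invSqrt_le_one s
  nlinarith

/-- Let `x² = 0`, and let `d`, `φ`, `y`, `z` be `x x⋆ - x⋆ x`, `x x⋆ + x⋆ x`, `x - x⋆`, `x + x⋆`.
With `E = e^{id} = cos φ + i d sinc φ`, the unitaries `v = E (1 + y) (1 + φ)^(-1/2)` and
`w = (E⁻¹ + i z sinc φ) (1 + φ (sinc φ)²)^(-1/2)` satisfy `w v = E⁻² v w`, because `y` and `z`
anticommute with `d` and `E - E⁻¹ = 2 i d sinc φ`. -/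
theorem exists_commutator_eq_expUnitary_sq {x : B} (hx : x * x = 0) :
    ∃ v w : unitary B, v ∈ Subgroup.connectedComponentOfOne (unitary B) ∧
      w ∈ Subgroup.connectedComponentOfOne (unitary B) ∧
      ⁅v, w⁆ = selfAdjoint.expUnitary ⟨selfCommutator x, isSelfAdjoint_selfCommutator x⟩ *
        selfAdjoint.expUnitary ⟨selfCommutator x, isSelfAdjoint_selfCommutator x⟩ ∧
      (∀ χ : B →⋆ₐ[ℂ] ℂ, χ x = 0 → χ v = 1 ∧ χ w = 1) ∧
      (‖x‖ ^ 2 ≤ 4 / 3 → ‖(v : B) - 1‖ ^ 2 ≤ 3 / 2 * ‖x‖ ^ 2 ∧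
        ‖(w : B) - 1‖ ^ 2 ≤ 3 / 2 * ‖x‖ ^ 2) := by
  have hs : star x * star x = 0 := by rw [← star_mul, hx, star_zero]
  set d := selfCommutator x with hd
  have hdsa : IsSelfAdjoint d := isSelfAdjoint_selfCommutator x
  set φ := x * star x + star x * x with hφ
  have hφsa : IsSelfAdjoint φ := (IsSelfAdjoint.mul_star_self x).add (IsSelfAdjoint.star_mul_self x)
  set y := x - star x with hy
  set z := x + star x with hz
  have hys : star y = -y := by rw [hy, star_sub, star_star]; abel
  have hzs : star z = z := by rw [hz, star_add, star_star]; abel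
  have hyz : y * z = d := by
    rw [hy, hz, hd, selfCommutator, sub_mul, mul_add, mul_add, hx, hs]; abel
  have hzy : z * y = -d := by
    rw [hy, hz, hd, selfCommutator, add_mul, mul_sub, mul_sub, hx, hs]; abel
  have hyy : star y * y = φ := by
    rw [hys, hy, hφ, neg_mul, sub_mul, mul_sub, mul_sub, hx, hs]; abel
  have hzz : z * z = φ := by
    rw [hz, hφ, add_mul, mul_add, mul_add, hx, hs]; abel
  have hxss : ∀ a : B, x * (x * a) = 0 := fun a => by rw [← mul_assoc, hx, zero_mul]
  have hsss : ∀ a : B, star x * (star x * a) = 0 := fun a => by rw [← mul_assoc, hs, zero_mul]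
  have hdφ : d ^ 2 = φ ^ 2 := by
    simp only [hd, selfCommutator, hφ, sq, sub_mul, mul_sub, add_mul, mul_add, mul_assoc, hxss,
      hsss, mul_zero]
    abel
  have hdx : d * x = -(x * d) := by
    simp only [hd, selfCommutator, sub_mul, mul_sub, mul_assoc, hxss, hx, mul_zero]
    abel
  have hds : d * star x = -(star x * d) := by
    simp only [hd, selfCommutator, sub_mul, mul_sub, mul_assoc, hsss, hs, mul_zero]
    abel
  have hdy : d * y = -(y * d) := by rw [hy, mul_sub, hdx, hds, sub_mul]; abel
  have hdz : d * z = -(z * d) := by rw [hz, mul_add, hdx, hds, add_mul]; abel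
  have cφx : Commute φ x := by
    simp only [Commute, SemiconjBy, hφ, add_mul, mul_add, mul_assoc, hxss, hx, mul_zero, add_zero,
      zero_add]
  have cφs : Commute φ (star x) := by
    simp only [Commute, SemiconjBy, hφ, add_mul, mul_add, mul_assoc, hsss, hs, mul_zero, add_zero,
      zero_add]
  have cφy : Commute φ y := cφx.sub_right cφs
  have cφz : Commute φ z := cφx.add_right cφs
  have cφd : Commute φ d := (cφx.mul_right cφs).sub_right (cφs.mul_right cφx)
  set C := cfc Real.cos φ with hC
  set S := cfc Real.sinc φ with hS
  have hCsa : IsSelfAdjoint C := cfc_predicate _ _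
  have hSsa : IsSelfAdjoint S := cfc_predicate _ _
  have cC : ∀ {b}, Commute φ b → Commute C b := fun h => h.cfc_real _
  have cS : ∀ {b}, Commute φ b → Commute S b := fun h => h.cfc_real _
  have cφC : Commute φ C := (cC (Commute.refl φ)).symm
  have cφS : Commute φ S := (cS (Commute.refl φ)).symm
  set u := selfAdjoint.expUnitary ⟨d, hdsa⟩ with hu
  set E : B := (u : B) with hE
  set E' : B := star E with hE'
  have eE : E = C + Complex.I • (S * d) := expUnitary_eq_cos_add_sinc hdsa hφsa hdφ
  have eE' : E' = C - Complex.I • (S * d) := by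
    rw [hE', eE, star_add, star_smul, star_mul, hCsa.star_eq, hSsa.star_eq, hdsa.star_eq,
      ← (cS cφd).eq, Complex.star_def, Complex.conj_I, neg_smul, ← sub_eq_add_neg]
  have hEE' : E * E' = 1 := Unitary.mul_star_self_of_mem u.2
  have hE'E : E' * E = 1 := Unitary.star_mul_self_of_mem u.2
  have cφE : Commute φ E := by
    rw [eE]
    exact cφC.add_right ((cφS.mul_right cφd).smul_right _)
  have cφE' : Commute φ E' := by
    rw [eE']
    exact cφC.sub_right ((cφS.mul_right cφd).smul_right _)
  have anti : ∀ {b}, Commute φ b → d * b = -(b * d) → b * E = E' * b ∧ b * E' = E * b := by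
    intro b hb hdb
    have h1 : S * d * b = -(b * (S * d)) := by
      rw [mul_assoc, hdb, mul_neg, ← mul_assoc, (cS hb).eq, mul_assoc]
    rw [eE, eE', mul_add, mul_sub, add_mul, sub_mul, smul_mul_assoc, h1, (cC hb).eq,
      mul_smul_comm, smul_neg]
    exact ⟨(sub_neg_eq_add _ _).symm, sub_eq_add_neg _ _⟩
  obtain ⟨hyE, hyE'⟩ := anti cφy hdy
  obtain ⟨hzE, hzE'⟩ := anti cφz hdz
  -- the skew-adjoint element belonging to the polar part of `w`
  set k := Complex.I • (E * S * z) with hk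
  have hzSE : E * S * z = z * S * E' := by
    rw [mul_assoc, (cS cφz).eq, ← mul_assoc, ← hzE', mul_assoc, ← (cS cφE').eq, ← mul_assoc]
  have hks : star k = -k := by
    rw [hk, star_smul, star_mul, star_mul, hzs, hSsa.star_eq, ← mul_assoc, ← hzSE,
      Complex.star_def, Complex.conj_I, neg_smul]
  have hkk : star k * k = S * S * φ := by
    have h1 : E * S * z * (E * S * z) = S * S * φ := by
      calc E * S * z * (E * S * z) = z * S * (E' * E) * S * z := by
            nth_rewrite 1 [hzSE]; noncomm_ring
        _ = S * S * φ := by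
            rw [hE'E, mul_one, ← (cS cφz).eq, mul_assoc, mul_assoc, (cS cφz).eq, ← mul_assoc z,
              hzz, ← (cS (Commute.refl φ)).eq, mul_assoc]
    rw [hks, hk, neg_mul, smul_mul_assoc, mul_smul_comm, smul_smul, Complex.I_mul_I, h1, neg_smul,
      one_smul, neg_neg]
  set R := cfc invSqrt (star y * y) with hR
  set Q := cfc invSqrt (star k * k) with hQ
  have cR : ∀ {b}, Commute φ b → Commute R b := fun h => Commute.cfc_real (by rwa [hyy]) _
  have cQ : ∀ {b}, Commute φ b → Commute Q b := fun h =>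
    Commute.cfc_real (by rw [hkk]; exact ((cS h).mul_left (cS h)).mul_left h) _
  have cφR : Commute φ R := (cR (Commute.refl φ)).symm
  have cφQ : Commute φ Q := (cQ (Commute.refl φ)).symm
  let U : unitary B := ⟨skewPolar y, skewPolar_mem_unitary hys⟩
  let T : unitary B := ⟨skewPolar k, skewPolar_mem_unitary hks⟩
  have hU : (U : B) = (1 + y) * R := rfl
  have hT : (T : B) = (1 + k) * Q := rfl
  have hu0 : u ∈ Subgroup.connectedComponentOfOne (unitary B) :=
    expUnitary_mem_connectedComponentOfOne _
  have hw : E' * (T : B) = (E' + Complex.I • (S * z)) * Q := by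
    rw [hT, ← mul_assoc, mul_add, mul_one, hk, mul_smul_comm, mul_assoc E, ← mul_assoc E', hE'E,
      one_mul]
  have key : E' * (T : B) * (E * (U : B)) = E' * (U : B) * (E' * (T : B)) := by
    rw [hw, hU]
    have c1 : Commute Q (E * (1 + y)) := cQ (cφE.mul_right ((Commute.one_right _).add_right cφy))
    have c2 : Commute R (E' + Complex.I • (S * z)) :=
      cR (cφE'.add_right ((cφS.mul_right cφz).smul_right _))
    have c3 : Commute Q R := cQ cφR
    have h1 : (E' + Complex.I • (S * z)) * (E * (1 + y)) =
        1 + y + Complex.I • (E' * S * z) - Complex.I • (E' * S * d) := by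
      calc (E' + Complex.I • (S * z)) * (E * (1 + y))
          = E' * E * (1 + y) + Complex.I • (S * (z * E) * (1 + y)) := by
            rw [add_mul, smul_mul_assoc]; noncomm_ring
        _ = 1 + y + Complex.I • (S * E' * (z + z * y)) := by
            rw [hE'E, one_mul, hzE]; noncomm_ring
        _ = _ := by
            rw [hzy, (cS cφE').eq, mul_add, mul_neg, smul_add, smul_neg]; abel
    have h2 : E' * (1 + y) * (E' + Complex.I • (S * z)) =
        E' * E' + y + Complex.I • (E' * S * z) + Complex.I • (E' * S * d) := by
      calc E' * (1 + y) * (E' + Complex.I • (S * z))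
          = E' * E' + E' * (y * E') + Complex.I • (E' * S * z + E' * (y * S) * z) := by
            rw [mul_add, mul_smul_comm]; noncomm_ring
        _ = E' * E' + E' * E * y + Complex.I • (E' * S * z + E' * S * (y * z)) := by
            rw [hyE', ← (cS cφy).eq]; noncomm_ring
        _ = _ := by rw [hE'E, one_mul, hyz, smul_add, add_assoc (E' * E' + y)]
    have h3 : (E' + Complex.I • (S * z)) * (E * (1 + y)) =
        E' * (1 + y) * (E' + Complex.I • (S * z)) := by
      have h4 : 1 = E' * E' + Complex.I • (E' * S * d) + Complex.I • (E' * S * d) := by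
        have h5 : E = E' + Complex.I • (S * d) + Complex.I • (S * d) := by
          rw [eE, eE', sub_add_cancel]
        calc 1 = E' * E := hE'E.symm
          _ = _ := by
            conv_lhs => rw [h5]
            rw [mul_add, mul_add, mul_smul_comm, mul_assoc]
      rw [h1, h2]
      conv_lhs => rw [h4]
      abel
    calc (E' + Complex.I • (S * z)) * Q * (E * ((1 + y) * R))
        = (E' + Complex.I • (S * z)) * (Q * (E * (1 + y))) * R := by noncomm_ring
      _ = (E' + Complex.I • (S * z)) * (E * (1 + y)) * (Q * R) := by rw [c1.eq]; noncomm_ring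
      _ = E' * (1 + y) * ((E' + Complex.I • (S * z)) * R) * Q := by
          rw [h3, c3.eq]; noncomm_ring
      _ = _ := by rw [← c2.eq]; noncomm_ring
  have key' : u⁻¹ * T * (u * U) = u⁻¹ * U * (u⁻¹ * T) := Subtype.ext key
  refine ⟨u * U, u⁻¹ * T, mul_mem hu0 (mem_connectedComponentOfOne_of_norm_sub_one_lt_two
    (norm_skewPolar_sub_one_lt_two hys)), mul_mem (inv_mem hu0)
    (mem_connectedComponentOfOne_of_norm_sub_one_lt_two (norm_skewPolar_sub_one_lt_two hks)),
    ?_, ?_, ?_⟩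
  · have h1 : ⁅u * U, u⁻¹ * T⁆ = u * U * (u⁻¹ * T * (u * U) * (u⁻¹ * T)⁻¹)⁻¹ := by
      rw [commutatorElement_def]; group
    rw [h1, key']
    group
  · intro χ hχ
    have hχs : χ (star x) = 0 := by rw [map_star, hχ, star_zero]
    have hχd : χ d = 0 := by rw [hd, selfCommutator, map_sub, map_mul, map_mul, hχ, hχs]; simp
    have hχE : χ E = 1 := map_expUnitary χ hχd
    have hχU : χ (U : B) = 1 := map_skewPolar χ (by rw [hy, map_sub, hχ, hχs, sub_zero])
    have hχT : χ (T : B) = 1 :=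
      map_skewPolar χ (by rw [hk, map_smul, map_mul, hz, map_add, hχ, hχs]; simp)
    constructor
    · change χ (E * (U : B)) = 1
      rw [map_mul, hχE, hχU, one_mul]
    · change χ (star E * (T : B)) = 1
      rw [map_mul, map_star, hχE, hχT, star_one, one_mul]
  · intro hxn
    have hφn : ‖star y * y‖ ≤ ‖x‖ ^ 2 := by
      rw [hyy, hφ, IsSelfAdjoint.norm_add_eq_max (IsSelfAdjoint.mul_star_self x)
        (IsSelfAdjoint.star_mul_self x) (by rw [mul_assoc, hsss, mul_zero]),
        CStarRing.norm_self_mul_star, CStarRing.norm_star_mul_self, max_self, sq]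
    have hbound : ∀ {v : B} {f : ℝ → ℝ}, v ∈ unitary B → Continuous f →
        v + star v = (2 : ℝ) • cfc f (star y * y) → (∀ t, f t ≤ 1) →
        (∀ t, 0 ≤ t → t ≤ 4 / 3 → 1 - 3 / 4 * t ≤ f t) → ‖v - 1‖ ^ 2 ≤ 3 / 2 * ‖x‖ ^ 2 := by
      intro v f hv hf h h1 h2
      have := norm_unitary_sub_one_sq_le hv hf h (hφn.trans hxn) h1 h2
      linarith
    have h2C : E + E' = (2 : ℝ) • C := by rw [eE, eE', two_smul]; abel
    have hRsa : IsSelfAdjoint R := cfc_predicate _ _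
    have hQsa : IsSelfAdjoint Q := cfc_predicate _ _
    have hc := continuous_invSqrt
    have hc' : Continuous fun t => invSqrt (Real.sinc t * Real.sinc t * t) :=
      hc.comp ((Real.continuous_sinc.mul Real.continuous_sinc).mul continuous_id)
    refine ⟨hbound (u * U).2 (f := fun t => Real.cos t * invSqrt t)
      (Real.continuous_cos.mul hc) ?_ (fun t => cos_mul_invSqrt_le_one _ _)
      fun t h0 ht => one_sub_le_cos_mul_invSqrt h0 le_rfl ht,
      hbound (u⁻¹ * T).2
        (f := fun t => Real.cos t * invSqrt (Real.sinc t * Real.sinc t * t))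
        (Real.continuous_cos.mul hc') ?_ (fun t => cos_mul_invSqrt_le_one _ _) fun t h0 ht =>
          one_sub_le_cos_mul_invSqrt (mul_nonneg (mul_self_nonneg _) h0) ?_ ht⟩
    · -- the real part of `v` is `cos φ (1 + φ)^(-1/2)`
      rw [cfc_mul Real.cos invSqrt (star y * y) Real.continuous_cos.continuousOn hc.continuousOn]
      have e1 : E * (U : B) = R * (E + y * E') := by
        rw [hU, ← mul_assoc, ← (cR (cφE.mul_right ((Commute.one_right _).add_right cφy))).eq,
          mul_add, mul_one, hyE']
      have e2 : star (E * (U : B)) = R * (E' - y * E') := by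
        rw [e1, star_mul, star_add, star_mul, hys, hRsa.star_eq, ← hE', hE', star_star, ← hE',
          mul_neg, ← hyE', ← sub_eq_add_neg, (cR (cφE'.sub_right (cφy.mul_right cφE'))).eq]
      change E * (U : B) + star (E * (U : B)) = _
      rw [e2, e1, ← mul_add, ← hR, hyy, ← hC, ← smul_mul_assoc, ← h2C,
        ← (cR (cφE.add_right cφE')).eq]
      congr 1
      abel
    · -- the real part of `w` is `cos φ (1 + φ (sinc φ)²)^(-1/2)`
      have hQ' : Q = cfc (fun t => invSqrt (Real.sinc t * Real.sinc t * t)) φ := by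
        have hs' := Real.continuous_sinc
        rw [hQ, hkk, cfc_comp' invSqrt (fun t => Real.sinc t * Real.sinc t * t) φ
          hc.continuousOn ((hs'.mul hs').mul continuous_id).continuousOn,
          cfc_mul (fun t => Real.sinc t * Real.sinc t) (fun t => t) φ (hs'.mul hs').continuousOn
          continuousOn_id, cfc_mul _ _ φ hs'.continuousOn hs'.continuousOn, cfc_id' ℝ φ]
      rw [cfc_mul Real.cos _ (star y * y) Real.continuous_cos.continuousOn hc'.continuousOn, hyy,
        ← hQ', ← hC, ← smul_mul_assoc, ← h2C]
      change E' * (T : B) + star (E' * (T : B)) = _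
      have e2 : star ((E' + Complex.I • (S * z)) * Q) = (E - Complex.I • (S * z)) * Q := by
        rw [star_mul, hQsa.star_eq, star_add, star_smul, star_mul, hSsa.star_eq, hzs,
          ← (cS cφz).eq, hE', star_star, Complex.star_def, Complex.conj_I, neg_smul,
          ← sub_eq_add_neg, (cQ (cφE.sub_right ((cφS.mul_right cφz).smul_right _))).eq]
      rw [hw, e2, ← add_mul]
      congr 1
      abel
    · have h1 := Real.abs_sinc_le_one t
      have h2 : Real.sinc t * Real.sinc t ≤ 1 := by
        rw [← abs_mul_abs_self]
        exact mul_le_one₀ h1 (abs_nonneg _) h1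
      exact mul_le_of_le_one_left h0 h2

/-- `exists_commutator_eq_expUnitary_sq` for `x / √2`, whose self-commutator is half of that
of `x`. -/
theorem exists_commutator_eq_expUnitary_selfCommutator {x : B} (hx : x * x = 0) :
    ∃ v w : unitary B, v ∈ Subgroup.connectedComponentOfOne (unitary B) ∧
      w ∈ Subgroup.connectedComponentOfOne (unitary B) ∧
      ⁅v, w⁆ = selfAdjoint.expUnitary ⟨selfCommutator x, isSelfAdjoint_selfCommutator x⟩ ∧
      (∀ χ : B →⋆ₐ[ℂ] ℂ, χ x = 0 → χ v = 1 ∧ χ w = 1) ∧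
      (‖x‖ ^ 2 ≤ 8 / 3 → ‖(v : B) - 1‖ ^ 2 ≤ 3 / 4 * ‖x‖ ^ 2 ∧
        ‖(w : B) - 1‖ ^ 2 ≤ 3 / 4 * ‖x‖ ^ 2) := by
  have hc : (√2)⁻¹ * (√2)⁻¹ = (2 : ℝ)⁻¹ := by
    rw [← mul_inv, Real.mul_self_sqrt two_pos.le]
  obtain ⟨v, w, hv, hw, hvw, hχ, hn⟩ := exists_commutator_eq_expUnitary_sq
    (x := ((√2)⁻¹ : ℝ) • x) (by rw [smul_mul_smul_comm, hx, smul_zero])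
  refine ⟨v, w, hv, hw, ?_, fun χ hx0 => hχ χ ?_, fun hxn => ?_⟩
  · rw [hvw, ← Commute.expUnitary_add (Commute.refl _)]
    congr 1
    ext
    change selfCommutator _ + selfCommutator _ = selfCommutator x
    simp only [selfCommutator, star_smul, star_trivial, smul_mul_smul_comm, hc]
    rw [← smul_sub, ← two_smul ℝ, smul_smul, mul_inv_cancel₀ two_ne_zero, one_smul]
  · have : ((√2)⁻¹ : ℝ) • x = (((√2)⁻¹ : ℝ) : ℂ) • x := (Complex.coe_smul _ _).symm
    rw [this, map_smul, hx0, smul_zero]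
  · have h1 : ‖((√2)⁻¹ : ℝ) • x‖ ^ 2 = 2⁻¹ * ‖x‖ ^ 2 := by
      rw [norm_smul, Real.norm_eq_abs, mul_pow, sq_abs, sq, hc]
    obtain ⟨h2, h3⟩ := hn (by rw [h1]; linarith)
    rw [h1] at h2 h3
    exact ⟨by linarith, by linarith⟩

end SingleCommutator

/-! ### The trace of the logarithm along a path -/

section LogTrace

variable {B Q : Type*} [NormedRing B] [NormedAlgebra ℝ B] [NormedAddCommGroup Q] [NormedSpace ℝ Q]

/-- The value of `τ` at `log (1 + x)`, as a power series in `x`. -/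
def logTrace (τ : B →L[ℝ] Q) (x : B) : Q :=
  ∑' n : ℕ, ((-1) ^ n / (n + 1) : ℝ) • τ (x ^ (n + 1))

theorem hasDerivAt_trace_pow (τ : B →L[ℝ] Q) (hτ : ∀ a b, τ (a * b) = τ (b * a)) {x : ℝ → B}
    {x' : B} {t : ℝ} (hx : HasDerivAt x x' t) (n : ℕ) :
    HasDerivAt (fun s => τ (x s ^ (n + 1))) ((n + 1 : ℝ) • τ (x t ^ n * x')) t := by
  have h1 := τ.hasFDerivAt.comp_hasDerivAt t (hx.fun_pow' (n + 1))
  convert! h1 using 1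
  rw [map_sum, Finset.sum_congr rfl (g := fun _ => τ (x t ^ n * x')), Finset.sum_const,
    Finset.card_range, ← Nat.cast_smul_eq_nsmul ℝ, Nat.cast_succ]
  intro i hi
  rw [hτ, ← mul_assoc, ← pow_add, Nat.pred_succ,
    Nat.add_sub_cancel' (Finset.mem_range_succ_iff.1 hi)]

/-- Along a path `g` of invertible elements close to `1` that starts at `1`, a trace of the
logarithm grows at the rate given by the trace of the logarithmic derivative `g⁻¹ g'`. -/
theorem logTrace_sub_one_eq [NormOneClass B] [CompleteSpace B] [CompleteSpace Q] (τ : B →L[ℝ] Q)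
    (hτ : ∀ a b, τ (a * b) = τ (b * a)) {g m : ℝ → B} {κ : Q} {r M : ℝ} (hr : r < 1) (hg0 : g 0 = 1)
    (hg : ∀ t ∈ Set.Ioo (-1 : ℝ) 2, HasDerivAt g (g t * m t) t)
    (hgr : ∀ t ∈ Set.Ioo (-1 : ℝ) 2, ‖g t - 1‖ ≤ r) (hm : ∀ t ∈ Set.Ioo (-1 : ℝ) 2, ‖m t‖ ≤ M)
    (hκ : ∀ t, τ (m t) = κ) : logTrace τ (g 1 - 1) = κ := by
  have hI0 : (0 : ℝ) ∈ Set.Ioo (-1 : ℝ) 2 := by constructor <;> norm_num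
  have hI1 : (1 : ℝ) ∈ Set.Ioo (-1 : ℝ) 2 := by constructor <;> norm_num
  have hr0 : 0 ≤ r := (norm_nonneg _).trans (hgr 0 hI0)
  have hM0 : 0 ≤ M := (norm_nonneg _).trans (hm 0 hI0)
  have hpow : ∀ n : ℕ, ∀ t ∈ Set.Ioo (-1 : ℝ) 2, ‖(g t - 1) ^ n‖ ≤ r ^ n := fun n t ht =>
    (norm_pow_le _ _).trans (pow_le_pow_left₀ (norm_nonneg _) (hgr t ht) n)
  have hterm : ∀ n : ℕ, ∀ t ∈ Set.Ioo (-1 : ℝ) 2,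
      HasDerivAt (fun s => ((-1) ^ n / (n + 1) : ℝ) • τ ((g s - 1) ^ (n + 1)))
        (((-1) ^ n : ℝ) • τ ((g t - 1) ^ n * (g t * m t))) t := by
    intro n t ht
    have h1 := (hasDerivAt_trace_pow τ hτ ((hg t ht).sub_const 1) n).const_smul
      ((-1) ^ n / (n + 1) : ℝ)
    rwa [smul_smul, div_mul_cancel₀ _ (by positivity)] at h1
  have hbd : ∀ n : ℕ, ∀ t ∈ Set.Ioo (-1 : ℝ) 2,
      ‖((-1) ^ n : ℝ) • τ ((g t - 1) ^ n * (g t * m t))‖ ≤ ‖τ‖ * (2 * M) * r ^ n := by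
    intro n t ht
    have h1 : ‖g t‖ ≤ 2 := by
      have h2 : g t = (g t - 1) + 1 := by abel
      rw [h2]
      refine (norm_add_le _ _).trans ?_
      rw [norm_one]
      linarith [hgr t ht]
    rw [norm_smul, norm_pow, norm_neg, norm_one, one_pow, one_mul]
    calc _ ≤ ‖τ‖ * ‖(g t - 1) ^ n * (g t * m t)‖ := τ.le_opNorm _
      _ ≤ ‖τ‖ * (r ^ n * (2 * M)) := by
          gcongr
          exact (norm_mul_le _ _).trans (mul_le_mul (hpow n t ht) ((norm_mul_le _ _).trans
            (mul_le_mul h1 (hm t ht) (norm_nonneg _) two_pos.le)) (norm_nonneg _) (by positivity))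
      _ = _ := by ring
  have hu : Summable fun n : ℕ => ‖τ‖ * (2 * M) * r ^ n :=
    (summable_geometric_of_lt_one hr0 hr).mul_left _
  have hsum : ∀ t ∈ Set.Ioo (-1 : ℝ) 2,
      ∑' n : ℕ, ((-1) ^ n : ℝ) • τ ((g t - 1) ^ n * (g t * m t)) = κ := by
    intro t ht
    have h1 : ‖-(g t - 1)‖ < 1 := by rw [norm_neg]; exact (hgr t ht).trans_lt hr
    have h2 := (summable_geometric_of_norm_lt_one h1).hasSum
    have h3 : (∑' n : ℕ, (-(g t - 1)) ^ n) * g t = 1 := by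
      have := geom_series_mul_neg _ h1
      rwa [sub_neg_eq_add, add_sub_cancel] at this
    have h4 := τ.hasSum (h2.mul_right (g t * m t))
    rw [← mul_assoc, h3, one_mul, hκ t] at h4
    rw [← h4.tsum_eq]
    refine tsum_congr fun n => ?_
    rcases Nat.even_or_odd n with h | h
    · rw [h.neg_one_pow, h.neg_pow, one_smul]
    · rw [h.neg_one_pow, h.neg_pow, neg_smul, one_smul, neg_mul, map_neg]
  have hderiv : ∀ t ∈ Set.Ioo (-1 : ℝ) 2,
      HasDerivAt (fun s => logTrace τ (g s - 1) - s • κ) 0 t := by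
    intro t ht
    have h1 := hasDerivAt_tsum_of_isPreconnected hu isOpen_Ioo isPreconnected_Ioo hterm hbd hI0
      (by simp [hg0]) ht
    rw [hsum t ht] at h1
    have h2 := h1.sub ((hasDerivAt_id t).smul_const κ)
    rw [one_smul, sub_self] at h2
    exact h2
  have h1 := (convex_Ioo (-1 : ℝ) 2).norm_image_sub_le_of_norm_hasDerivWithin_le (C := 0)
    (fun t ht => (hderiv t ht).hasDerivWithinAt) (fun t _ => by rw [norm_zero]) hI0 hI1
  have h0 : logTrace τ (g 0 - 1) = 0 := by simp [logTrace, hg0]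
  rw [zero_mul, h0, zero_smul, sub_zero, sub_zero, one_smul] at h1
  exact sub_eq_zero.1 (norm_le_zero_iff.1 h1)

end LogTrace

/-! ### Splitting an exponential into two exponentials -/

section Splitting

section Paths

variable {B : Type*} [CStarAlgebra B]

theorem exp_smul_mem_unitary {a : B} (ha : star a = -a) (t : ℝ) :
    NormedSpace.exp (t • a) ∈ unitary B := by
  let +nondep : NormedAlgebra ℚ B := .restrictScalars ℚ ℂ B
  refine NormedSpace.exp_mem_unitary_of_mem_skewAdjoint ?_
  rw [skewAdjoint.mem_iff, star_smul, star_trivial, ha, smul_neg]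

theorem exp_smul_mul_exp_neg_smul (a : B) (t : ℝ) :
    NormedSpace.exp (t • a) * NormedSpace.exp (t • -a) = 1 := by
  let +nondep : NormedAlgebra ℚ B := .restrictScalars ℚ ℂ B
  rw [smul_neg, ← NormedSpace.exp_add_of_commute (Commute.refl _).neg_right, add_neg_cancel,
    NormedSpace.exp_zero]

theorem exp_neg_smul_mul_exp_smul (a : B) (t : ℝ) :
    NormedSpace.exp (t • -a) * NormedSpace.exp (t • a) = 1 := by
  have := exp_smul_mul_exp_neg_smul (-a) t
  rwa [neg_neg] at this

theorem norm_exp_smul_sub_one_le {a : B} (ha : star a = -a) (t : ℝ) :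
    ‖NormedSpace.exp (t • a) - 1‖ ≤ ‖a‖ * |t| := by
  have h1 := convex_univ.norm_image_sub_le_of_norm_hasDerivWithin_le (x := (0 : ℝ)) (y := t)
    (C := ‖a‖) (fun s _ => (hasDerivAt_exp_smul_const a s).hasDerivWithinAt)
    (fun s _ => (CStarRing.norm_mem_unitary_mul a (exp_smul_mem_unitary ha s)).le) trivial trivial
  rwa [zero_smul, NormedSpace.exp_zero, sub_zero, Real.norm_eq_abs] at h1

/-- Conjugation with `e^{ta}` moves `b` by at most `|t|` times the norm of `[a, b]`. -/
theorem norm_exp_conj_sub_le {a b : B} (ha : star a = -a) (t : ℝ) :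
    ‖NormedSpace.exp (t • a) * b * NormedSpace.exp (t • -a) - b‖ ≤ ‖a * b - b * a‖ * |t| := by
  have hna : star (-a) = -(-a) := by rw [star_neg, ha]
  have hd : ∀ s : ℝ, HasDerivAt
      (fun s : ℝ => NormedSpace.exp (s • a) * b * NormedSpace.exp (s • -a))
      (NormedSpace.exp (s • a) * (a * b - b * a) * NormedSpace.exp (s • -a)) s := by
    intro s
    have h1 := ((hasDerivAt_exp_smul_const a s).mul_const b).mul (hasDerivAt_exp_smul_const' (-a) s)
    convert! h1 using 1
    noncomm_ring
  have h1 := convex_univ.norm_image_sub_le_of_norm_hasDerivWithin_le (x := (0 : ℝ)) (y := t)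
    (C := ‖a * b - b * a‖) (fun s _ => (hd s).hasDerivWithinAt)
    (fun s _ => by
      rw [CStarRing.norm_mul_mem_unitary _ (exp_smul_mem_unitary hna s),
        CStarRing.norm_mem_unitary_mul _ (exp_smul_mem_unitary ha s)]) trivial trivial
  simpa only [zero_smul, NormedSpace.exp_zero, one_mul, mul_one, sub_zero, Real.norm_eq_abs]
    using h1

/-- The path `t ↦ e^{-t a₁} e^{-t a₀} e^{t b}`, which stays near `1` if `a₀` and `a₁` almost commute
and `b` is near `a₀ + a₁`. -/
def splittingPath (a₀ a₁ b : B) (t : ℝ) : B :=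
  NormedSpace.exp (t • -a₁) * NormedSpace.exp (t • -a₀) * NormedSpace.exp (t • b)

/-- The logarithmic derivative `g⁻¹ g'` of `splittingPath`. -/
def splittingPathLogDeriv (a₀ a₁ b : B) (t : ℝ) : B :=
  b - NormedSpace.exp (t • -b) *
    (a₀ + NormedSpace.exp (t • a₀) * a₁ * NormedSpace.exp (t • -a₀)) * NormedSpace.exp (t • b)

theorem splittingPath_zero (a₀ a₁ b : B) : splittingPath a₀ a₁ b 0 = 1 := by
  simp [splittingPath]

theorem splittingPath_mem_unitary {a₀ a₁ b : B} (h₀ : star a₀ = -a₀) (h₁ : star a₁ = -a₁)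
    (hb : star b = -b) (t : ℝ) : splittingPath a₀ a₁ b t ∈ unitary B :=
  mul_mem (mul_mem (exp_smul_mem_unitary (by rw [star_neg, h₁]) t)
    (exp_smul_mem_unitary (by rw [star_neg, h₀]) t)) (exp_smul_mem_unitary hb t)

theorem hasDerivAt_splittingPath (a₀ a₁ b : B) (t : ℝ) :
    HasDerivAt (splittingPath a₀ a₁ b) (splittingPath a₀ a₁ b t * splittingPathLogDeriv a₀ a₁ b t)
      t := by
  have h1 := ((hasDerivAt_exp_smul_const (-a₁) t).mul (hasDerivAt_exp_smul_const (-a₀) t)).mul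
    (hasDerivAt_exp_smul_const b t)
  convert! h1 using 1
  have hb := exp_smul_mul_exp_neg_smul b t
  have h0 := exp_neg_smul_mul_exp_smul a₀ t
  rw [splittingPath, splittingPathLogDeriv]
  set E₁ := NormedSpace.exp (t • -a₁)
  set E₀ := NormedSpace.exp (t • -a₀)
  set F₀ := NormedSpace.exp (t • a₀)
  set G := NormedSpace.exp (t • b)
  set H := NormedSpace.exp (t • -b)
  change _ = (E₁ * -a₁ * E₀ + E₁ * (E₀ * -a₀)) * G + E₁ * E₀ * (G * b)
  calc E₁ * E₀ * G * (b - H * (a₀ + F₀ * a₁ * E₀) * G)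
      = E₁ * E₀ * G * b - E₁ * E₀ * (G * H) * a₀ * G - E₁ * E₀ * (G * H) * F₀ * a₁ * E₀ * G := by
        noncomm_ring
    _ = E₁ * E₀ * G * b - E₁ * E₀ * a₀ * G - E₁ * (E₀ * F₀) * a₁ * E₀ * G := by
        rw [hb]; noncomm_ring
    _ = _ := by rw [h0]; noncomm_ring

theorem norm_splittingPathLogDeriv_le {a₀ a₁ b : B} (h₀ : star a₀ = -a₀) (hb : star b = -b)
    {η : ℝ} (hc : ‖a₀ * a₁ - a₁ * a₀‖ ≤ η) (hs : ‖b - a₀ - a₁‖ ≤ η) {t : ℝ} (ht : |t| ≤ 2) :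
    ‖splittingPathLogDeriv a₀ a₁ b t‖ ≤ 3 * η := by
  have hη : 0 ≤ η := (norm_nonneg _).trans hs
  have e1 : splittingPathLogDeriv a₀ a₁ b t = NormedSpace.exp (t • -b) * ((b - a₀ - a₁)
      - (NormedSpace.exp (t • a₀) * a₁ * NormedSpace.exp (t • -a₀) - a₁))
      * NormedSpace.exp (t • b) := by
    have h1 : Commute (NormedSpace.exp (t • -b)) b := by
      let +nondep : NormedAlgebra ℚ B := .restrictScalars ℚ ℂ B
      exact (((Commute.refl b).neg_left).smul_left t).exp_left
    have h2 : b = NormedSpace.exp (t • -b) * b * NormedSpace.exp (t • b) := by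
      rw [h1.eq, mul_assoc, exp_neg_smul_mul_exp_smul, mul_one]
    rw [splittingPathLogDeriv]
    nth_rewrite 1 [h2]
    noncomm_ring
  rw [e1, CStarRing.norm_mul_mem_unitary _ (exp_smul_mem_unitary hb t),
    CStarRing.norm_mem_unitary_mul _ (exp_smul_mem_unitary (by rw [star_neg, hb]) t)]
  have h3 := norm_exp_conj_sub_le (b := a₁) h₀ t
  have h4 : ‖a₀ * a₁ - a₁ * a₀‖ * |t| ≤ η * 2 := mul_le_mul hc ht (abs_nonneg _) hη
  refine (norm_sub_le _ _).trans ?_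
  linarith

theorem norm_splittingPath_sub_one_le {a₀ a₁ b : B} (h₀ : star a₀ = -a₀) (h₁ : star a₁ = -a₁)
    (hb : star b = -b) {η : ℝ} (hc : ‖a₀ * a₁ - a₁ * a₀‖ ≤ η) (hs : ‖b - a₀ - a₁‖ ≤ η) {t : ℝ}
    (ht : |t| ≤ 2) : ‖splittingPath a₀ a₁ b t - 1‖ ≤ 6 * η := by
  have hη : 0 ≤ η := (norm_nonneg _).trans hs
  have h1 := (convex_Icc (-2 : ℝ) 2).norm_image_sub_le_of_norm_hasDerivWithin_le (x := (0 : ℝ))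
    (y := t) (C := 3 * η)
    (fun s _ => (hasDerivAt_splittingPath a₀ a₁ b s).hasDerivWithinAt)
    (fun s hs' => by
      rw [CStarRing.norm_mem_unitary_mul _ (splittingPath_mem_unitary h₀ h₁ hb s)]
      exact norm_splittingPathLogDeriv_le h₀ hb hc hs (abs_le.2 hs')) (by norm_num) (abs_le.1 ht)
  rw [splittingPath_zero, sub_zero, Real.norm_eq_abs] at h1
  refine h1.trans ?_
  have := mul_le_mul_of_nonneg_left ht hη
  linarith

/-- The selfadjoint logarithm of a unitary close to `1` is small. -/
theorem norm_argSelfAdjoint_le {u : unitary B} (hu : ‖(u : B) - 1‖ < 2) :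
    ‖Unitary.argSelfAdjoint u‖ ≤ 2 * ‖(u : B) - 1‖ := by
  have h1 := Unitary.two_mul_one_sub_cos_norm_argSelfAdjoint hu
  have h2 := Unitary.norm_argSelfAdjoint_le_pi u
  have h3 := Real.cos_le_one_sub_mul_cos_sq (x := ‖Unitary.argSelfAdjoint u‖)
    (by rwa [abs_of_nonneg (norm_nonneg _)])
  have h4 : 1 / 4 ≤ 4 / Real.pi ^ 2 := by
    rw [div_le_div_iff₀ (by norm_num) (by positivity)]
    nlinarith [Real.pi_pos, Real.pi_lt_four]
  refine le_of_sq_le_sq ?_ (by positivity)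
  rw [mul_pow, ← h1]
  have h5 := mul_le_mul_of_nonneg_right h4 (sq_nonneg ‖Unitary.argSelfAdjoint u‖)
  have h6 : 4 / Real.pi ^ 2 * ‖Unitary.argSelfAdjoint u‖ ^ 2 =
    2 * (2 / Real.pi ^ 2 * ‖Unitary.argSelfAdjoint u‖ ^ 2) := by ring
  linarith

end Paths

section Unitization

theorem eq_inr_snd_of_fst_eq_zero {A : Type*} [AddMonoid A] {x : Unitization ℂ A} (hx : x.fst = 0) :
    x = (x.snd : Unitization ℂ A) := by
  ext
  · rw [hx, Unitization.fst_inr]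
  · rw [Unitization.snd_inr]

variable {A : Type*} [NonUnitalCStarAlgebra A]

instance isClosed_commutatorClosure : IsClosed (commutatorClosure A : Set A) :=
  Submodule.isClosed_topologicalClosure _

/-- The universal trace, extended to `A~` by zero on the scalars and regarded as a continuous real
linear map. -/
def unitizationTrace (A : Type*) [NonUnitalCStarAlgebra A] :
    Unitization ℂ A →L[ℝ] A ⧸ commutatorClosure A :=
  ((commutatorClosure A).mkQL.restrictScalars ℝ).comp
    ({ toFun := fun x => x.snd
       map_add' := fun _ _ => rfl
       map_smul' := fun _ _ => rfl
       cont := Unitization.continuous_snd } : Unitization ℂ A →L[ℝ] A)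

theorem unitizationTrace_eq_zero_iff {x : Unitization ℂ A} :
    unitizationTrace A x = 0 ↔ x.snd ∈ commutatorClosure A :=
  Submodule.Quotient.mk_eq_zero (commutatorClosure A)

theorem snd_sub (x y : Unitization ℂ A) : (x - y).snd = x.snd - y.snd := by
  rw [sub_eq_add_neg, Unitization.snd_add, Unitization.snd_neg, sub_eq_add_neg]

/-- The quotient map `A~ → ℂ`. -/
def scalarHom (A : Type*) [NonUnitalCStarAlgebra A] : Unitization ℂ A →⋆ₐ[ℂ] ℂ :=
  { Unitization.fstHom ℂ A with map_star' := fun _ => rfl }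

theorem unitizationTrace_mul_comm (x y : Unitization ℂ A) :
    unitizationTrace A (x * y) = unitizationTrace A (y * x) := by
  rw [← sub_eq_zero, ← map_sub, unitizationTrace_eq_zero_iff]
  refine Submodule.le_topologicalClosure _ (Submodule.subset_span ⟨x.snd, y.snd, ?_⟩)
  rw [snd_sub, Unitization.snd_mul, Unitization.snd_mul]
  abel

theorem fst_expI (h : selfAdjoint A) : (expI h : Unitization ℂ A).fst = 1 :=
  map_expUnitary (scalarHom A) (a := ⟨_, IsSelfAdjoint.inr (R := ℂ) h.2⟩)
    (Unitization.fst_inr ℂ (h : A))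

theorem star_I_smul_inr (h : selfAdjoint A) :
    star (Complex.I • ((h : A) : Unitization ℂ A)) =
      -(Complex.I • ((h : A) : Unitization ℂ A)) := by
  rw [star_smul, ← Unitization.inr_star, h.2.star_eq, Complex.star_def, Complex.conj_I, neg_smul]

/-- A unitary of `A~` near `1` with scalar part `1` is the exponential of a small selfadjoint
element of `A`. -/
theorem exists_expI_eq {u : unitary (Unitization ℂ A)} (hu : ‖(u : Unitization ℂ A) - 1‖ < 2)
    (hu1 : (u : Unitization ℂ A).fst = 1) :
    ∃ c : selfAdjoint A, expI c = u ∧ ‖(c : A)‖ ≤ 2 * ‖(u : Unitization ℂ A) - 1‖ := by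
  set a := Unitary.argSelfAdjoint u with ha
  have h1 : (a : Unitization ℂ A).fst = 0 := by
    have hs : ContinuousOn (fun z : ℂ => (Complex.arg z : ℂ)) (spectrum ℂ (u : Unitization ℂ A)) :=
      Complex.continuous_ofReal.comp_continuousOn (Complex.continuousOn_arg.mono
        ((Unitary.spectrum_subset_slitPlane_iff_norm_lt_two u.2).2 hu))
    have h2 := StarAlgHomClass.map_cfc (scalarHom A) _ (u : Unitization ℂ A) hs
      (map_continuous _) (isStarNormal_of_mem_unitary u.2) ⟨mul_comm _ _⟩
    have h3 : scalarHom A (u : Unitization ℂ A) = 1 := hu1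
    rw [h3] at h2
    refine h2.trans ?_
    simp
  have h2 := eq_inr_snd_of_fst_eq_zero h1
  have hsa : IsSelfAdjoint (a : Unitization ℂ A).snd := by
    have := congrArg (fun x : Unitization ℂ A => x.snd) a.2.star_eq
    rwa [Unitization.snd_star] at this
  refine ⟨⟨(a : Unitization ℂ A).snd, hsa⟩, ?_, ?_⟩
  · rw [expI, ← expUnitary_argSelfAdjoint hu]
    congr 1
    exact Subtype.ext h2.symm
  · rw [← Unitization.norm_inr (𝕜 := ℂ), ← h2]
    exact norm_argSelfAdjoint_le hu

/-- If `d₀` and `d₁` almost commute and add up to `h`, approximately and up to the universal trace,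
then `e^{ih}` is `e^{i d₀} e^{i d₁}` up to the exponential of a small element of trace zero. -/
theorem exists_expI_eq_mul_mul (d₀ d₁ h : selfAdjoint A) {η : ℝ} (hη : η ≤ 1 / 50)
    (hc : ‖(d₀ : A) * d₁ - d₁ * d₀‖ ≤ η) (hs : ‖(h : A) - d₀ - d₁‖ ≤ η)
    (ht : (h : A) - d₀ - d₁ ∈ commutatorClosure A) :
    ∃ c : selfAdjoint A, expI h = expI d₀ * expI d₁ * expI c ∧
      (c : A) ∈ commutatorClosure A ∧ ‖(c : A)‖ ≤ 12 * η := by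
  set a₀ := Complex.I • ((d₀ : A) : Unitization ℂ A) with ha₀
  set a₁ := Complex.I • ((d₁ : A) : Unitization ℂ A) with ha₁
  set b := Complex.I • ((h : A) : Unitization ℂ A) with hb
  have s₀ : star a₀ = -a₀ := star_I_smul_inr d₀
  have s₁ : star a₁ = -a₁ := star_I_smul_inr d₁
  have sb : star b = -b := star_I_smul_inr h
  have hc' : ‖a₀ * a₁ - a₁ * a₀‖ ≤ η := by
    have : a₀ * a₁ - a₁ * a₀ = -(((d₀ : A) * d₁ - d₁ * d₀ : A) : Unitization ℂ A) := by
      rw [ha₀, ha₁, smul_mul_smul_comm, smul_mul_smul_comm, Complex.I_mul_I, ← smul_sub,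
        neg_smul, one_smul, Unitization.inr_sub, Unitization.inr_mul, Unitization.inr_mul]
    rwa [this, norm_neg, Unitization.norm_inr]
  have hs' : ‖b - a₀ - a₁‖ ≤ η := by
    have : b - a₀ - a₁ = Complex.I • (((h : A) - d₀ - d₁ : A) : Unitization ℂ A) := by
      rw [ha₀, ha₁, hb, ← smul_sub, ← smul_sub, Unitization.inr_sub, Unitization.inr_sub]
    rwa [this, norm_smul, Complex.norm_I, one_mul, Unitization.norm_inr]
  have habs : ∀ t ∈ Set.Ioo (-1 : ℝ) 2, |t| ≤ 2 := fun t ht =>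
    abs_le.2 ⟨by linarith [ht.1], ht.2.le⟩
  have hη0 : 0 ≤ η := (norm_nonneg _).trans hs
  have hτ := unitizationTrace_mul_comm (A := A)
  set u := (expI d₁)⁻¹ * (expI d₀)⁻¹ * expI h with hu
  have hinv : ∀ d : selfAdjoint A, (((expI d)⁻¹ : unitary (Unitization ℂ A)) : Unitization ℂ A) =
      NormedSpace.exp ((1 : ℝ) • -(Complex.I • ((d : A) : Unitization ℂ A))) := by
    intro d
    let +nondep : NormedAlgebra ℚ (Unitization ℂ A) := .restrictScalars ℚ ℂ _
    rw [one_smul, ← star_I_smul_inr, ← NormedSpace.star_exp]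
    rfl
  have hu1 : (u : Unitization ℂ A) = splittingPath a₀ a₁ b 1 := by
    rw [splittingPath, ha₀, ha₁, ← hinv, ← hinv, one_smul]
    rfl
  have hu2 : ‖(u : Unitization ℂ A) - 1‖ ≤ 6 * η := by
    rw [hu1]
    exact norm_splittingPath_sub_one_le s₀ s₁ sb hc' hs' (by norm_num)
  have hu3 : (u : Unitization ℂ A).fst = 1 := by
    have h1 : scalarPart A u = 1 := by
      have h2 : ∀ d : selfAdjoint A, scalarPart A (expI d) = 1 := fst_expI
      have h3 : ∀ d : selfAdjoint A, scalarPart A (expI d)⁻¹ = 1 := fun d => by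
        have := map_mul (scalarPart A) (expI d)⁻¹ (expI d)
        rw [inv_mul_cancel, map_one, h2, mul_one] at this
        exact this.symm
      rw [hu, map_mul, map_mul, h2, h3, h3, one_mul, one_mul]
    exact h1
  obtain ⟨c, hcu, hcn⟩ := exists_expI_eq (by linarith) hu3
  refine ⟨c, ?_, ?_, by linarith⟩
  · rw [hcu, hu]; group
  -- the trace of the logarithm of `u` is `0` along `splittingPath`, and `i c` along `e^{itc}`
  have l1 : logTrace (unitizationTrace A) ((u : Unitization ℂ A) - 1) = 0 := by
    rw [hu1]
    refine logTrace_sub_one_eq (unitizationTrace A) hτ (m := splittingPathLogDeriv a₀ a₁ b)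
      (r := 6 * η) (M := 3 * η) (by linarith) (splittingPath_zero _ _ _)
      (fun t _ => hasDerivAt_splittingPath _ _ _ t)
      (fun t ht => norm_splittingPath_sub_one_le s₀ s₁ sb hc' hs' (habs t ht))
      (fun t ht => norm_splittingPathLogDeriv_le s₀ sb hc' hs' (habs t ht)) fun t => ?_
    rw [splittingPathLogDeriv, map_sub, mul_assoc, hτ, mul_assoc, exp_smul_mul_exp_neg_smul,
      mul_one, map_add, mul_assoc, hτ, mul_assoc, exp_neg_smul_mul_exp_smul, mul_one, ← map_add,
      ← map_sub, unitizationTrace_eq_zero_iff, ← sub_sub]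
    have : (b - a₀ - a₁).snd = Complex.I • ((h : A) - d₀ - d₁) := by
      rw [snd_sub, snd_sub, ha₀, ha₁, hb, smul_sub, smul_sub]
      rfl
    rw [this]
    exact Submodule.smul_mem _ _ ht
  have sc := star_I_smul_inr c
  have hcn' : ‖Complex.I • ((c : A) : Unitization ℂ A)‖ ≤ 12 * η := by
    rw [norm_smul, Complex.norm_I, one_mul, Unitization.norm_inr]
    linarith
  have l2 : logTrace (unitizationTrace A) ((u : Unitization ℂ A) - 1) =
      unitizationTrace A (Complex.I • ((c : A) : Unitization ℂ A)) := by
    have e1 : (u : Unitization ℂ A) =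
        NormedSpace.exp ((1 : ℝ) • (Complex.I • ((c : A) : Unitization ℂ A))) := by
      rw [← hcu, one_smul]; rfl
    rw [e1]
    refine logTrace_sub_one_eq (unitizationTrace A) hτ
      (g := fun t => NormedSpace.exp (t • (Complex.I • ((c : A) : Unitization ℂ A))))
      (m := fun _ => Complex.I • ((c : A) : Unitization ℂ A))
      (r := 24 * η) (by linarith) (by simp)
      (fun t _ => hasDerivAt_exp_smul_const _ t) (fun t ht => ?_) (fun _ _ => le_rfl) fun _ => rfl
    refine (norm_exp_smul_sub_one_le sc t).trans ?_
    have := mul_le_mul hcn' (habs t ht) (abs_nonneg t) (by positivity)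
    linarith
  rw [l1] at l2
  have h1 := unitizationTrace_eq_zero_iff.1 l2.symm
  rw [Unitization.snd_smul, Unitization.snd_inr] at h1
  have h2 := Submodule.smul_mem _ (-Complex.I) h1
  rwa [smul_smul, neg_mul, Complex.I_mul_I, neg_neg, one_smul] at h2

end Unitization

end Splitting

/-! ### Products of commutators in `U⁰(A)` -/

section Products

variable {A : Type*} [NonUnitalCStarAlgebra A]

theorem expI_zero : expI (0 : selfAdjoint A) = 1 := by
  have h : (⟨(((0 : selfAdjoint A) : A) : Unitization ℂ A), IsSelfAdjoint.inr (R := ℂ)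
      (0 : selfAdjoint A).2⟩ : selfAdjoint (Unitization ℂ A)) = 0 :=
    Subtype.ext (Unitization.inr_zero ℂ)
  rw [expI, h, selfAdjoint.expUnitary_zero]

theorem expI_add {a b : selfAdjoint A} (hab : Commute (a : A) b) :
    expI (a + b) = expI a * expI b := by
  have h : Commute ((a : A) : Unitization ℂ A) ((b : A) : Unitization ℂ A) := by
    rw [Commute, SemiconjBy, ← Unitization.inr_mul, ← Unitization.inr_mul, hab.eq]
  rw [expI, expI, expI, ← Commute.expUnitary_add h]
  congr 1
  exact Subtype.ext (Unitization.inr_add ℂ _ _)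

theorem exists_commutator_eq_expI_selfCommutator {x : A} (hx : x * x = 0) :
    ∃ v w : unitary (Unitization ℂ A), v ∈ U0 A ∧ w ∈ U0 A ∧
      ⁅v, w⁆ = expI ⟨selfCommutator x, isSelfAdjoint_selfCommutator x⟩ ∧
      (‖x‖ ^ 2 ≤ 8 / 3 → ‖(v : Unitization ℂ A) - 1‖ ^ 2 ≤ 3 / 4 * ‖x‖ ^ 2 ∧
        ‖(w : Unitization ℂ A) - 1‖ ^ 2 ≤ 3 / 4 * ‖x‖ ^ 2) := by
  obtain ⟨v, w, hv, hw, hvw, hχ, hn⟩ := exists_commutator_eq_expUnitary_selfCommutator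
    (x := (x : Unitization ℂ A)) (by rw [← Unitization.inr_mul, hx, Unitization.inr_zero])
  obtain ⟨hv1, hw1⟩ := hχ (scalarHom A) (Unitization.fst_inr ℂ x)
  rw [Unitization.norm_inr] at hn
  refine ⟨v, w, ⟨hv, hv1⟩, ⟨hw, hw1⟩, ?_, hn⟩
  rw [hvw, expI]
  congr 1
  apply Subtype.ext
  change selfCommutator (x : Unitization ℂ A) = (selfCommutator x : A)
  rw [selfCommutator, selfCommutator, Unitization.inr_sub, Unitization.inr_mul,
    Unitization.inr_mul, Unitization.inr_star]

variable [PartialOrder A] [StarOrderedRing A]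

/-- The factorization of `e^{ih}`, with the distances of the unitaries to `1` controlled by
`‖h‖`. -/
theorem exists_commutators_mul_expI (hA : NuclearDimensionLE A 1) (h : selfAdjoint A)
    (hh : (h : A) ∈ commutatorClosure A) {δ ε : ℝ} (hδ : 0 < δ) (hε : 0 < ε) :
    ∃ (v w : Fin 4 → unitary (Unitization ℂ A)) (c : selfAdjoint A),
      (∀ j, v j ∈ U0 A ∧ w j ∈ U0 A) ∧
      expI h = (List.ofFn fun j => ⁅v j, w j⁆).prod * expI c ∧
      (c : A) ∈ commutatorClosure A ∧ ‖(c : A)‖ < ε ∧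
      (‖(h : A)‖ + δ ≤ 8 / 3 → ∀ j,
        ‖(v j : Unitization ℂ A) - 1‖ ^ 2 ≤ 3 / 4 * (‖(h : A)‖ + δ) ∧
        ‖(w j : Unitization ℂ A) - 1‖ ^ 2 ≤ 3 / 4 * (‖(h : A)‖ + δ)) := by
  set η := min δ (min (1 / 50) (ε / 24)) with hη
  have hη0 : 0 < η := lt_min hδ (lt_min (by norm_num) (by positivity))
  have hηδ : η ≤ δ := min_le_left _ _
  have hη1 : η ≤ 1 / 50 := (min_le_right _ _).trans (min_le_left _ _)
  have hηε : η ≤ ε / 24 := (min_le_right _ _).trans (min_le_right _ _)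
  obtain ⟨x, z, hxz, hcomm, hsum⟩ := exists_selfCommutators_near hA h.2 hh hη0
  let X : Fin 2 → selfAdjoint A := fun i =>
    ⟨selfCommutator (x i), isSelfAdjoint_selfCommutator _⟩
  let Z : Fin 2 → selfAdjoint A := fun i =>
    ⟨selfCommutator (z i), isSelfAdjoint_selfCommutator _⟩
  have hmem : ∀ i, ((X i + Z i : selfAdjoint A) : A) ∈ commutatorClosure A := fun i =>
    add_mem (selfCommutator_mem_commutatorClosure _) (selfCommutator_mem_commutatorClosure _)
  obtain ⟨c, hc, hcm, hcn⟩ := exists_expI_eq_mul_mul (X 0 + Z 0) (X 1 + Z 1) h hη1 hcomm hsum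
    (sub_mem (sub_mem hh (hmem 0)) (hmem 1))
  choose v w hv hw hvw hn using fun i => exists_commutator_eq_expI_selfCommutator (hxz i).1
  choose v' w' hv' hw' hvw' hn' using fun i => exists_commutator_eq_expI_selfCommutator (hxz i).2.1
  refine ⟨![v 0, v' 0, v 1, v' 1], ![w 0, w' 0, w 1, w' 1], c, ?_, ?_, hcm, by linarith, ?_⟩
  · intro j
    fin_cases j
    exacts [⟨hv 0, hw 0⟩, ⟨hv' 0, hw' 0⟩, ⟨hv 1, hw 1⟩, ⟨hv' 1, hw' 1⟩]
  · rw [hc, expI_add (hxz 0).2.2.2.2, expI_add (hxz 1).2.2.2.2]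
    simp [List.ofFn_succ, hvw, hvw', X, Z, mul_assoc]
  · intro hle
    have h1 : ∀ i, ‖(v i : Unitization ℂ A) - 1‖ ^ 2 ≤ 3 / 4 * (‖(h : A)‖ + δ) ∧
        ‖(w i : Unitization ℂ A) - 1‖ ^ 2 ≤ 3 / 4 * (‖(h : A)‖ + δ) := fun i => by
      have h2 := (hxz i).2.2.1
      have h3 := hn i (by linarith)
      exact ⟨by linarith, by linarith⟩
    have h1' : ∀ i, ‖(v' i : Unitization ℂ A) - 1‖ ^ 2 ≤ 3 / 4 * (‖(h : A)‖ + δ) ∧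
        ‖(w' i : Unitization ℂ A) - 1‖ ^ 2 ≤ 3 / 4 * (‖(h : A)‖ + δ) := fun i => by
      have h2 := (hxz i).2.2.2.1
      have h3 := hn' i (by linarith)
      exact ⟨by linarith, by linarith⟩
    intro j
    fin_cases j
    exacts [h1 0, h1' 0, h1 1, h1' 1]

/-- The value of `‖e^{ih} - 1‖` is `2 sin (‖h‖ / 2)`.  Since `sin s ≥ s (1 - s² / 4)` for
`0 < s ≤ 1`, it is at least `(33/40) ‖h‖` if `‖h‖ < π / 2`. -/
theorem mul_norm_le_norm_expI_sub_one {A : Type*} [NonUnitalCStarAlgebra A] (h : selfAdjoint A)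
    (hh : ‖(h : A)‖ < Real.pi / 2) :
    33 / 40 * ‖(h : A)‖ ≤ ‖(expI h : Unitization ℂ A) - 1‖ := by
  have hpi := Real.pi_lt_d2
  have h1 : ‖(expI h : Unitization ℂ A) - 1‖ ^ 2 = 2 * (1 - Real.cos ‖(h : A)‖) := by
    rw [← Unitization.norm_inr (𝕜 := ℂ) (h : A)]
    refine selfAdjoint.norm_sq_expUnitary_sub_one ?_
    change ‖((h : A) : Unitization ℂ A)‖ ≤ Real.pi
    rw [Unitization.norm_inr]
    linarith [Real.pi_pos]
  rcases (norm_nonneg (h : A)).eq_or_lt with h0 | h0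
  · rw [← h0, mul_zero]; exact norm_nonneg _
  set s := ‖(h : A)‖ / 2 with hs
  have h2 : ‖(h : A)‖ = 2 * s := by rw [hs]; ring
  have hs0 : 0 < s := by positivity
  have hs1 : s ≤ 315 / 400 := by linarith
  have h3 := Real.sin_gt_sub_cube hs0
  have h4 : 33 / 40 * s ≤ Real.sin s := by
    have : s ^ 2 ≤ 7 / 10 := by nlinarith
    nlinarith
  refine le_of_sq_le_sq ?_ (norm_nonneg _)
  rw [h1, h2, Real.cos_two_mul, Real.cos_sq']
  nlinarith

end Products

end NucOne

end

theorem mainTheorem9 {A : Type*} [NonUnitalCStarAlgebra A] [PartialOrder A] [StarOrderedRing A]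
    (hA : NucOne.NuclearDimensionLE A 1)
    (h : selfAdjoint A) (hh : NucOne.TrEquiv (h : A) 0) (ε : ℝ) (hε : 0 < ε) :
    (∃ (v w : Fin 4 → unitary (Unitization ℂ A)) (c : selfAdjoint A),
      (∀ j, v j ∈ NucOne.U0 A ∧ w j ∈ NucOne.U0 A) ∧
      NucOne.expI h = (List.ofFn fun j => ⁅v j, w j⁆).prod * NucOne.expI c ∧
      NucOne.TrEquiv (c : A) 0 ∧ ‖(c : A)‖ < ε) ∧
    (‖(h : A)‖ < Real.pi / 2 →
      ∃ (v w : Fin 4 → unitary (Unitization ℂ A)) (c : selfAdjoint A),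
        (∀ j, v j ∈ NucOne.U0 A ∧ w j ∈ NucOne.U0 A) ∧
        NucOne.expI h = (List.ofFn fun j => ⁅v j, w j⁆).prod * NucOne.expI c ∧
        NucOne.TrEquiv (c : A) 0 ∧ ‖(c : A)‖ < ε ∧
        ∀ j,
          ‖(v j : Unitization ℂ A) - 1‖
            ≤ ‖(NucOne.expI h : Unitization ℂ A) - 1‖ ^ (1 / 2 : ℝ) ∧
          ‖(w j : Unitization ℂ A) - 1‖
            ≤ ‖(NucOne.expI h : Unitization ℂ A) - 1‖ ^ (1 / 2 : ℝ)) := by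
  have hh' := NucOne.trEquiv_zero_iff.1 hh
  simp only [NucOne.trEquiv_zero_iff]
  refine ⟨?_, fun hlt => ?_⟩
  · obtain ⟨v, w, c, hvw, hc, hcm, hcε, -⟩ :=
      NucOne.exists_commutators_mul_expI hA h hh' one_pos hε
    exact ⟨v, w, c, hvw, hc, hcm, hcε⟩
  rcases (norm_nonneg (h : A)).eq_or_lt with h0 | h0
  · obtain rfl : h = 0 := Subtype.ext (norm_eq_zero.1 h0.symm)
    refine ⟨fun _ => 1, fun _ => 1, 0, fun _ => ⟨one_mem _, one_mem _⟩, ?_, zero_mem _, ?_,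
      fun _ => ?_⟩
    · simp [NucOne.expI_zero]
    · simpa using hε
    · simp only [OneMemClass.coe_one, sub_self, norm_zero, and_self]
      positivity
  -- with `δ = ‖h‖ / 10`, the bound `3 / 4 * (‖h‖ + δ)` is exactly `33 / 40 * ‖h‖`; for `h = 0`,
  -- where no such `δ` is positive, all unitaries were taken to be `1`
  have hpi := Real.pi_lt_four
  obtain ⟨v, w, c, hvw, hc, hcm, hcε, hn⟩ := NucOne.exists_commutators_mul_expI hA h hh'
    (δ := ‖(h : A)‖ / 10) (by positivity) hε
  have hN := NucOne.mul_norm_le_norm_expI_sub_one h hlt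
  have key : ∀ u : Unitization ℂ A, ‖u - 1‖ ^ 2 ≤ 3 / 4 * (‖(h : A)‖ + ‖(h : A)‖ / 10) →
      ‖u - 1‖ ≤ ‖(NucOne.expI h : Unitization ℂ A) - 1‖ ^ (1 / 2 : ℝ) := by
    intro u hu
    rw [← Real.sqrt_eq_rpow]
    exact Real.le_sqrt_of_sq_le (by linarith)
  have hn' := hn (by linarith)
  exact ⟨v, w, c, hvw, hc, hcm, hcε, fun j => ⟨key _ (hn' j).1, key _ (hn' j).2⟩⟩
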